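/- A finite simple graph is *chordal* if each of its cycles of length at least $4$ has a chord, and *split* if its vertex set is a disjoint union of a clique and an independent set. For a graph $G$ on $[n]=\{1,\dots,n\}$ let $c_G\in\mathbb{R}^{\{S\subseteq[n]\,:\,|S|\ge 2\}}$ be its characteristic imset, $c_G(S)=1$ if $S$ is a clique of $G$ and $c_G(S)=0$ otherwise, and let the chordal graph polytope be $$\mathrm{CGP}_n=\operatorname{conv}\bigl(c_G : G \text{ is a chordal graph on } [n]\bigr).$$ Two distinct vertices $\alpha,\beta$ of a polytope $P$ *fulfill the rhombus criterion* in $P$ if either $\operatorname{conv}(\alpha,\beta)$ is an edge of $P$, or there are vertices $\alpha',\beta'$ of $P$, both different from $\alpha$ and from $\beta$, such that $\alpha+\beta=\alpha'+\beta'$. **Theorem.** (1) For every $n$ and any two distinct split graphs $G$ and $H$ on $[n]$, the characteristic imsets $c_G$ and $c_H$ are vertices of $\mathrm{CGP}_n$ and they fulfill the rhombus criterion in $\mathrm{CGP}_n$. (2) Asymptotically almost all pairs of vertices of $\mathrm{CGP}_n$ fulfill the rhombus criterion: the number of pairs of distinct vertices of $\mathrm{CGP}_n$ that fulfill the rhombus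 criterion in $\mathrm{CGP}_n$, divided by the number of all pairs of distinct vertices of $\mathrm{CGP}_n$, tends to $1$ as $n\to\infty$. -/

import Mathlib

open Filter Topology

/-- A graph is chordal if every cycle of length at least four has a chord. -/
def IsChordalGraph {V : Type*} (G : SimpleGraph V) : Prop :=
  ∀ (v : V) (p : G.Walk v v), p.IsCycle → 4 ≤ p.length → ∃ e : Sym2 V, p.IsChord e

/-- A graph is split if its vertex set is the disjoint union of a clique `K` and an
independent set `Kᶜ` (either part may be empty). -/
def IsSplitGraph {V : Type*} (G : SimpleGraph V) : Prop :=
  ∃ K : Set V, G.IsClique K ∧ G.IsIndepSet Kᶜ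

/-- The ambient space `ℝ^(2^n - n - 1)`: real functions on the subsets of `[n]` with at least two
elements. -/
abbrev ImsetSpace (n : ℕ) : Type := {S : Finset (Fin n) // 2 ≤ S.card} → ℝ

open Classical in
/-- The characteristic imset of an undirected graph: `c_G(S) = 1` if `S` is complete in `G`, and
`c_G(S) = 0` otherwise. -/
noncomputable def charImset {n : ℕ} (G : SimpleGraph (Fin n)) : ImsetSpace n :=
  fun S => if G.IsClique (S.1 : Set (Fin n)) then 1 else 0

/-- The chordal graph polytope: the convex hull of the characteristic imsets of all chordal graphs
on `[n]`. -/
def chordalGraphPolytope (n : ℕ) : Set (ImsetSpace n) :=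
  convexHull ℝ {x | ∃ G : SimpleGraph (Fin n), IsChordalGraph G ∧ charImset G = x}

/-- `conv(α, β)` is an edge of the polytope `P`: it is a one-dimensional face, a face being the set
of maximizers in `P` of some linear functional. -/
def IsPolytopeEdge {E : Type*} [AddCommGroup E] [Module ℝ E] [TopologicalSpace E]
    (P : Set E) (α β : E) : Prop :=
  α ≠ β ∧ IsExposed ℝ P (convexHull ℝ {α, β})

/-- `α'` and `β'` are witnesses of the rhombus criterion for the pair `α`, `β`: they are vertices
of `P` other than `α`, `β`, and `α + β = α' + β'`. -/
def IsRhombusWitness {E : Type*} [AddCommGroup E] [Module ℝ E]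
    (P : Set E) (α β α' β' : E) : Prop :=
  α' ∈ P.extremePoints ℝ \ {α, β} ∧ β' ∈ P.extremePoints ℝ \ {α, β} ∧ α + β = α' + β'

/-- The pair `α`, `β` fulfills the rhombus criterion in `P`: it is an edge or it has witnesses. -/
def FulfillsRhombus {E : Type*} [AddCommGroup E] [Module ℝ E] [TopologicalSpace E]
    (P : Set E) (α β : E) : Prop :=
  IsPolytopeEdge P α β ∨ ∃ α' β' : E, IsRhombusWitness P α β α' β'

/-- The proportion of the (ordered) pairs of distinct vertices of `P` that fulfill the rhombus
criterion in `P`. The criterion is symmetric, so unordered pairs give the same proportion. -/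
noncomputable def rhombusProportion {E : Type*} [AddCommGroup E] [Module ℝ E] [TopologicalSpace E]
    (P : Set E) : ℝ :=
  ({p ∈ (P.extremePoints ℝ).offDiag | FulfillsRhombus P p.1 p.2}.ncard : ℝ) /
    ((P.extremePoints ℝ).offDiag.ncard : ℝ)

/-!
# The rhombus criterion for chordal graph polytopes

All imsets `charImset G` are points with coordinates `0` and `1`, so each chordal graph gives a
vertex of the polytope. Let `G` and `H` be different split graphs with cliques `K` and `L` and
independent complements. `IsOnFace G H D` says that the chordal graph `D` lies on the smallest face
containing `G` and `H`; if there are only two such graphs, this face is an edge. Otherwise a pair of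
chordal graphs `D`, `E` is wanted that shares out the edges and the cliques of `G` and `H`
(`IsExchange`), since then `charImset G + charImset H = charImset D + charImset E`. There are four
kinds of such exchanges.

* The neighbourhoods of a vertex `d` outside `K` and `L` are exchanged, if each of them is a clique
  in both graphs (`IsSplitPair.fulfillsRhombus_of_vertex`; the case that `G` and `H` differ only at
  `d` is `IsSplitPair.fulfillsRhombus_of_eq_off`).
* A single edge is exchanged that attaches a satellite, a vertex outside `K`, to a vertex of `K`
  (`IsSatellite.fulfillsRhombus`).
* A cycle of such edges is exchanged, alternately of `G` and of `H`
  (`IsSatelliteCycle.fulfillsRhombus`).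
* The main edges of both graphs go to `D` and the other edges to `E` (`IsMainJoin.fulfillsRhombus`).
  Main are the edges in `K` and those at vertices whose neighbourhood in `G` is not a clique of `H`,
  and likewise for `H`. This works if no vertex and no cycle can be exchanged, some chordal graph
  contains the main edges of both graphs and has no clique that is a clique of neither, and the
  exchange does not just give `G` and `H`.

Suppose that no exchange is possible. An edge of `G` outside `H` that is not main and lies in a
graph on the face containing the clique `L` is attached at a satellite `v`, and its other end is a
satellite in `H` of the same nature (`IsFaceSatellite.exists_isSatellite`). Following these edges
one would find a cycle of satellites, so there are no such edges. What remains on the face is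
controlled by two facts: the edges of a clique of `G` that are missing in `H` occur together
(`IsOnFace.isClique_of_adj`), and an edge of only `G` and an edge of only `H` cannot be missing
together in one graph on the face without occurring together in another
(`exists_isOnFace_adj_adj`). Hence the face contains only `G` and `H`
(`IsSplitPair.fulfillsRhombus`).

For the second part it remains to see that almost all chordal graphs are split. Let `K` be a largest
clique, with `k` vertices, and `r = n - k`. The graph is built from `K` by adding each vertex `v`
with a clique as neighbourhood, and it is coded by the last neighbour of `v` outside `K` together
with positions for its other neighbours, which lie in `K` or in the neighbourhood of this last
neighbour (`IsConstruction.eq_of_constructionCode_eq`). If no vertex has such a last neighbour, the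
graph is split, and there are `2 ^ (k * r)` codes of this kind. Choosing neighbours relative to a
vertex with few neighbours gives few possibilities, while a vertex with nearly `k` neighbours has
itself few possibilities; so the other codes are negligible if `k` is at least `2 * n / 5`
(`ncard_nonsplitChordal_le_of_le`). For smaller `k` the trivial bound on the number of codes
suffices, as `k * r` is much smaller than `n ^ 2 / 4`. A split graph has at most `(n + 1) ^ 2`
partitions, so the sum of `2 ^ (k * r)` over all `K` is bounded by a polynomial times the number of
split graphs (`sum_two_pow_le`).
-/

/-! ### Chordal graphs and simplicial elimination -/

section Chordality

variable {V : Type*} {G : SimpleGraph V}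

/-- The neighbours of `s` inside `T` are pairwise adjacent: `s` is simplicial in the graph induced
on `T`. The vertex `s` itself need not lie in `T`. -/
def IsSimplicialIn (G : SimpleGraph V) (T : Set V) (s : V) : Prop :=
  ∀ u ∈ T, ∀ w ∈ T, G.Adj s u → G.Adj s w → u ≠ w → G.Adj u w

/-- Two neighbours of `x` that are joined by a walk avoiding `x` and its other neighbours are
adjacent: a shortest such walk closes up through `x` to a cycle without chords. -/
lemma IsChordalGraph.adj_of_walk_avoiding (hG : IsChordalGraph G) {x s t : V} (hs : G.Adj x s)
    (ht : G.Adj x t) (hst : s ≠ t) {Y : Set V} (hY : ∀ y ∈ Y, y ≠ x ∧ ¬ G.Adj x y)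
    (h : ∃ p : G.Walk s t, ∀ z ∈ p.support, z ∈ Y ∨ z = s ∨ z = t) : G.Adj s t := by
  classical
  by_contra hnadj
  let Q : ℕ → Prop := fun n => ∃ p : G.Walk s t, (∀ z ∈ p.support, z ∈ Y ∨ z = s ∨ z = t) ∧
    p.length = n
  have hQ : ∃ n, Q n := by obtain ⟨p, hp⟩ := h; exact ⟨_, p, hp, rfl⟩
  obtain ⟨p₀, hp₀, hl₀⟩ := Nat.find_spec hQ
  have hmin : ∀ q : G.Walk s t, (∀ z ∈ q.support, z ∈ Y ∨ z = s ∨ z = t) →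
      Nat.find hQ ≤ q.length := fun q hq => Nat.find_min' hQ ⟨q, hq, rfl⟩
  obtain ⟨p, hpath, hsupp, hlen⟩ : ∃ p : G.Walk s t, p.IsPath ∧
      (∀ z ∈ p.support, z ∈ Y ∨ z = s ∨ z = t) ∧ p.length = Nat.find hQ := by
    refine ⟨p₀.bypass, p₀.bypass_isPath,
      fun z hz => hp₀ z (p₀.support_bypass_subset_support hz), ?_⟩
    apply le_antisymm
    · rw [← hl₀]; exact p₀.length_bypass_le_length
    · exact hmin _ fun z hz => hp₀ z (p₀.support_bypass_subset_support hz)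
  have hx : x ∉ p.support := by
    intro hx
    rcases hsupp x hx with h | h | h
    · exact (hY x h).1 rfl
    · exact hs.ne h
    · exact ht.ne h
  have hlen2 : 2 ≤ p.length := by
    by_contra hlt
    have : p.length = 0 ∨ p.length = 1 := by omega
    rcases this with h | h
    · exact hst (SimpleGraph.Walk.eq_of_length_eq_zero h)
    · exact hnadj (SimpleGraph.Walk.adj_of_length_eq_one h)
  let c : G.Walk x x := SimpleGraph.Walk.cons hs (p.concat ht.symm)
  have hc : c.IsCycle := by
    rw [SimpleGraph.Walk.cons_isCycle_iff]
    refine ⟨hpath.concat hx ht.symm, ?_⟩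
    rw [SimpleGraph.Walk.edges_concat]
    simp only [List.concat_eq_append, List.mem_append, List.mem_singleton, not_or]
    refine ⟨fun h => hx (p.fst_mem_support_of_mem_edges h), ?_⟩
    intro h
    rw [Sym2.eq_iff] at h
    rcases h with ⟨h1, h2⟩ | ⟨h1, h2⟩
    · exact ht.ne h1
    · exact hst h2
  have hcl : c.length = p.length + 2 := by
    simp [c, SimpleGraph.Walk.length_concat]
  obtain ⟨e, he⟩ := hG x c hc (by omega)
  induction e using Sym2.ind with
  | _ u w =>
  rw [SimpleGraph.Walk.isChord_sym2Mk] at he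
  obtain ⟨hadj, hne, hu, hw⟩ := he
  have hce : ∀ e, e ∈ c.edges ↔ e = s(x, s) ∨ e ∈ p.edges ∨ e = s(t, x) := by
    intro e
    simp [c, SimpleGraph.Walk.edges_concat]
  have hcs : ∀ z, z ∈ c.support ↔ z = x ∨ z ∈ p.support := by
    intro z
    simp [c, SimpleGraph.Walk.support_concat]
    tauto
  have hxs : ∀ z, z ∈ p.support → G.Adj x z → s(x, z) ∈ c.edges := by
    intro z hz hadj
    rw [hce]
    rcases hsupp z hz with h | rfl | rfl
    · exact absurd hadj (hY z h).2
    · exact Or.inl rfl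
    · exact Or.inr (Or.inr Sym2.eq_swap)
  rw [hcs] at hu hw
  rcases hu with rfl | hu
  · rcases hw with rfl | hw
    · exact hadj.ne rfl
    · exact hne (hxs _ hw hadj)
  rcases hw with rfl | hw
  · exact hne (Sym2.eq_swap ▸ hxs _ hu hadj.symm)
  -- a chord of the walk itself would shorten it
  have key : ∀ i j, i < j → j ≤ p.length → G.Adj (p.getVert i) (p.getVert j) →
      s(p.getVert i, p.getVert j) ∈ p.edges := by
    intro i j hij hj ha
    by_cases hj1 : j = i + 1
    · rw [← SimpleGraph.Walk.mem_edges_toSubgraph, SimpleGraph.Subgraph.mem_edgeSet, hj1]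
      exact p.toSubgraph_adj_getVert (by omega)
    · exfalso
      let q : G.Walk s t := (p.take i).append (SimpleGraph.Walk.cons ha (p.drop j))
      have := hmin q (by
        intro z hz
        apply hsupp
        rw [SimpleGraph.Walk.mem_support_append_iff, SimpleGraph.Walk.support_cons,
          List.mem_cons] at hz
        rcases hz with hz | rfl | hz
        · exact (p.isSubwalk_take i).support_subset hz
        · exact p.getVert_mem_support i
        · exact (p.isSubwalk_drop j).support_subset hz)
      have hq : q.length = i + 1 + (p.length - j) := by
        simp [q, SimpleGraph.Walk.take_length, SimpleGraph.Walk.drop_length]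
        omega
      omega
  rw [SimpleGraph.Walk.mem_support_iff_exists_getVert] at hu hw
  obtain ⟨i, rfl, hi⟩ := hu
  obtain ⟨j, rfl, hj⟩ := hw
  rcases lt_trichotomy i j with h | h | h
  · exact hne ((hce _).2 (Or.inr (Or.inl (key i j h hj hadj))))
  · subst h; exact hadj.ne rfl
  · exact hne ((hce _).2 (Or.inr (Or.inl (Sym2.eq_swap ▸ key j i h hi hadj.symm))))

/-- Dirac's theorem in the form used throughout: in every induced subgraph of a chordal graph,
outside a given clique that is not everything, there is a simplicial vertex. -/
theorem IsChordalGraph.exists_simplicial (hG : IsChordalGraph G) (T : Finset V) (K : Set V)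
    (hK : ∀ u ∈ T, ∀ w ∈ T, u ∈ K → w ∈ K → u ≠ w → G.Adj u w) (hT : ∃ v ∈ T, v ∉ K) :
    ∃ s ∈ T, s ∉ K ∧ IsSimplicialIn G T s := by
  classical
  induction T using Finset.strongInduction generalizing K with
  | _ T ih =>
  by_cases hcomp : ∀ u ∈ T, ∀ w ∈ T, u ≠ w → G.Adj u w
  · obtain ⟨v, hv, hvK⟩ := hT
    exact ⟨v, hv, hvK, fun u hu w hw _ _ h => hcomp u hu w hw h⟩
  -- a vertex `x` that is not adjacent to all others, taken in `K` if possible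
  obtain ⟨x, hx, y₀, hy₀, hxy, hnadj, hxK⟩ : ∃ x ∈ T, ∃ y ∈ T, x ≠ y ∧ ¬ G.Adj x y ∧
      (x ∈ K ∨ ∀ u ∈ T, u ∈ K → ∀ w ∈ T, u ≠ w → G.Adj u w) := by
    by_cases h : ∀ u ∈ T, u ∈ K → ∀ w ∈ T, u ≠ w → G.Adj u w
    · push Not at hcomp
      obtain ⟨x, hx, y, hy, h1, h2⟩ := hcomp
      exact ⟨x, hx, y, hy, h1, h2, Or.inr h⟩
    · push Not at h
      obtain ⟨x, hx, hxK, y, hy, h1, h2⟩ := h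
      exact ⟨x, hx, y, hy, h1, h2, Or.inl hxK⟩
  let A : Set V := {v | v ∈ T ∧ v ≠ x ∧ ¬ G.Adj x v}
  -- the component of `y₀` among the non-neighbours of `x`, and its neighbourhood
  let Y : Finset V := T.filter fun y => ∃ p : G.Walk y₀ y, ∀ z ∈ p.support, z ∈ A
  let S : Finset V := T.filter fun s => G.Adj x s ∧ ∃ y ∈ Y, G.Adj s y
  have hYA : ∀ y ∈ Y, y ∈ A := by
    intro y hy
    obtain ⟨_, p, hp⟩ := Finset.mem_filter.1 hy
    exact hp y p.end_mem_support
  have hy₀Y : y₀ ∈ Y := by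
    refine Finset.mem_filter.2 ⟨hy₀, SimpleGraph.Walk.nil, ?_⟩
    simp only [SimpleGraph.Walk.support_nil, List.mem_singleton, forall_eq]
    exact ⟨hy₀, hxy.symm, hnadj⟩
  have hSclique : ∀ u ∈ S, ∀ w ∈ S, u ≠ w → G.Adj u w := by
    intro u hu w hw huw
    obtain ⟨huT, hxu, y, hy, huy⟩ := Finset.mem_filter.1 hu
    obtain ⟨hwT, hxw, y', hy', hwy'⟩ := Finset.mem_filter.1 hw
    obtain ⟨_, p, hp⟩ := Finset.mem_filter.1 hy
    obtain ⟨_, p', hp'⟩ := Finset.mem_filter.1 hy'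
    refine hG.adj_of_walk_avoiding hxu hxw huw (Y := A) (fun y hy => hy.2)
      ⟨SimpleGraph.Walk.cons huy ((p.reverse.append p').concat hwy'.symm), ?_⟩
    intro z hz
    simp only [SimpleGraph.Walk.support_cons, SimpleGraph.Walk.support_concat, List.mem_cons,
      List.mem_append, SimpleGraph.Walk.mem_support_append_iff,
      SimpleGraph.Walk.support_reverse, List.mem_reverse] at hz
    rcases hz with rfl | (hz | hz) | hz
    · exact Or.inr (Or.inl rfl)
    · exact Or.inl (hp z hz)
    · exact Or.inl (hp' z hz)
    · simp at hz
      exact Or.inr (Or.inr hz)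
  have hsub : Y ∪ S ⊂ T := by
    refine (Finset.ssubset_iff_of_subset ?_).2 ⟨x, hx, ?_⟩
    · exact Finset.union_subset (Finset.filter_subset _ _) (Finset.filter_subset _ _)
    · intro h
      rcases Finset.mem_union.1 h with h | h
      · exact (hYA x h).2.1 rfl
      · exact (Finset.mem_filter.1 h).2.1.ne rfl
  have hYS : ∀ y ∈ Y, y ∉ S := fun y hy hS => (hYA y hy).2.2 (Finset.mem_filter.1 hS).2.1
  obtain ⟨z, hz, hzS, hsimp⟩ := ih (Y ∪ S) hsub (S : Set V)
    (fun u _ w _ hu hw h => hSclique u hu w hw h)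
    ⟨y₀, Finset.mem_union_left _ hy₀Y, hYS y₀ hy₀Y⟩
  have hzY : z ∈ Y := (Finset.mem_union.1 hz).resolve_right hzS
  have hzA := hYA z hzY
  have hnb : ∀ w ∈ T, G.Adj z w → w ∈ Y ∪ S := by
    intro w hw hzw
    by_cases hxw : G.Adj x w
    · exact Finset.mem_union_right _ (Finset.mem_filter.2 ⟨hw, hxw, z, hzY, hzw.symm⟩)
    · apply Finset.mem_union_left
      obtain ⟨_, p, hp⟩ := Finset.mem_filter.1 hzY
      refine Finset.mem_filter.2 ⟨hw, p.concat hzw, ?_⟩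
      intro v hv
      rw [SimpleGraph.Walk.support_concat] at hv
      simp only [List.mem_append, List.mem_singleton] at hv
      rcases hv with hv | rfl
      · exact hp v hv
      · refine ⟨hw, ?_, hxw⟩
        rintro rfl
        exact hzA.2.2 hzw.symm
  refine ⟨z, hzA.1, ?_, fun u hu w hw h1 h2 h =>
    hsimp u (hnb u hu h1) w (hnb w hw h2) h1 h2 h⟩
  intro hzK
  rcases hxK with h | h
  · exact hzA.2.2 (hK x hx z hzA.1 h hzK hzA.2.1.symm)
  · exact hzA.2.2 (h z hzA.1 hzK x hx hzA.2.1).symm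

/-- The converse: a graph all of whose finite induced subgraphs have a simplicial vertex is
chordal. -/
theorem isChordalGraph_of_exists_simplicial
    (h : ∀ T : Finset V, T.Nonempty → ∃ s ∈ T, IsSimplicialIn G T s) : IsChordalGraph G := by
  classical
  intro v p hp hl
  obtain ⟨s, hs, hsimp⟩ := h p.support.toFinset ⟨v, by simp⟩
  have hs' : s ∈ p.support := by simpa using hs
  let c := p.rotate s hs'
  have hc : c.IsCycle := hp.rotate hs'
  have hcl : c.length = p.length := by
    rw [← SimpleGraph.Walk.length_edges, ← SimpleGraph.Walk.length_edges]
    exact (p.rotate_edges s hs').perm.length_eq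
  have hmem : ∀ z, z ∈ c.support → z ∈ p.support := fun z hz =>
    (p.mem_support_rotate_iff s hs').1 hz
  have h1 : G.Adj s c.snd := c.adj_snd hc.not_nil
  have h2 : G.Adj c.penultimate s := c.adj_penultimate hc.not_nil
  have h1m : c.snd ∈ c.support := c.getVert_mem_support 1
  have h2m : c.penultimate ∈ c.support := c.getVert_mem_support _
  have hadj : G.Adj c.snd c.penultimate := by
    refine hsimp _ ?_ _ ?_ h1 h2.symm hc.snd_ne_penultimate
    · simpa using hmem _ h1m
    · simpa using hmem _ h2m
  refine ⟨s(c.snd, c.penultimate), ?_⟩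
  rw [SimpleGraph.Walk.isChord_sym2Mk]
  refine ⟨hadj, ?_, hmem _ h1m, hmem _ h2m⟩
  intro he
  have he' : s(c.snd, c.penultimate) ∈ c.edges := (p.rotate_edges s hs').perm.mem_iff.2 he
  rw [← SimpleGraph.Walk.mem_edges_toSubgraph, SimpleGraph.Subgraph.mem_edgeSet,
    SimpleGraph.Walk.toSubgraph_adj_iff] at he'
  obtain ⟨i, hi, hil⟩ := he'
  have hinj := hc.getVert_injOn
  have hI : ∀ a b, 1 ≤ a → a ≤ c.length → 1 ≤ b → b ≤ c.length → c.getVert a = c.getVert b →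
      a = b := fun a b h1 h2 h3 h4 h => hinj ⟨h1, h2⟩ ⟨h3, h4⟩ h
  rw [Sym2.eq_iff] at hi
  -- the two neighbours of `s` along the cycle have the positions `1` and `length - 1`
  have h0 : c.getVert 0 = c.getVert c.length := by simp
  rcases hi with ⟨ha, hb⟩ | ⟨ha, hb⟩
  · have e2 := hI (i + 1) (c.length - 1) (by omega) (by omega) (by omega) (by omega) hb
    have e1 := hI i 1 (by omega) (by omega) (by omega) (by omega) ha
    omega
  · have e2 := hI (i + 1) 1 (by omega) (by omega) (by omega) (by omega) hb
    have e0 : i = 0 := by omega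
    subst e0
    have e1 := hI c.length (c.length - 1) (by omega) (by omega) (by omega) (by omega)
      (h0.symm.trans ha)
    omega

/-- A perfect elimination scheme with ties: a graph is chordal if its vertices can be ranked so
that the neighbours of each vertex of at least its rank are pairwise adjacent. -/
theorem isChordalGraph_of_rank (r : V → ℕ)
    (h : ∀ v u w, G.Adj v u → G.Adj v w → u ≠ w → r v ≤ r u → r v ≤ r w → G.Adj u w) :
    IsChordalGraph G := by
  apply isChordalGraph_of_exists_simplicial
  intro T hT
  obtain ⟨s, hs, hmin⟩ := T.exists_min_image r hT
  exact ⟨s, hs, fun u hu w hw h1 h2 h3 => h s u w h1 h2 h3 (hmin u hu) (hmin w hw)⟩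

theorem IsSplitGraph.isChordalGraph (hG : IsSplitGraph G) : IsChordalGraph G := by
  classical
  obtain ⟨K, hK, hI⟩ := hG
  apply isChordalGraph_of_rank fun v => if v ∈ K then 1 else 0
  intro v u w hvu hvw huw h1 h2
  by_cases hv : v ∈ K
  · have hu : u ∈ K := by by_contra hu; simp [hv, hu] at h1
    have hw : w ∈ K := by by_contra hw; simp [hv, hw] at h2
    exact hK hu hw huw
  · have hu : u ∈ K := by by_contra hu; exact hI hv hu hvu.ne hvu
    have hw : w ∈ K := by by_contra hw; exact hI hv hw hvw.ne hvw
    exact hK hu hw huw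

/-- A chordal graph stays chordal when an edge is removed that lies in a single maximal clique. -/
theorem IsChordalGraph.deleteEdge (hG : IsChordalGraph G) {a b : V} (hab : G.Adj a b)
    (hcl : ∀ u w, G.Adj u a → G.Adj u b → G.Adj w a → G.Adj w b → u ≠ w → G.Adj u w) :
    IsChordalGraph (G.deleteEdges {s(a, b)}) := by
  apply isChordalGraph_of_exists_simplicial
  intro T hT
  have hadj : ∀ u w, (G.deleteEdges {s(a, b)}).Adj u w ↔
      G.Adj u w ∧ ¬ (u = a ∧ w = b ∨ u = b ∧ w = a) := by
    intro u w
    simp [SimpleGraph.deleteEdges_adj]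
  let K : Set V := {v | v = a ∨ v = b ∨ (G.Adj v a ∧ G.Adj v b)}
  by_cases hTK : ∃ v ∈ T, v ∉ K
  · obtain ⟨s, hs, hsK, hsimp⟩ := hG.exists_simplicial T K (by
      rintro u - w - (rfl | rfl | hu) (rfl | rfl | hw) huw
      · exact absurd rfl huw
      · exact hab
      · exact hw.1.symm
      · exact hab.symm
      · exact absurd rfl huw
      · exact hw.2.symm
      · exact hu.1
      · exact hu.2
      · exact hcl u w hu.1 hu.2 hw.1 hw.2 huw) hTK
    refine ⟨s, hs, fun u hu w hw h1 h2 h => ?_⟩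
    rw [hadj] at h1 h2 ⊢
    refine ⟨hsimp u hu w hw h1.1 h2.1 h, ?_⟩
    rintro (⟨rfl, rfl⟩ | ⟨rfl, rfl⟩)
    · exact hsK (Or.inr (Or.inr ⟨h1.1, h2.1⟩))
    · exact hsK (Or.inr (Or.inr ⟨h2.1, h1.1⟩))
  · push Not at hTK
    -- inside the unique maximal clique, an end of the removed edge is simplicial
    by_cases haT : a ∈ T
    · refine ⟨a, haT, fun u hu w hw h1 h2 h => ?_⟩
      rw [hadj] at h1 h2 ⊢
      have hub : u ≠ b := fun hub => h1.2 (Or.inl ⟨rfl, hub⟩)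
      have hwb : w ≠ b := fun hwb => h2.2 (Or.inl ⟨rfl, hwb⟩)
      have hu' : G.Adj u a ∧ G.Adj u b :=
        ((hTK u hu).resolve_left h1.1.ne').resolve_left hub
      have hw' : G.Adj w a ∧ G.Adj w b :=
        ((hTK w hw).resolve_left h2.1.ne').resolve_left hwb
      refine ⟨hcl u w hu'.1 hu'.2 hw'.1 hw'.2 h, ?_⟩
      rintro (⟨_, h⟩ | ⟨h, _⟩)
      · exact hwb h
      · exact hub h
    · obtain ⟨s, hs⟩ := hT
      refine ⟨s, hs, fun u hu w hw h1 h2 h => ?_⟩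
      rw [hadj] at h1 h2 ⊢
      have hua : u ≠ a := fun e => haT (e ▸ hu)
      have hwa : w ≠ a := fun e => haT (e ▸ hw)
      refine ⟨?_, by tauto⟩
      rcases (hTK u hu).resolve_left hua with rfl | hu'
      · rcases (hTK w hw).resolve_left hwa with rfl | hw'
        · exact absurd rfl h
        · exact hw'.2.symm
      · rcases (hTK w hw).resolve_left hwa with rfl | hw'
        · exact hu'.2
        · exact hcl u w hu'.1 hu'.2 hw'.1 hw'.2 h

/-- A cycle of length four in a chordal graph has a chord. -/
lemma IsChordalGraph.four_cycle (hG : IsChordalGraph G) {a b c d : V} (hab : G.Adj a b)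
    (hbc : G.Adj b c) (hcd : G.Adj c d) (hda : G.Adj d a) (hac : a ≠ c) (hbd : b ≠ d) :
    G.Adj a c ∨ G.Adj b d := by
  by_contra hcon
  push Not at hcon
  refine hcon.2 (hG.adj_of_walk_avoiding (x := a) (Y := {c}) hab hda.symm hbd ?_
    ⟨SimpleGraph.Walk.cons hbc (SimpleGraph.Walk.cons hcd SimpleGraph.Walk.nil), ?_⟩)
  · rintro y rfl
    exact ⟨hac.symm, hcon.1⟩
  · intro z hz
    simp at hz
    simp only [Set.mem_singleton_iff]
    tauto

end Chordality

/-! ### Vertices and faces of the chordal graph polytope -/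

section Polytope

variable {n : ℕ}

lemma charImset_apply_eq_one_iff {G : SimpleGraph (Fin n)}
    {S : {S : Finset (Fin n) // 2 ≤ S.card}} :
    charImset G S = 1 ↔ G.IsClique (S.1 : Set (Fin n)) := by
  unfold charImset; split_ifs with h <;> simp [h]

lemma charImset_of_isClique {G : SimpleGraph (Fin n)} {S : {S : Finset (Fin n) // 2 ≤ S.card}}
    (h : G.IsClique (S.1 : Set (Fin n))) : charImset G S = 1 := by
  unfold charImset; rw [if_pos h]

lemma charImset_of_not_isClique {G : SimpleGraph (Fin n)}
    {S : {S : Finset (Fin n) // 2 ≤ S.card}}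
    (h : ¬ G.IsClique (S.1 : Set (Fin n))) : charImset G S = 0 := by
  unfold charImset; rw [if_neg h]

lemma charImset_nonneg (G : SimpleGraph (Fin n)) (S) : 0 ≤ charImset G S := by
  unfold charImset; split_ifs <;> norm_num

lemma charImset_le_one (G : SimpleGraph (Fin n)) (S) : charImset G S ≤ 1 := by
  unfold charImset; split_ifs <;> norm_num

/-- Evaluation at a coordinate, as a linear functional on imsets. -/
def coordFunctional (S : {S : Finset (Fin n) // 2 ≤ S.card}) : ImsetSpace n →ₗ[ℝ] ℝ :=
  LinearMap.proj S

@[simp] lemma coordFunctional_apply (S : {S : Finset (Fin n) // 2 ≤ S.card}) (x : ImsetSpace n) :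
    coordFunctional S x = x S := rfl

/-- The coordinate of an imset that belongs to an edge. -/
def edgeCoord {x y : Fin n} (h : x ≠ y) : {S : Finset (Fin n) // 2 ≤ S.card} :=
  ⟨{x, y}, by rw [Finset.card_pair h]⟩

lemma isClique_edgeCoord {G : SimpleGraph (Fin n)} {x y : Fin n} (h : x ≠ y) :
    G.IsClique ((edgeCoord h).1 : Set (Fin n)) ↔ G.Adj x y := by
  simp [edgeCoord, h]

lemma charImset_injective : Function.Injective (charImset (n := n)) := by
  intro G H hGH
  ext x y
  by_cases hxy : x = y
  · subst hxy; simp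
  · rw [← isClique_edgeCoord hxy, ← isClique_edgeCoord hxy, ← charImset_apply_eq_one_iff,
      ← charImset_apply_eq_one_iff, hGH]

/-- The vertices of the chordal graph polytope are the imsets of all chordal graphs, because
these are points with coordinates `0` and `1`. -/
theorem extremePoints_chordalGraphPolytope (n : ℕ) :
    (chordalGraphPolytope n).extremePoints ℝ = charImset '' {G | IsChordalGraph G} := by
  apply Set.Subset.antisymm
  · intro x hx
    obtain ⟨G, hG, rfl⟩ := extremePoints_convexHull_subset hx
    exact ⟨G, hG, rfl⟩
  · rintro _ ⟨G, hG, rfl⟩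
    have hcube : chordalGraphPolytope n ⊆ Set.Icc 0 1 := by
      apply convexHull_min _ (convex_Icc 0 1)
      rintro _ ⟨H, -, rfl⟩
      exact ⟨fun S => charImset_nonneg H S, fun S => charImset_le_one H S⟩
    refine ⟨subset_convexHull ℝ _ ⟨G, hG, rfl⟩, ?_⟩
    intro y hy z hz hyz
    obtain ⟨a, b, ha, hb, hab, h⟩ := hyz
    have hy' := hcube hy
    have hz' := hcube hz
    ext S
    have hS := congrFun h S
    have y0 : 0 ≤ y S := hy'.1 S
    have y1 : y S ≤ 1 := hy'.2 S
    have z0 : 0 ≤ z S := hz'.1 S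
    have z1 : z S ≤ 1 := hz'.2 S
    simp only [Pi.add_apply, Pi.smul_apply, smul_eq_mul] at hS
    unfold charImset at hS ⊢
    split_ifs at hS ⊢ with hc
    · nlinarith [mul_nonneg hb.le (sub_nonneg.2 z1), mul_nonneg ha.le (sub_nonneg.2 y1)]
    · nlinarith [mul_nonneg hb.le z0, mul_nonneg ha.le y0]

/-- The functional `l` attains its maximum over the chordal graphs at both `G` and `H`. -/
def IsTight (G H : SimpleGraph (Fin n)) (l : ImsetSpace n →ₗ[ℝ] ℝ) : Prop :=
  l (charImset H) = l (charImset G) ∧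
    ∀ D, IsChordalGraph D → l (charImset D) ≤ l (charImset G)

/-- `D` is a chordal graph whose imset lies on the smallest face of the chordal graph polytope
that contains the imsets of `G` and `H`. -/
def IsOnFace (G H D : SimpleGraph (Fin n)) : Prop :=
  IsChordalGraph D ∧ ∀ l, IsTight G H l → l (charImset D) = l (charImset G)

variable {G H D : SimpleGraph (Fin n)}

lemma IsTight.symm {l : ImsetSpace n →ₗ[ℝ] ℝ} (h : IsTight G H l) : IsTight H G l :=
  ⟨h.1.symm, fun D hD => (h.2 D hD).trans h.1.symm.le⟩

lemma IsOnFace.symm (h : IsOnFace G H D) : IsOnFace H G D :=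
  ⟨h.1, fun l hl => (h.2 l hl.symm).trans hl.1⟩

lemma isOnFace_left (hG : IsChordalGraph G) : IsOnFace G H G := ⟨hG, fun _ _ => rfl⟩

lemma isOnFace_right (hH : IsChordalGraph H) : IsOnFace G H H := ⟨hH, fun _ h => h.1⟩

/-- One functional cuts out the smallest face containing two imsets: the sum of functionals that
separate the individual vertices off the face. -/
lemma exists_isTight_lt (G H : SimpleGraph (Fin n)) : ∃ l, IsTight G H l ∧
    ∀ D, IsChordalGraph D → ¬ IsOnFace G H D → l (charImset D) < l (charImset G) := by
  classical
  have := Fintype.ofFinite (SimpleGraph (Fin n))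
  have hex : ∀ D : SimpleGraph (Fin n), ∃ l, IsTight G H l ∧
      (IsChordalGraph D → ¬ IsOnFace G H D → l (charImset D) < l (charImset G)) := by
    intro D
    by_cases hD : IsChordalGraph D ∧ ¬ IsOnFace G H D
    · obtain ⟨hD1, hD2⟩ := hD
      have : ∃ l, IsTight G H l ∧ l (charImset D) ≠ l (charImset G) := by
        by_contra hcon
        push Not at hcon
        exact hD2 ⟨hD1, hcon⟩
      obtain ⟨l, hl, hne⟩ := this
      exact ⟨l, hl, fun _ _ => lt_of_le_of_ne (hl.2 D hD1) hne⟩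
    · exact ⟨0, ⟨by simp, by simp⟩, fun h1 h2 => absurd ⟨h1, h2⟩ hD⟩
  choose l hl hlt using hex
  refine ⟨∑ D, l D, ⟨?_, ?_⟩, ?_⟩
  · simp only [LinearMap.sum_apply]
    exact Finset.sum_congr rfl fun D _ => (hl D).1
  · intro E hE
    simp only [LinearMap.sum_apply]
    exact Finset.sum_le_sum fun D _ => (hl D).2 E hE
  · intro E hE hE'
    simp only [LinearMap.sum_apply]
    exact Finset.sum_lt_sum (fun D _ => (hl D).2 E hE) ⟨E, Finset.mem_univ _, hlt E hE hE'⟩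

/-- A functional only has to be bounded on the smallest face for its maximizers there to contain
the whole face. -/
lemma IsOnFace.eq_of_forall_le (l : ImsetSpace n →ₗ[ℝ] ℝ) (h1 : l (charImset H) = l (charImset G))
    (h2 : ∀ E, IsOnFace G H E → l (charImset E) ≤ l (charImset G)) (hD : IsOnFace G H D) :
    l (charImset D) = l (charImset G) := by
  obtain ⟨l₀, hl₀, hlt⟩ := exists_isTight_lt G H
  have := Fintype.ofFinite (SimpleGraph (Fin n))
  -- a large multiple of `l₀` dominates `l` off the face
  obtain ⟨M, hM⟩ : ∃ M : ℝ, ∀ E, IsChordalGraph E → ¬ IsOnFace G H E →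
      l (charImset E) - l (charImset G) ≤ M * (l₀ (charImset G) - l₀ (charImset E)) := by
    have hex : ∀ E : SimpleGraph (Fin n), ∃ M : ℝ, 0 ≤ M ∧
        (IsChordalGraph E → ¬ IsOnFace G H E →
        l (charImset E) - l (charImset G) ≤ M * (l₀ (charImset G) - l₀ (charImset E))) := by
      intro E
      by_cases hE : IsChordalGraph E ∧ ¬ IsOnFace G H E
      · have hpos := sub_pos.2 (hlt E hE.1 hE.2)
        refine ⟨|l (charImset E) - l (charImset G)| / (l₀ (charImset G) - l₀ (charImset E)),
          by positivity, fun _ _ => ?_⟩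
        rw [div_mul_cancel₀ _ hpos.ne']
        exact le_abs_self _
      · exact ⟨0, le_rfl, fun h1 h2 => absurd ⟨h1, h2⟩ hE⟩
    choose M hM0 hM using hex
    refine ⟨∑ E, M E, fun E h1 h2 => (hM E h1 h2).trans ?_⟩
    apply mul_le_mul_of_nonneg_right _ (sub_pos.2 (hlt E h1 h2)).le
    exact Finset.single_le_sum (fun E _ => hM0 E) (Finset.mem_univ E)
  have ht : IsTight G H (M • l₀ + l) := by
    refine ⟨?_, fun E hE => ?_⟩
    · simp [hl₀.1, h1]
    · simp only [LinearMap.add_apply, LinearMap.smul_apply, smul_eq_mul]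
      by_cases hE' : IsOnFace G H E
      · rw [hE'.2 l₀ hl₀]
        linarith [h2 E hE']
      · linarith [hM E hE hE', mul_sub M (l₀ (charImset G)) (l₀ (charImset E))]
  have := hD.2 _ ht
  simp only [LinearMap.add_apply, LinearMap.smul_apply, smul_eq_mul, hD.2 l₀ hl₀] at this
  linarith

/-- If no chordal graph but `G` and `H` lies on their smallest common face, they span an edge. -/
theorem isPolytopeEdge_of_isOnFace (hGH : G ≠ H) (hG : IsChordalGraph G) (hH : IsChordalGraph H)
    (h : ∀ D, IsOnFace G H D → D = G ∨ D = H) :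
    IsPolytopeEdge (chordalGraphPolytope n) (charImset G) (charImset H) := by
  refine ⟨charImset_injective.ne hGH, fun _ => ?_⟩
  obtain ⟨l, hl, hlt⟩ := exists_isTight_lt G H
  have hmax : ∀ y ∈ chordalGraphPolytope n, l y ≤ l (charImset G) := by
    have : chordalGraphPolytope n ⊆ {y | l y ≤ l (charImset G)} := by
      apply convexHull_min
      · rintro _ ⟨E, hE, rfl⟩
        exact hl.2 E hE
      · exact (convex_Iic (l (charImset G))).linear_preimage l
    exact this
  have hGm : charImset G ∈ chordalGraphPolytope n := subset_convexHull ℝ _ ⟨G, hG, rfl⟩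
  have hHm : charImset H ∈ chordalGraphPolytope n := subset_convexHull ℝ _ ⟨H, hH, rfl⟩
  refine ⟨LinearMap.toContinuousLinearMap l, ?_⟩
  apply Set.Subset.antisymm
  · intro x hx
    have hxP : x ∈ chordalGraphPolytope n :=
      convexHull_min (by rintro _ (rfl | rfl) <;> assumption) (convex_convexHull ℝ _) hx
    refine ⟨hxP, fun y hy => (hmax y hy).trans ?_⟩
    have : convexHull ℝ {charImset G, charImset H} ⊆ {y | l (charImset G) ≤ l y} := by
      apply convexHull_min
      · rintro _ (rfl | rfl)
        · exact le_refl (l _)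
        · exact hl.1.ge
      · exact (convex_Ici (l (charImset G))).linear_preimage l
    exact this hx
  · rintro x ⟨hxP, hx⟩
    have hxl : l x = l (charImset G) := le_antisymm (hmax x hxP) (hx _ hGm)
    by_cases hex : ∃ E, IsChordalGraph E ∧ E ≠ G ∧ E ≠ H
    · -- split the vertices into `G`, `H` and the others, where the functional is smaller
      let V₂ : Set (ImsetSpace n) := {y | ∃ E, IsChordalGraph E ∧ E ≠ G ∧ E ≠ H ∧ charImset E = y}
      have hV : {x | ∃ G : SimpleGraph (Fin n), IsChordalGraph G ∧ charImset G = x} =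
          {charImset G, charImset H} ∪ V₂ := by
        ext y
        constructor
        · rintro ⟨E, hE, rfl⟩
          by_cases h1 : E = G
          · exact Or.inl (Or.inl (by rw [h1]))
          by_cases h2 : E = H
          · exact Or.inl (Or.inr (by rw [h2]; rfl))
          · exact Or.inr ⟨E, hE, h1, h2, rfl⟩
        · rintro ((rfl | rfl) | ⟨E, hE, -, -, rfl⟩)
          · exact ⟨G, hG, rfl⟩
          · exact ⟨H, hH, rfl⟩
          · exact ⟨E, hE, rfl⟩
      have hV₂ : V₂.Nonempty := by
        obtain ⟨E, hE, h1, h2⟩ := hex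
        exact ⟨_, E, hE, h1, h2, rfl⟩
      have hlV₂ : ∀ y ∈ convexHull ℝ V₂, l y < l (charImset G) := by
        have : convexHull ℝ V₂ ⊆ {y | l y < l (charImset G)} := by
          apply convexHull_min
          · rintro _ ⟨E, hE, h1, h2, rfl⟩
            refine hlt E hE fun hE' => ?_
            rcases h E hE' with h | h
            · exact h1 h
            · exact h2 h
          · exact (convex_Iio (l (charImset G))).linear_preimage l
        exact this
      unfold chordalGraphPolytope at hxP
      rw [hV, convexHull_union (by simp) hV₂, mem_convexJoin] at hxP
      obtain ⟨p, hp, q, hq, hpq⟩ := hxP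
      obtain ⟨a, b, ha, hb, hab, rfl⟩ := hpq
      have hpP : l p ≤ l (charImset G) := hmax p <|
        convexHull_mono (by rw [hV]; exact Set.subset_union_left) hp
      have hql := hlV₂ q hq
      simp only [map_add, map_smul, smul_eq_mul] at hxl
      have hb0 : b = 0 := by
        by_contra hb0
        have : 0 < b := lt_of_le_of_ne hb (Ne.symm hb0)
        have hM : (a + b) * l (charImset G) = l (charImset G) := by rw [hab, one_mul]
        nlinarith [mul_pos this (sub_pos.2 hql), mul_nonneg ha (sub_nonneg.2 hpP)]
      subst hb0
      have : a = 1 := by linarith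
      subst this
      simpa using hp
    · push Not at hex
      refine convexHull_mono ?_ hxP
      rintro _ ⟨E, hE, rfl⟩
      by_cases h1 : E = G
      · exact Or.inl (by rw [h1])
      · exact Or.inr (by rw [hex E hE h1]; rfl)

/-! ### Graphs on the smallest face -/

lemma IsOnFace.isClique_of_isClique (hD : IsOnFace G H D) {S : Set (Fin n)} (hG : G.IsClique S)
    (hH : H.IsClique S) : D.IsClique S := by
  intro x hx y hy hxy
  rw [← isClique_edgeCoord hxy, ← charImset_apply_eq_one_iff]
  have h1 : charImset G (edgeCoord hxy) = 1 :=
    charImset_of_isClique ((isClique_edgeCoord hxy).2 (hG hx hy hxy))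
  have h2 : charImset H (edgeCoord hxy) = 1 :=
    charImset_of_isClique ((isClique_edgeCoord hxy).2 (hH hx hy hxy))
  have := hD.2 (coordFunctional (edgeCoord hxy)) ⟨by simp [h1, h2], fun E _ => by
    simpa [h1] using charImset_le_one E _⟩
  simpa [h1] using this

lemma IsOnFace.adj_of_adj (hD : IsOnFace G H D) {x y : Fin n} (hG : G.Adj x y) (hH : H.Adj x y) :
    D.Adj x y := by
  have := hD.isClique_of_isClique (S := {x, y}) (by simp [hG])
    (by simp [hH])
  exact this (by simp) (by simp) hG.ne

lemma IsOnFace.isClique_or (hD : IsOnFace G H D) {S : Set (Fin n)} (hS : D.IsClique S) :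
    G.IsClique S ∨ H.IsClique S := by
  classical
  by_contra hcon
  push Not at hcon
  have hfin : (S.toFinset : Set (Fin n)) = S := Set.coe_toFinset S
  have hcard : 2 ≤ S.toFinset.card := by
    by_contra hlt
    have : S.toFinset.card ≤ 1 := by omega
    rw [Finset.card_le_one] at this
    exact hcon.1 fun x hx y hy hxy => absurd (this x (by simpa using hx) y (by simpa using hy)) hxy
  let s : {S : Finset (Fin n) // 2 ≤ S.card} := ⟨S.toFinset, hcard⟩
  have h1 : charImset G s = 0 := charImset_of_not_isClique (by rw [hfin]; exact hcon.1)
  have h2 : charImset H s = 0 := charImset_of_not_isClique (by rw [hfin]; exact hcon.2)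
  have h3 : charImset D s = 1 := charImset_of_isClique (by rw [hfin]; exact hS)
  have := hD.2 (-coordFunctional s) ⟨by simp [h1, h2], fun E _ => by
    simpa [h1] using charImset_nonneg E _⟩
  simp [h1, h3] at this

lemma IsOnFace.adj_or (hD : IsOnFace G H D) {x y : Fin n} (h : D.Adj x y) :
    G.Adj x y ∨ H.Adj x y := by
  rcases hD.isClique_or (S := {x, y}) (by simp [h]) with h' | h'
  · exact Or.inl (h' (by simp) (by simp) h.ne)
  · exact Or.inr (h' (by simp) (by simp) h.ne)

/-- On the smallest face, the edges of a clique of `G` that are missing in `H` occur together. -/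
lemma IsOnFace.isClique_of_adj (hD : IsOnFace G H D) {S : Set (Fin n)} (hS : G.IsClique S)
    {x y : Fin n} (hx : x ∈ S) (hy : y ∈ S) (hxy : D.Adj x y) (hH : ¬ H.Adj x y) :
    D.IsClique S := by
  classical
  have hfin : (S.toFinset : Set (Fin n)) = S := Set.coe_toFinset S
  have hne := hxy.ne
  have hcard : 2 ≤ S.toFinset.card := by
    rw [← Finset.card_pair hne]
    apply Finset.card_le_card
    intro z hz
    simp only [Finset.mem_insert, Finset.mem_singleton] at hz
    rcases hz with rfl | rfl <;> simpa
  let s : {S : Finset (Fin n) // 2 ≤ S.card} := ⟨S.toFinset, hcard⟩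
  have h1 : charImset G s = 1 := charImset_of_isClique (by rw [hfin]; exact hS)
  have h2 : charImset G (edgeCoord hne) = 1 :=
    charImset_of_isClique ((isClique_edgeCoord hne).2 (hS hx hy hne))
  have h3 : charImset H s = 0 :=
    charImset_of_not_isClique (by rw [hfin]; exact fun h => hH (h hx hy hne))
  have h4 : charImset H (edgeCoord hne) = 0 :=
    charImset_of_not_isClique (by rwa [isClique_edgeCoord])
  have h5 : charImset D (edgeCoord hne) = 1 :=
    charImset_of_isClique (by rwa [isClique_edgeCoord])
  have := hD.2 (coordFunctional s - coordFunctional (edgeCoord hne)) ⟨by simp [h1, h2, h3, h4], by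
    intro E _
    simp only [LinearMap.sub_apply, coordFunctional_apply, h1, h2, sub_self]
    by_cases hE : E.IsClique S
    · rw [charImset_of_isClique (S := edgeCoord hne) ((isClique_edgeCoord hne).2 (hE hx hy hne))]
      linarith [charImset_le_one E s]
    · rw [charImset_of_not_isClique (S := s) (by rw [hfin]; exact hE)]
      linarith [charImset_nonneg E (edgeCoord hne)]⟩
  simp only [LinearMap.sub_apply, coordFunctional_apply, h1, h2, h5, sub_self] at this
  have : charImset D s = 1 := by linarith
  rw [charImset_apply_eq_one_iff, hfin] at this
  exact this

/-- If an edge of only `G` and an edge of only `H` are missing together in a graph on the smallest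
face, they occur together in another: otherwise the sum of their two coordinates would be at most
its value at `G` and `H` on the face, and smaller somewhere. -/
lemma exists_isOnFace_adj_adj {x y u w : Fin n} (hxy : G.Adj x y)
    (hxy' : ¬ H.Adj x y) (huw : H.Adj u w) (huw' : ¬ G.Adj u w) (hD : IsOnFace G H D)
    (h1 : ¬ D.Adj x y) (h2 : ¬ D.Adj u w) :
    ∃ E, IsOnFace G H E ∧ E.Adj x y ∧ E.Adj u w := by
  by_contra hcon
  push Not at hcon
  have c1 : ∀ E : SimpleGraph (Fin n), E.Adj x y → charImset E (edgeCoord hxy.ne) = 1 :=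
    fun E h => charImset_of_isClique ((isClique_edgeCoord _).2 h)
  have c2 : ∀ E : SimpleGraph (Fin n), E.Adj u w → charImset E (edgeCoord huw.ne) = 1 :=
    fun E h => charImset_of_isClique ((isClique_edgeCoord _).2 h)
  have c3 : ∀ E : SimpleGraph (Fin n), ¬ E.Adj x y → charImset E (edgeCoord hxy.ne) = 0 :=
    fun E h => charImset_of_not_isClique (by rwa [isClique_edgeCoord])
  have c4 : ∀ E : SimpleGraph (Fin n), ¬ E.Adj u w → charImset E (edgeCoord huw.ne) = 0 :=
    fun E h => charImset_of_not_isClique (by rwa [isClique_edgeCoord])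
  have := hD.eq_of_forall_le
    (coordFunctional (edgeCoord hxy.ne) + coordFunctional (edgeCoord huw.ne))
    (by simp [c1 G hxy, c2 H huw, c3 H hxy', c4 G huw']) (by
      intro E hE
      simp only [LinearMap.add_apply, coordFunctional_apply, c1 G hxy, c4 G huw', add_zero]
      by_cases h : E.Adj x y
      · simp [c1 E h, c4 E (hcon E hE h)]
      · simpa [c3 E h] using charImset_le_one E _)
  simp [c1 G hxy, c4 G huw', c3 D h1, c4 D h2] at this

/-! ### Witnesses for the rhombus criterion -/

/-- `D` and `E` share out the cliques of `G` and `H`, and in particular their edges: then their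
imsets have the same sum. For common cliques it suffices to consider edges. -/
structure IsExchange (G H D E : SimpleGraph (Fin n)) : Prop where
  and_iff : ∀ x y, D.Adj x y ∧ E.Adj x y ↔ G.Adj x y ∧ H.Adj x y
  of_left : ∀ S : Set (Fin n), D.IsClique S → G.IsClique S ∨ H.IsClique S
  of_right : ∀ S : Set (Fin n), E.IsClique S → G.IsClique S ∨ H.IsClique S
  to_left : ∀ S : Set (Fin n), G.IsClique S → D.IsClique S ∨ E.IsClique S
  to_right : ∀ S : Set (Fin n), H.IsClique S → D.IsClique S ∨ E.IsClique S

lemma IsExchange.charImset_add {E : SimpleGraph (Fin n)} (h : IsExchange G H D E) :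
    charImset G + charImset H = charImset D + charImset E := by
  classical
  ext S
  have hand : (D.IsClique (S.1 : Set (Fin n)) ∧ E.IsClique (S.1 : Set (Fin n))) ↔
      (G.IsClique (S.1 : Set (Fin n)) ∧ H.IsClique (S.1 : Set (Fin n))) := by
    constructor
    · intro hh
      exact ⟨fun x hx y hy hxy => ((h.and_iff x y).1 ⟨hh.1 hx hy hxy, hh.2 hx hy hxy⟩).1,
        fun x hx y hy hxy => ((h.and_iff x y).1 ⟨hh.1 hx hy hxy, hh.2 hx hy hxy⟩).2⟩
    · intro hh
      exact ⟨fun x hx y hy hxy => ((h.and_iff x y).2 ⟨hh.1 hx hy hxy, hh.2 hx hy hxy⟩).1,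
        fun x hx y hy hxy => ((h.and_iff x y).2 ⟨hh.1 hx hy hxy, hh.2 hx hy hxy⟩).2⟩
  have hor : (D.IsClique (S.1 : Set (Fin n)) ∨ E.IsClique (S.1 : Set (Fin n))) ↔
      (G.IsClique (S.1 : Set (Fin n)) ∨ H.IsClique (S.1 : Set (Fin n))) :=
    ⟨fun hh => hh.elim (h.of_left _) (h.of_right _), fun hh => hh.elim (h.to_left _) (h.to_right _)⟩
  have key : ∀ p q : Prop, ∀ [Decidable p] [Decidable q],
      (if p then (1 : ℝ) else 0) + (if q then 1 else 0) =
      (if p ∧ q then 1 else 0) + (if p ∨ q then 1 else 0) := by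
    intro p q _ _
    by_cases hp : p <;> by_cases hq : q <;> simp [hp, hq]
  simp only [Pi.add_apply, charImset]
  rw [key, key (D.IsClique _)]
  congr 1
  · exact if_congr hand.symm rfl rfl
  · exact if_congr hor.symm rfl rfl

/-- Two chordal graphs that share out the edges and cliques of `G` and `H` and differ from them
are a witness of the rhombus criterion. -/
theorem IsExchange.fulfillsRhombus {E : SimpleGraph (Fin n)} (h : IsExchange G H D E)
    (hD : IsChordalGraph D) (hE : IsChordalGraph E) (hDG : D ≠ G) (hDH : D ≠ H) :
    FulfillsRhombus (chordalGraphPolytope n) (charImset G) (charImset H) := by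
  have hadd := h.charImset_add
  refine Or.inr ⟨charImset D, charImset E, ⟨?_, ?_⟩, ⟨?_, ?_⟩, hadd⟩
  · rw [extremePoints_chordalGraphPolytope]; exact ⟨D, hD, rfl⟩
  · rintro (h | h)
    · exact hDG (charImset_injective h)
    · exact hDH (charImset_injective h)
  · rw [extremePoints_chordalGraphPolytope]; exact ⟨E, hE, rfl⟩
  · rintro (h | h)
    · rw [h, add_comm] at hadd
      exact hDH (charImset_injective (add_right_cancel hadd)).symm
    · have h : charImset E = charImset H := h
      rw [h] at hadd
      exact hDG (charImset_injective (add_right_cancel hadd)).symm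

end Polytope

/-! ### Exchanging edges between two split graphs -/

section Exchange

variable {n : ℕ} {G H : SimpleGraph (Fin n)} {K L : Set (Fin n)}

/-- The graph that agrees with `H` on the pairs in `E` and with `G` on all other pairs. -/
def exchangeGraph (G H : SimpleGraph (Fin n)) (E : Set (Sym2 (Fin n))) : SimpleGraph (Fin n) where
  Adj x y := (s(x, y) ∈ E ∧ H.Adj x y) ∨ (s(x, y) ∉ E ∧ G.Adj x y)
  symm := ⟨fun x y h => by rwa [Sym2.eq_swap, H.adj_comm, G.adj_comm] at h⟩
  loopless := ⟨fun x h => by simp at h⟩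

lemma exchangeGraph_adj {E : Set (Sym2 (Fin n))} {x y : Fin n} : (exchangeGraph G H E).Adj x y ↔
    (s(x, y) ∈ E ∧ H.Adj x y) ∨ (s(x, y) ∉ E ∧ G.Adj x y) := Iff.rfl

lemma exchangeGraph_adj_of_mem {E : Set (Sym2 (Fin n))} {x y : Fin n} (h : s(x, y) ∈ E) :
    (exchangeGraph G H E).Adj x y ↔ H.Adj x y := by simp [exchangeGraph_adj, h]

lemma exchangeGraph_adj_of_notMem {E : Set (Sym2 (Fin n))} {x y : Fin n} (h : s(x, y) ∉ E) :
    (exchangeGraph G H E).Adj x y ↔ G.Adj x y := by simp [exchangeGraph_adj, h]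

/-- Exchanging the pairs in `E` in both directions shares out the edges; what remains to be checked
concerns the cliques. -/
lemma isExchange_exchangeGraph {E : Set (Sym2 (Fin n))}
    (h1 : ∀ S, (exchangeGraph G H E).IsClique S → G.IsClique S ∨ H.IsClique S)
    (h2 : ∀ S, (exchangeGraph H G E).IsClique S → H.IsClique S ∨ G.IsClique S)
    (h3 : ∀ S, G.IsClique S → (exchangeGraph G H E).IsClique S ∨ (exchangeGraph H G E).IsClique S)
    (h4 : ∀ S, H.IsClique S → (exchangeGraph H G E).IsClique S ∨
      (exchangeGraph G H E).IsClique S) :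
    IsExchange G H (exchangeGraph G H E) (exchangeGraph H G E) where
  and_iff x y := by simp only [exchangeGraph_adj]; tauto
  of_left := h1
  of_right S hS := (h2 S hS).symm
  to_left := h3
  to_right S hS := (h4 S hS).symm

/-- `K` and `L` are cliques of `G` and `H` whose complements are independent sets of `G` and `H`. -/
structure IsSplitPair (G H : SimpleGraph (Fin n)) (K L : Set (Fin n)) : Prop where
  adj_left : ∀ ⦃x y⦄, x ∈ K → y ∈ K → x ≠ y → G.Adj x y
  mem_left : ∀ ⦃x y⦄, x ∉ K → G.Adj x y → y ∈ K
  adj_right : ∀ ⦃x y⦄, x ∈ L → y ∈ L → x ≠ y → H.Adj x y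
  mem_right : ∀ ⦃x y⦄, x ∉ L → H.Adj x y → y ∈ L

lemma IsSplitPair.symm (h : IsSplitPair G H K L) : IsSplitPair H G L K :=
  ⟨h.adj_right, h.mem_right, h.adj_left, h.mem_left⟩

lemma isChordalGraph_of_split (h1 : ∀ x y, x ∈ K → y ∈ K → x ≠ y → G.Adj x y)
    (h2 : ∀ x y, x ∉ K → G.Adj x y → y ∈ K) : IsChordalGraph G :=
  IsSplitGraph.isChordalGraph ⟨K, fun x hx y hy hxy => h1 x y hx hy hxy,
    fun x hx y hy _ hadj => hy (h2 x y hx hadj)⟩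

lemma IsSplitPair.isChordalGraph_left (h : IsSplitPair G H K L) : IsChordalGraph G :=
  isChordalGraph_of_split h.adj_left h.mem_left

lemma IsSplitPair.isChordalGraph_right (h : IsSplitPair G H K L) : IsChordalGraph H :=
  h.symm.isChordalGraph_left

/-- The neighbours of `v` in `G` are pairwise adjacent in `H`. -/
def NeighborsAdjIn (G H : SimpleGraph (Fin n)) (v : Fin n) : Prop :=
  ∀ ⦃u w⦄, G.Adj v u → G.Adj v w → u ≠ w → H.Adj u w

/-! #### Exchanging the neighbourhood of a vertex -/

lemma isChordalGraph_exchangeGraph_vertex (h : IsSplitPair G H K L) {d : Fin n}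
    (hd : NeighborsAdjIn H G d) : IsChordalGraph (exchangeGraph G H {e | d ∈ e}) := by
  classical
  apply isChordalGraph_of_rank fun v => if v = d then 0 else if v ∈ K then 2 else 1
  intro v u w hvu hvw huw h1 h2
  have key : ∀ x y, x ≠ d → y ≠ d → ((exchangeGraph G H {e | d ∈ e}).Adj x y ↔ G.Adj x y) := by
    intro x y hx hy
    exact exchangeGraph_adj_of_notMem (by simp [hx.symm, hy.symm])
  by_cases hv : v = d
  · subst hv
    rw [exchangeGraph_adj_of_mem (by simp)] at hvu hvw
    rw [key _ _ hvu.ne' hvw.ne']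
    exact hd hvu hvw huw
  · have hu : u ≠ d := by rintro rfl; by_cases hvK : v ∈ K <;> simp [hv, hvK] at h1
    have hw : w ≠ d := by rintro rfl; by_cases hvK : v ∈ K <;> simp [hv, hvK] at h2
    rw [key _ _ hv hu] at hvu
    rw [key _ _ hv hw] at hvw
    rw [key _ _ hu hw]
    by_cases hvK : v ∈ K
    · have hu : u ∈ K := by by_contra hu'; simp [hv, hvK, hu, hu'] at h1
      have hw : w ∈ K := by by_contra hw'; simp [hv, hvK, hw, hw'] at h2
      exact h.adj_left hu hw huw
    · exact h.adj_left (h.mem_left hvK hvu) (h.mem_left hvK hvw) huw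

lemma isClique_of_exchangeGraph_vertex (h : IsSplitPair G H K L) {d : Fin n} (hdL : d ∉ L)
    (S : Set (Fin n)) (hS : (exchangeGraph G H {e | d ∈ e}).IsClique S) :
    G.IsClique S ∨ H.IsClique S := by
  by_cases hdS : d ∈ S
  · have hH : ∀ x ∈ S, x ≠ d → H.Adj d x := fun x hx hxd =>
      (exchangeGraph_adj_of_mem (by simp)).1 (hS hdS hx hxd.symm)
    refine Or.inr fun x hx y hy hxy => ?_
    by_cases hxd : x = d
    · subst hxd; exact hH y hy hxy.symm
    by_cases hyd : y = d
    · subst hyd; exact (hH x hx hxd).symm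
    · exact h.adj_right (h.mem_right hdL (hH x hx hxd)) (h.mem_right hdL (hH y hy hyd)) hxy
  · refine Or.inl fun x hx y hy hxy => ?_
    have hxd : d ≠ x := fun e => hdS (e ▸ hx)
    have hyd : d ≠ y := fun e => hdS (e ▸ hy)
    exact (exchangeGraph_adj_of_notMem (by simp [hxd, hyd])).1 (hS hx hy hxy)

lemma isClique_exchangeGraph_vertex {d : Fin n} (hd : NeighborsAdjIn G H d)
    (S : Set (Fin n)) (hS : G.IsClique S) :
    (exchangeGraph G H {e | d ∈ e}).IsClique S ∨ (exchangeGraph H G {e | d ∈ e}).IsClique S := by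
  by_cases hdS : d ∈ S
  · refine Or.inr fun x hx y hy hxy => ?_
    by_cases hxd : x = d
    · subst hxd; exact (exchangeGraph_adj_of_mem (by simp)).2 (hS hx hy hxy)
    by_cases hyd : y = d
    · subst hyd; exact (exchangeGraph_adj_of_mem (by simp)).2 (hS hx hy hxy)
    · refine (exchangeGraph_adj_of_notMem (by simp [Ne.symm hxd, Ne.symm hyd])).2 ?_
      exact hd (hS hdS hx (Ne.symm hxd)) (hS hdS hy (Ne.symm hyd)) hxy
  · refine Or.inl fun x hx y hy hxy => ?_
    have hxd : d ≠ x := fun e => hdS (e ▸ hx)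
    have hyd : d ≠ y := fun e => hdS (e ▸ hy)
    exact (exchangeGraph_adj_of_notMem (by simp [hxd, hyd])).2 (hS hx hy hxy)

/-- The neighbourhoods of a vertex outside both cliques can be exchanged, if each of them is a
clique in both graphs. -/
theorem IsSplitPair.fulfillsRhombus_of_vertex (h : IsSplitPair G H K L) {d : Fin n} (hdK : d ∉ K)
    (hdL : d ∉ L) (hG : NeighborsAdjIn G H d) (hH : NeighborsAdjIn H G d)
    (hd : ∃ u, ¬ (G.Adj d u ↔ H.Adj d u))
    (hne : ∃ x y, x ≠ d ∧ y ≠ d ∧ ¬ (G.Adj x y ↔ H.Adj x y)) :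
    FulfillsRhombus (chordalGraphPolytope n) (charImset G) (charImset H) := by
  refine (isExchange_exchangeGraph (isClique_of_exchangeGraph_vertex h hdL)
    (isClique_of_exchangeGraph_vertex h.symm hdK) (isClique_exchangeGraph_vertex hG)
    (isClique_exchangeGraph_vertex hH)).fulfillsRhombus
    (isChordalGraph_exchangeGraph_vertex h hH) (isChordalGraph_exchangeGraph_vertex h.symm hG) ?_ ?_
  · intro he
    obtain ⟨u, hu⟩ := hd
    apply hu
    rw [← exchangeGraph_adj_of_mem (G := G) (H := H) (E := {e | d ∈ e}) (by simp), he]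
  · intro he
    obtain ⟨x, y, hx, hy, hxy⟩ := hne
    apply hxy
    rw [← exchangeGraph_adj_of_notMem (G := G) (H := H) (E := {e | d ∈ e})
      (by simp [hx.symm, hy.symm]), he]

/-! #### Exchanging a pendant edge, or a cycle of them -/

/-- The vertex `v` outside `K` is attached to `b` in `K`, outside `L`, by an edge of `G` that is
missing in `H`, and the remaining neighbours of `v` in `G` form a clique of both graphs together
with `b` and a clique of both graphs together with `v`. -/
structure IsSatellite (G H : SimpleGraph (Fin n)) (K L : Set (Fin n)) (v b : Fin n) : Prop where
  notMem : v ∉ K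
  mem : b ∈ K
  notMem' : b ∉ L
  adj : G.Adj v b
  not_adj : ¬ H.Adj v b
  nbr : ∀ ⦃a⦄, G.Adj v a → a ≠ b → a ∈ L ∧ H.Adj b a ∧ H.Adj v a

/-- The edge that attaches a satellite `v` to `b` can be moved from `G` to `H`, if the neighbours of
`b` in `H` are neighbours of `v` in `G`: then `b` is simplicial after this edge has been added. -/
theorem IsSatellite.fulfillsRhombus (h : IsSplitPair G H K L) {v b : Fin n}
    (hs : IsSatellite G H K L v b) (hb : ∀ a, H.Adj b a → G.Adj v a)
    (hne : ∃ x y, s(x, y) ≠ s(v, b) ∧ ¬ (G.Adj x y ↔ H.Adj x y)) :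
    FulfillsRhombus (chordalGraphPolytope n) (charImset G) (charImset H) := by
  classical
  have hvb := hs.adj.ne
  have keyD : ∀ x y, (exchangeGraph G H {s(v, b)}).Adj x y ↔ s(x, y) ≠ s(v, b) ∧ G.Adj x y := by
    intro x y
    by_cases hxy : s(x, y) = s(v, b)
    · rw [exchangeGraph_adj_of_mem (by simpa using hxy)]
      refine ⟨fun hh => absurd hh ?_, fun hh => absurd hxy hh.1⟩
      rw [Sym2.eq_iff] at hxy
      rcases hxy with ⟨rfl, rfl⟩ | ⟨rfl, rfl⟩
      · exact hs.not_adj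
      · exact fun h => hs.not_adj h.symm
    · rw [exchangeGraph_adj_of_notMem (by simpa using hxy)]
      simp [hxy]
  have keyE : ∀ x y, (exchangeGraph H G {s(v, b)}).Adj x y ↔ s(x, y) = s(v, b) ∨ H.Adj x y := by
    intro x y
    by_cases hxy : s(x, y) = s(v, b)
    · rw [exchangeGraph_adj_of_mem (by simpa using hxy)]
      refine ⟨fun hh => Or.inl hxy, fun _ => ?_⟩
      rw [Sym2.eq_iff] at hxy
      rcases hxy with ⟨rfl, rfl⟩ | ⟨rfl, rfl⟩
      · exact hs.adj
      · exact hs.adj.symm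
    · rw [exchangeGraph_adj_of_notMem (by simpa using hxy)]
      simp [hxy]
  have hvb' : ∀ {x y}, s(x, y) = s(v, b) → (x = v ∧ y = b) ∨ (x = b ∧ y = v) := by
    intro x y hxy
    simpa [Sym2.eq_iff] using hxy
  refine (isExchange_exchangeGraph (E := {s(v, b)}) ?_ ?_ ?_ ?_).fulfillsRhombus ?_ ?_ ?_ ?_
  · exact fun S hS => Or.inl fun x hx y hy hxy => ((keyD x y).1 (hS hx hy hxy)).2
  · intro S hS
    by_cases hvS : v ∈ S ∧ b ∈ S
    · -- a clique through the new edge lies in the closed neighbourhood of `v` in `G`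
      have hnb : ∀ x ∈ S, x ≠ v → G.Adj v x := by
        intro x hx hxv
        by_cases hxb : x = b
        · subst hxb; exact hs.adj
        · rcases (keyE b x).1 (hS hvS.2 hx (Ne.symm hxb)) with he | he
          · rcases hvb' he with ⟨h1, -⟩ | ⟨-, h1⟩
            · exact absurd h1.symm hvb
            · exact absurd h1 hxv
          · exact hb x he
      refine Or.inr fun x hx y hy hxy => ?_
      by_cases hxv : x = v
      · subst hxv; exact hnb y hy hxy.symm
      by_cases hyv : y = v
      · subst hyv; exact (hnb x hx hxv).symm
      · exact h.adj_left (h.mem_left hs.notMem (hnb x hx hxv))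
          (h.mem_left hs.notMem (hnb y hy hyv)) hxy
    · refine Or.inl fun x hx y hy hxy => ?_
      rcases (keyE x y).1 (hS hx hy hxy) with he | he
      · rcases hvb' he with ⟨rfl, rfl⟩ | ⟨rfl, rfl⟩
        · exact absurd ⟨hx, hy⟩ hvS
        · exact absurd ⟨hy, hx⟩ hvS
      · exact he
  · intro S hS
    by_cases hvS : v ∈ S ∧ b ∈ S
    · refine Or.inr fun x hx y hy hxy => (keyE x y).2 ?_
      have hnb : ∀ x ∈ S, x ≠ v → x ≠ b → x ∈ L ∧ H.Adj b x ∧ H.Adj v x := fun x hx hxv hxb =>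
        hs.nbr (hS hvS.1 hx (Ne.symm hxv)) hxb
      by_cases hxv : x = v
      · subst hxv
        by_cases hyb : y = b
        · exact Or.inl (by rw [hyb])
        · exact Or.inr (hnb y hy hxy.symm hyb).2.2
      by_cases hxb : x = b
      · subst hxb
        by_cases hyv : y = v
        · exact Or.inl (by rw [hyv, Sym2.eq_swap])
        · exact Or.inr (hnb y hy hyv hxy.symm).2.1
      by_cases hyv : y = v
      · subst hyv; exact Or.inr (hnb x hx hxv hxb).2.2.symm
      by_cases hyb : y = b
      · subst hyb; exact Or.inr (hnb x hx hxv hxb).2.1.symm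
      · exact Or.inr (h.adj_right (hnb x hx hxv hxb).1 (hnb y hy hyv hyb).1 hxy)
    · refine Or.inl fun x hx y hy hxy => (keyD x y).2 ⟨fun he => ?_, hS hx hy hxy⟩
      rcases hvb' he with ⟨rfl, rfl⟩ | ⟨rfl, rfl⟩
      · exact hvS ⟨hx, hy⟩
      · exact hvS ⟨hy, hx⟩
  · exact fun S hS => Or.inl fun x hx y hy hxy => (keyE x y).2 (Or.inr (hS hx hy hxy))
  · refine isChordalGraph_of_split (K := K) (fun x y hx hy hxy => (keyD x y).2
      ⟨fun he => ?_, h.adj_left hx hy hxy⟩) (fun x y hx hxy => h.mem_left hx ((keyD x y).1 hxy).2)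
    rcases hvb' he with ⟨rfl, rfl⟩ | ⟨rfl, rfl⟩
    · exact hs.notMem hx
    · exact hs.notMem hy
  · -- in `H` with the edge `vb` added, `b` is simplicial
    apply isChordalGraph_of_rank fun x => if x = b then 0 else if x ∈ L then 2 else 1
    intro x u w hxu hxw huw h1 h2
    have hbn : ∀ a, (exchangeGraph H G {s(v, b)}).Adj b a → a = v ∨ H.Adj b a := by
      intro a ha
      rcases (keyE b a).1 ha with he | he
      · rcases hvb' he with ⟨h1, -⟩ | ⟨-, h1⟩
        · exact absurd h1.symm hvb
        · exact Or.inl h1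
      · exact Or.inr he
    have hbv : ∀ a, H.Adj b a → a ≠ v → H.Adj v a := fun a ha hav =>
      (hs.nbr (hb a ha) ha.ne').2.2
    by_cases hxb : x = b
    · subst hxb
      rw [keyE]
      right
      rcases hbn u hxu with rfl | hu
      · rcases hbn w hxw with rfl | hw
        · exact absurd rfl huw
        · exact hbv w hw huw.symm
      · rcases hbn w hxw with rfl | hw
        · exact (hbv u hu huw).symm
        · exact h.adj_right (h.mem_right hs.notMem' hu) (h.mem_right hs.notMem' hw) huw
    · have hub : u ≠ b := by rintro rfl; by_cases hxL : x ∈ L <;> simp [hxb, hxL] at h1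
      have hwb : w ≠ b := by rintro rfl; by_cases hxL : x ∈ L <;> simp [hxb, hxL] at h2
      have hH : ∀ y, y ≠ b → (exchangeGraph H G {s(v, b)}).Adj x y → H.Adj x y := by
        intro y hyb hy
        rcases (keyE x y).1 hy with he | he
        · rcases hvb' he with ⟨-, h1⟩ | ⟨h1, -⟩
          · exact absurd h1 hyb
          · exact absurd h1 hxb
        · exact he
      rw [keyE]
      right
      by_cases hxL : x ∈ L
      · have hu : u ∈ L := by by_contra hu'; simp [hxb, hxL, hub, hu'] at h1
        have hw : w ∈ L := by by_contra hw'; simp [hxb, hxL, hwb, hw'] at h2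
        exact h.adj_right hu hw huw
      · exact h.adj_right (h.mem_right hxL (hH u hub hxu)) (h.mem_right hxL (hH w hwb hxw)) huw
  · intro he
    have := (keyD v b)
    rw [he] at this
    exact (this.1 hs.adj).1 rfl
  · intro he
    obtain ⟨x, y, hxy, hne⟩ := hne
    apply hne
    have := keyD x y
    rw [he] at this
    rw [this]
    simp [hxy]

/-- A cyclic system of satellites: `f` permutes `W`, and every `w` in `W` is attached to `f w` by an
edge of only one of the two graphs, alternately of `G` and of `H`. -/
structure IsSatelliteCycle (G H : SimpleGraph (Fin n)) (K L : Set (Fin n)) (W : Finset (Fin n))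
    (f : Fin n → Fin n) : Prop where
  mapsTo : ∀ w ∈ W, f w ∈ W
  inj : ∀ w ∈ W, ∀ w' ∈ W, f w = f w' → w = w'
  sat : ∀ w ∈ W, IsSatellite G H K L w (f w) ∨ IsSatellite H G L K w (f w)

namespace IsSatelliteCycle

variable {W : Finset (Fin n)} {f : Fin n → Fin n}

lemma symm (h : IsSatelliteCycle G H K L W f) : IsSatelliteCycle H G L K W f :=
  ⟨h.mapsTo, h.inj, fun w hw => (h.sat w hw).symm⟩

lemma exists_eq (h : IsSatelliteCycle G H K L W f) {w : Fin n} (hw : w ∈ W) :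
    ∃ w' ∈ W, f w' = w := by
  classical
  have himg : W.image f = W := by
    apply Finset.eq_of_subset_of_card_le
    · intro x hx
      obtain ⟨y, hy, rfl⟩ := Finset.mem_image.1 hx
      exact h.mapsTo y hy
    · rw [Finset.card_image_of_injOn]
      exact fun x hx y hy hxy => h.inj x hx y hy hxy
  rw [← himg] at hw
  obtain ⟨y, hy, rfl⟩ := Finset.mem_image.1 hw
  exact ⟨y, hy, rfl⟩

lemma mem_iff_notMem (h : IsSatelliteCycle G H K L W f) {w : Fin n} (hw : w ∈ W) :
    w ∈ K ↔ w ∉ L := by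
  obtain ⟨w', hw', rfl⟩ := h.exists_eq hw
  rcases h.sat w' hw' with hs | hs
  · exact ⟨fun _ => hs.notMem', fun _ => hs.mem⟩
  · exact ⟨fun h => absurd h hs.notMem', fun h => absurd hs.mem h⟩

lemma sat_left (h : IsSatelliteCycle G H K L W f) {w : Fin n} (hw : w ∈ W) (hK : w ∉ K) :
    IsSatellite G H K L w (f w) := by
  rcases h.sat w hw with hs | hs
  · exact hs
  · exact absurd ((h.mem_iff_notMem hw).2 hs.notMem) hK

lemma sat_right (h : IsSatelliteCycle G H K L W f) {w : Fin n} (hw : w ∈ W) (hL : w ∉ L) :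
    IsSatellite H G L K w (f w) := h.symm.sat_left hw hL

lemma mk_mem {w : Fin n} (hw : w ∈ W) : s(w, f w) ∈ {e | ∃ w ∈ W, e = s(w, f w)} := ⟨w, hw, rfl⟩

lemma mem_or_of_mem {x y : Fin n}
    (hxy : s(x, y) ∈ {e | ∃ w ∈ W, e = s(w, f w)}) : (x ∈ W ∧ y = f x) ∨ (y ∈ W ∧ x = f y) := by
  obtain ⟨w, hw, he⟩ := hxy
  rw [Sym2.eq_iff] at he
  rcases he with ⟨rfl, rfl⟩ | ⟨rfl, rfl⟩
  · exact Or.inl ⟨hw, rfl⟩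
  · exact Or.inr ⟨hw, rfl⟩

/-- The neighbourhoods of the satellites grow along `f`; since `f` is a permutation, they all
agree. -/
lemma adj_of_adj (h : IsSatelliteCycle G H K L W f) (hsp : IsSplitPair G H K L) {w : Fin n}
    (hw : w ∈ W) (hwL : w ∉ L) {a : Fin n} (ha : G.Adj (f w) a) (ha' : a ≠ f (f w)) :
    H.Adj w a := by
  classical
  let A : Fin n → Finset (Fin n) := fun w => Finset.univ.filter fun a =>
    a ≠ f w ∧ ((w ∉ K ∧ G.Adj w a) ∨ (w ∉ L ∧ H.Adj w a))
  have hmono : ∀ w ∈ W, A w ⊆ A (f w) := by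
    intro w hw a ha
    simp only [A, Finset.mem_filter, Finset.mem_univ, true_and] at ha ⊢
    have hfw := h.mapsTo w hw
    obtain ⟨hne, ⟨hK, hadj⟩ | ⟨hL, hadj⟩⟩ := ha
    · have hs := h.sat_left hw hK
      have hs' := h.sat_right hfw hs.notMem'
      refine ⟨?_, Or.inr ⟨hs.notMem', (hs.nbr hadj hne).2.1⟩⟩
      rintro rfl
      exact hs'.notMem' (hsp.mem_left hK hadj)
    · have hs := h.sat_right hw hL
      have hs' := h.sat_left hfw hs.notMem'
      refine ⟨?_, Or.inl ⟨hs.notMem', (hs.nbr hadj hne).2.1⟩⟩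
      rintro rfl
      exact hs'.notMem' (hsp.mem_right hL hadj)
  have hsum : ∑ w ∈ W, (A w).card = ∑ w ∈ W, (A (f w)).card := by
    symm
    refine Finset.sum_bij (fun w _ => f w) (fun w hw => h.mapsTo w hw)
      (fun w hw w' hw' he => h.inj w hw w' hw' he) (fun w hw => ?_) (fun _ _ => rfl)
    obtain ⟨w', hw', he⟩ := h.exists_eq hw
    exact ⟨w', hw', he⟩
  have hcard := (Finset.sum_eq_sum_iff_of_le fun w hw => Finset.card_le_card (hmono w hw)).1 hsum
  have hA : A w = A (f w) := Finset.eq_of_subset_of_card_le (hmono w hw) (hcard w hw).ge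
  have hmem : a ∈ A (f w) := by
    simp only [A, Finset.mem_filter, Finset.mem_univ, true_and]
    exact ⟨ha', Or.inl ⟨(h.sat_right hw hwL).notMem', ha⟩⟩
  rw [← hA] at hmem
  simp only [A, Finset.mem_filter, Finset.mem_univ, true_and] at hmem
  rcases hmem.2 with hh | hh
  · exact absurd ((h.mem_iff_notMem hw).2 hwL) hh.1
  · exact hh.2

lemma notMem_of_mem (h : IsSatelliteCycle G H K L W f) {x y : Fin n} (hxK : x ∈ K) (hxL : x ∈ L) :
    s(x, y) ∉ {e | ∃ w ∈ W, e = s(w, f w)} := by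
  intro hxy
  have hx : x ∈ W := by
    rcases mem_or_of_mem hxy with ⟨h1, -⟩ | ⟨h1, rfl⟩
    · exact h1
    · exact h.mapsTo y h1
  exact (h.mem_iff_notMem hx).1 hxK hxL

lemma mem_iff_mem (h : IsSatelliteCycle G H K L W f) {x y : Fin n}
    (hxy : s(x, y) ∈ {e | ∃ w ∈ W, e = s(w, f w)}) : (x ∈ K ↔ y ∉ K) := by
  have key : ∀ w ∈ W, (w ∈ K ↔ f w ∉ K) := by
    intro w hw
    by_cases hK : w ∈ K
    · have := (h.sat_right hw ((h.mem_iff_notMem hw).1 hK)).notMem'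
      tauto
    · have := (h.sat_left hw hK).mem
      tauto
  rcases mem_or_of_mem hxy with ⟨h1, rfl⟩ | ⟨h1, rfl⟩
  · exact key x h1
  · have := key y h1
    tauto

lemma isChordalGraph_exchangeGraph (h : IsSatelliteCycle G H K L W f)
    (hsp : IsSplitPair G H K L) :
    IsChordalGraph (exchangeGraph G H {e | ∃ w ∈ W, e = s(w, f w)}) := by
  refine isChordalGraph_of_split (K := K) (fun x y hx hy hxy => ?_) (fun x y hx hxy => ?_)
  · rw [exchangeGraph_adj_of_notMem fun he => (h.mem_iff_mem he).1 hx hy]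
    exact hsp.adj_left hx hy hxy
  · rcases exchangeGraph_adj.1 hxy with ⟨he, -⟩ | ⟨-, hadj⟩
    · by_contra hy
      exact hx ((h.mem_iff_mem he).2 hy)
    · exact hsp.mem_left hx hadj

lemma isClique_of_exchangeGraph (h : IsSatelliteCycle G H K L W f) (hsp : IsSplitPair G H K L)
    (S : Set (Fin n))
    (hS : (exchangeGraph G H {e | ∃ w ∈ W, e = s(w, f w)}).IsClique S) :
    G.IsClique S ∨ H.IsClique S := by
  by_cases hex : ∃ w ∈ W, w ∈ S ∧ f w ∈ S
  · obtain ⟨w, hw, hwS, hfS⟩ := hex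
    have hne : w ≠ f w := by
      rcases h.sat w hw with hs | hs
      · exact hs.adj.ne
      · exact hs.adj.ne
    have hadj : H.Adj w (f w) := (exchangeGraph_adj_of_mem (mk_mem hw)).1 (hS hwS hfS hne)
    have hwL : w ∉ L := by
      intro hL
      exact (h.sat_left hw fun hK => (h.mem_iff_notMem hw).1 hK hL).not_adj hadj
    have hs := h.sat_right hw hwL
    have hs' := h.sat_left (h.mapsTo w hw) hs.notMem'
    -- the clique lies in the closed neighbourhood of `w` in `H`
    have hnb : ∀ x ∈ S, x ≠ w → H.Adj w x := by
      intro x hx hxw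
      by_cases hxf : x = f w
      · rw [hxf]; exact hadj
      rcases exchangeGraph_adj.1 (hS hfS hx (Ne.symm hxf)) with ⟨he, hH⟩ | ⟨he, hG⟩
      · rcases mem_or_of_mem he with ⟨-, rfl⟩ | ⟨hxW, hx'⟩
        · exact absurd hH hs'.not_adj
        · exact absurd (h.inj x hxW w hw hx'.symm) hxw
      · refine h.adj_of_adj hsp hw hwL hG ?_
        rintro rfl
        exact he ⟨f w, h.mapsTo w hw, rfl⟩
    refine Or.inr fun x hx y hy hxy => ?_
    by_cases hxw : x = w
    · subst hxw; exact hnb y hy hxy.symm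
    by_cases hyw : y = w
    · subst hyw; exact (hnb x hx hxw).symm
    · exact hsp.adj_right (hsp.mem_right hwL (hnb x hx hxw)) (hsp.mem_right hwL (hnb y hy hyw)) hxy
  · refine Or.inl fun x hx y hy hxy => ?_
    refine (exchangeGraph_adj_of_notMem fun he => hex ?_).1 (hS hx hy hxy)
    rcases mem_or_of_mem he with ⟨h1, rfl⟩ | ⟨h1, rfl⟩
    · exact ⟨x, h1, hx, hy⟩
    · exact ⟨y, h1, hy, hx⟩

lemma isClique_exchangeGraph (h : IsSatelliteCycle G H K L W f) (hsp : IsSplitPair G H K L)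
    (S : Set (Fin n)) (hS : G.IsClique S) :
    (exchangeGraph G H {e | ∃ w ∈ W, e = s(w, f w)}).IsClique S ∨
      (exchangeGraph H G {e | ∃ w ∈ W, e = s(w, f w)}).IsClique S := by
  by_cases hex : ∃ w ∈ W, w ∈ S ∧ f w ∈ S
  · obtain ⟨w, hw, hwS, hfS⟩ := hex
    have hne : w ≠ f w := by
      rcases h.sat w hw with hs | hs
      · exact hs.adj.ne
      · exact hs.adj.ne
    have hadj : G.Adj w (f w) := hS hwS hfS hne
    have hwK : w ∉ K := by
      intro hK
      exact (h.sat_right hw ((h.mem_iff_notMem hw).1 hK)).not_adj hadj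
    have hs := h.sat_left hw hwK
    have hnb : ∀ x ∈ S, x ≠ w → x ≠ f w → x ∈ K ∧ x ∈ L ∧ H.Adj (f w) x ∧ H.Adj w x :=
      fun x hx hxw hxf => ⟨hsp.mem_left hwK (hS hwS hx (Ne.symm hxw)),
        hs.nbr (hS hwS hx (Ne.symm hxw)) hxf⟩
    have hkey : ∀ x y, x ∈ K → x ∈ L → H.Adj x y →
        (exchangeGraph H G {e | ∃ w ∈ W, e = s(w, f w)}).Adj x y := fun x y hK hL hxy =>
      (exchangeGraph_adj_of_notMem (h.notMem_of_mem hK hL)).2 hxy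
    refine Or.inr fun x hx y hy hxy => ?_
    by_cases hxw : x = w ∨ x = f w
    · by_cases hyw : y = w ∨ y = f w
      · rcases hxw with rfl | rfl <;> rcases hyw with hyw | hyw
        · exact absurd hyw.symm hxy
        · rw [hyw]; exact (exchangeGraph_adj_of_mem (mk_mem hw)).2 hadj
        · rw [hyw]; exact ((exchangeGraph_adj_of_mem (mk_mem hw)).2 hadj).symm
        · exact absurd hyw.symm hxy
      · push Not at hyw
        obtain ⟨h1, h2, h3, h4⟩ := hnb y hy hyw.1 hyw.2
        rcases hxw with rfl | rfl
        · exact (hkey y x h1 h2 h4.symm).symm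
        · exact (hkey y _ h1 h2 h3.symm).symm
    · push Not at hxw
      obtain ⟨h1, h2, h3, h4⟩ := hnb x hx hxw.1 hxw.2
      by_cases hyw : y = w
      · rw [hyw]; exact hkey x w h1 h2 h4.symm
      by_cases hyf : y = f w
      · rw [hyf]; exact hkey x _ h1 h2 h3.symm
      · exact hkey x y h1 h2 (hsp.adj_right h2 (hnb y hy hyw hyf).2.1 hxy)
  · refine Or.inl fun x hx y hy hxy => ?_
    refine (exchangeGraph_adj_of_notMem fun he => hex ?_).2 (hS hx hy hxy)
    rcases mem_or_of_mem he with ⟨h1, rfl⟩ | ⟨h1, rfl⟩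
    · exact ⟨x, h1, hx, hy⟩
    · exact ⟨y, h1, hy, hx⟩

/-- A cycle of satellites can be exchanged as a whole. -/
theorem fulfillsRhombus (h : IsSatelliteCycle G H K L W f) (hsp : IsSplitPair G H K L)
    (hW : W.Nonempty) :
    FulfillsRhombus (chordalGraphPolytope n) (charImset G) (charImset H) := by
  obtain ⟨w, hw, hwK⟩ : ∃ w ∈ W, w ∉ K := by
    obtain ⟨w, hw⟩ := hW
    by_cases hK : w ∈ K
    · exact ⟨f w, h.mapsTo w hw, (h.sat_right hw ((h.mem_iff_notMem hw).1 hK)).notMem'⟩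
    · exact ⟨w, hw, hK⟩
  have hs1 := h.sat_left hw hwK
  have hw1 := h.mapsTo w hw
  have hs2 := h.sat_right hw1 hs1.notMem'
  have hw2 := h.mapsTo _ hw1
  have hs3 := h.sat_left hw2 hs2.notMem'
  refine (isExchange_exchangeGraph (h.isClique_of_exchangeGraph hsp)
    (h.symm.isClique_of_exchangeGraph hsp.symm) (h.isClique_exchangeGraph hsp)
    (h.symm.isClique_exchangeGraph hsp.symm)).fulfillsRhombus
    (h.isChordalGraph_exchangeGraph hsp) (h.symm.isChordalGraph_exchangeGraph hsp.symm) ?_ ?_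
  · intro he
    have := hs1.adj
    rw [← he, exchangeGraph_adj_of_mem (mk_mem hw)] at this
    exact hs1.not_adj this
  · -- `K` contains two vertices of the cycle, and the edge between them is not exchanged
    intro he
    have hne : f w ≠ f (f (f w)) := by
      intro e
      have := hs3.adj
      rw [← e] at this
      exact hs2.not_adj this.symm
    have hadj := hsp.adj_left hs1.mem hs3.mem hne
    rw [← exchangeGraph_adj_of_notMem (H := H)
      fun he' => (h.mem_iff_mem he').1 hs1.mem hs3.mem, he] at hadj
    exact hs3.notMem' (hsp.mem_right hs1.notMem' hadj)

end IsSatelliteCycle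

end Exchange

section SingleVertex

variable {n : ℕ} {G H : SimpleGraph (Fin n)} {K L : Set (Fin n)}

/-! ### Split graphs that differ at one vertex -/

lemma IsOnFace.not_triangle {D : SimpleGraph (Fin n)} (hD : IsOnFace G H D) {x y z : Fin n}
    (hxy : D.Adj x y) (hxz : D.Adj x z) (hyz : D.Adj y z) :
    (G.Adj x y ∧ G.Adj x z ∧ G.Adj y z) ∨ (H.Adj x y ∧ H.Adj x z ∧ H.Adj y z) := by
  have hcl : D.IsClique {x, y, z} := by
    intro a ha b hb hab
    rcases ha with rfl | rfl | rfl <;> rcases hb with rfl | rfl | rfl <;>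
      first | exact absurd rfl hab | assumption | (apply SimpleGraph.Adj.symm; assumption)
  rcases hD.isClique_or hcl with h | h
  · exact Or.inl ⟨h (by simp) (by simp) hxy.ne, h (by simp) (by simp) hxz.ne,
      h (by simp) (by simp) hyz.ne⟩
  · exact Or.inr ⟨h (by simp) (by simp) hxy.ne, h (by simp) (by simp) hxz.ne,
      h (by simp) (by simp) hyz.ne⟩

/-- The edges of `G` at a vertex outside the clique of `G` that are missing in `H` occur together
in the graphs on the smallest face. -/
lemma IsOnFace.adj_of_adj_of_notMem {D : SimpleGraph (Fin n)} (hD : IsOnFace G H D)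
    (h : IsSplitPair G H K L) {d p q : Fin n} (hd : d ∉ K) (hq : G.Adj d q) (hp' : D.Adj d p)
    (hp : G.Adj d p) (hpH : ¬ H.Adj d p) : D.Adj d q := by
  have hcl : G.IsClique (insert d {u | G.Adj d u}) := by
    intro x hx y hy hxy
    rcases hx with rfl | hx
    · exact hy.resolve_left hxy.symm
    · rcases hy with rfl | hy
      · exact hx.symm
      · exact h.adj_left (h.mem_left hd hx) (h.mem_left hd hy) hxy
  exact hD.isClique_of_adj hcl (Set.mem_insert _ _) (Or.inr hp) hp' hpH (Set.mem_insert _ _)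
    (Or.inr hq) hq.ne

/-- If `G` and `H` differ only at a vertex `d` outside both cliques, and the smallest face contains
a third graph, then the neighbourhoods of `d` consist of the common part of the cliques and one
further vertex each, and union and intersection of `G` and `H` are witnesses. -/
theorem IsSplitPair.fulfillsRhombus_of_eq_off (h : IsSplitPair G H K L) (hne : G ≠ H) {d : Fin n}
    (hdK : d ∉ K) (hdL : d ∉ L)
    (heq : ∀ x y, x ≠ d → y ≠ d → (G.Adj x y ↔ H.Adj x y)) :
    FulfillsRhombus (chordalGraphPolytope n) (charImset G) (charImset H) := by
  by_cases hface : ∀ D, IsOnFace G H D → D = G ∨ D = H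
  · exact Or.inl (isPolytopeEdge_of_isOnFace hne h.isChordalGraph_left h.isChordalGraph_right hface)
  push Not at hface
  obtain ⟨D, hD, hDG, hDH⟩ := hface
  have hoff : ∀ {F : SimpleGraph (Fin n)}, IsOnFace G H F → ∀ x y, x ≠ d → y ≠ d →
      (F.Adj x y ↔ G.Adj x y) := by
    intro F hF x y hx hy
    constructor
    · intro hxy
      rcases hF.adj_or hxy with hh | hh
      · exact hh
      · exact (heq x y hx hy).2 hh
    · exact fun hxy => hF.adj_of_adj hxy ((heq x y hx hy).1 hxy)
  -- two graphs that agree off `d` and at `d` are equal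
  have hext : ∀ {F F' : SimpleGraph (Fin n)}, (∀ x y, x ≠ d → y ≠ d → (F.Adj x y ↔ F'.Adj x y)) →
      (∀ u, F.Adj d u ↔ F'.Adj d u) → F = F' := by
    intro F F' h1 h2
    ext x y
    by_cases hx : x = d
    · rw [hx]; exact h2 y
    by_cases hy : y = d
    · rw [hy, F.adj_comm, F'.adj_comm]; exact h2 x
    · exact h1 x y hx hy
  -- a graph on the smallest face with an edge at `d` of each kind
  obtain ⟨F, hF, p, q, hpG, hpH, hpF, hqH, hqG, hqF⟩ : ∃ F, IsOnFace G H F ∧ ∃ p q,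
      G.Adj d p ∧ ¬ H.Adj d p ∧ F.Adj d p ∧ H.Adj d q ∧ ¬ G.Adj d q ∧ F.Adj d q := by
    have hex1 : ∃ u, ¬ (D.Adj d u ↔ G.Adj d u) := by
      by_contra hcon; push Not at hcon
      exact hDG (hext (hoff hD) hcon)
    have hex2 : ∃ u, ¬ (D.Adj d u ↔ H.Adj d u) := by
      by_contra hcon; push Not at hcon
      exact hDH (hext (fun x y hx hy => (hoff hD x y hx hy).trans (heq x y hx hy)) hcon)
    obtain ⟨u, hu⟩ := hex1
    obtain ⟨w, hw⟩ := hex2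
    have hDor : ∀ x, D.Adj d x → G.Adj d x ∨ H.Adj d x := fun x hx => hD.adj_or hx
    have hDand : ∀ x, G.Adj d x → H.Adj d x → D.Adj d x := fun x => hD.adj_of_adj
    have c1 := hDor u; have c2 := hDor w; have c3 := hDand u; have c4 := hDand w
    have hl : ∀ a b, G.Adj d a → ¬ H.Adj d a → D.Adj d a → G.Adj d b → D.Adj d b :=
      fun a b ha ha' haD hb => hD.adj_of_adj_of_notMem h hdK hb haD ha ha'
    have hr : ∀ a b, H.Adj d a → ¬ G.Adj d a → D.Adj d a → H.Adj d b → D.Adj d b :=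
      fun a b ha ha' haD hb => hD.symm.adj_of_adj_of_notMem h.symm hdL hb haD ha ha'
    by_cases hu' : D.Adj d u
    · have huG : ¬ G.Adj d u := fun hh => hu ⟨fun _ => hh, fun _ => hu'⟩
      have huH : H.Adj d u := (c1 hu').resolve_left huG
      by_cases hw' : D.Adj d w
      · have hwH : ¬ H.Adj d w := fun hh => hw ⟨fun _ => hh, fun _ => hw'⟩
        exact ⟨D, hD, w, u, (c2 hw').resolve_right hwH, hwH, hw', huH, huG, hu'⟩
      · have hwH : H.Adj d w := by
          by_contra hh; exact hw ⟨fun h => absurd h hw', fun h => absurd h hh⟩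
        exact absurd (hr u w huH huG hu' hwH) hw'
    · have huG : G.Adj d u := by
        by_contra hh; exact hu ⟨fun h => absurd h hu', fun h => absurd h hh⟩
      have huH : ¬ H.Adj d u := fun hh => hu' (c3 huG hh)
      by_cases hw' : D.Adj d w
      · have hwH : ¬ H.Adj d w := fun hh => hw ⟨fun _ => hh, fun _ => hw'⟩
        exact absurd (hl w u ((c2 hw').resolve_right hwH) hwH hw' huG) hu'
      · have hwH : H.Adj d w := by
          by_contra hh; exact hw ⟨fun h => absurd h hw', fun h => absurd h hh⟩
        have hwG : ¬ G.Adj d w := fun hh => hw' (c4 hh hwH)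
        obtain ⟨F, hF, h1, h2⟩ := exists_isOnFace_adj_adj huG huH hwH hwG hD hu' hw'
        exact ⟨F, hF, u, w, huG, huH, h1, hwH, hwG, h2⟩
  have hpd : p ≠ d := hpG.ne'
  have hqd : q ≠ d := hqH.ne'
  have hpq : p ≠ q := by rintro rfl; exact hpH hqH
  have hpK := h.mem_left hdK hpG
  have hqL := h.mem_right hdL hqH
  have hpqF : ¬ F.Adj p q := by
    intro hh
    rcases hF.not_triangle hpF hqF hh with ⟨-, h2, -⟩ | ⟨h1, -, -⟩
    · exact hqG h2
    · exact hpH h1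
  have hpqG : ¬ G.Adj p q := fun hh => hpqF ((hoff hF p q hpd hqd).2 hh)
  have hpqH : ¬ H.Adj p q := fun hh => hpqG ((heq p q hpd hqd).2 hh)
  have hpL : p ∉ L := fun hh => hpqH (h.adj_right hh hqL hpq)
  have hqK : q ∉ K := fun hh => hpqG (h.adj_left hpK hh hpq)
  have hKL : ∀ x, x ∈ K → x ∉ L → x = p := by
    intro x hxK hxL
    by_contra hxp
    have hxd : x ≠ d := by rintro rfl; exact hdK hxK
    exact hpL (h.mem_right hxL ((heq x p hxd hpd).1 (h.adj_left hxK hpK hxp)))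
  have hLK : ∀ x, x ∈ L → x ∉ K → x = q := by
    intro x hxL hxK
    by_contra hxq
    have hxd : x ≠ d := by rintro rfl; exact hdL hxL
    exact hqK (h.mem_left hxK ((heq x q hxd hqd).2 (h.adj_right hxL hqL hxq)))
  -- the four-cycle `d p a q` forces `d` to be adjacent to the common part of the cliques
  have hA : ∀ a, a ∈ K → a ∈ L → G.Adj d a ∧ H.Adj d a := by
    intro a haK haL
    have had : a ≠ d := by rintro rfl; exact hdK haK
    have hap : p ≠ a := by rintro rfl; exact hpL haL
    have haq : a ≠ q := by rintro rfl; exact hqK haK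
    have h1 : F.Adj p a := (hoff hF p a hpd had).2 (h.adj_left hpK haK hap)
    have h2 : F.Adj a q := (hoff hF a q had hqd).2 ((heq a q had hqd).2 (h.adj_right haL hqL haq))
    rcases hF.1.four_cycle hpF h1 h2 hqF.symm had.symm hpq with hh | hh
    · have h3 : F.Adj a p := h1.symm
      constructor
      · rcases hF.not_triangle hh hpF h3 with ⟨h4, -⟩ | ⟨-, h4, -⟩
        · exact h4
        · exact absurd h4 hpH
      · rcases hF.not_triangle hh hqF h2 with ⟨-, h4, -⟩ | ⟨h4, -⟩
        · exact absurd h4 hqG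
        · exact h4
    · exact absurd hh hpqF
  have hGd : ∀ u, G.Adj d u ↔ (u ∈ K ∧ u ∈ L) ∨ u = p := by
    intro u
    constructor
    · intro hu
      have huK := h.mem_left hdK hu
      by_cases huL : u ∈ L
      · exact Or.inl ⟨huK, huL⟩
      · exact Or.inr (hKL u huK huL)
    · rintro (hu | rfl)
      · exact (hA u hu.1 hu.2).1
      · exact hpG
  have hHd : ∀ u, H.Adj d u ↔ (u ∈ K ∧ u ∈ L) ∨ u = q := by
    intro u
    constructor
    · intro hu
      have huL := h.mem_right hdL hu
      by_cases huK : u ∈ K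
      · exact Or.inl ⟨huK, huL⟩
      · exact Or.inr (hLK u huL huK)
    · rintro (hu | rfl)
      · exact (hA u hu.1 hu.2).2
      · exact hqH
  -- then the union and the intersection of `G` and `H` are witnesses
  have hdq : ∀ {x y}, s(x, y) = s(d, q) ↔ (x = d ∧ y = q) ∨ (x = q ∧ y = d) := by
    intro x y; simp
  have keyD : ∀ x y, (exchangeGraph G H {s(d, q)}).Adj x y ↔ s(x, y) = s(d, q) ∨ G.Adj x y := by
    intro x y
    by_cases hxy : s(x, y) = s(d, q)
    · rw [exchangeGraph_adj_of_mem (by simpa using hxy)]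
      refine ⟨fun _ => Or.inl hxy, fun _ => ?_⟩
      rcases hdq.1 hxy with ⟨rfl, rfl⟩ | ⟨rfl, rfl⟩
      · exact hqH
      · exact hqH.symm
    · rw [exchangeGraph_adj_of_notMem (by simpa using hxy)]
      simp [hxy]
  have keyE : ∀ x y, (exchangeGraph H G {s(d, q)}).Adj x y ↔ s(x, y) ≠ s(d, q) ∧ H.Adj x y := by
    intro x y
    by_cases hxy : s(x, y) = s(d, q)
    · rw [exchangeGraph_adj_of_mem (by simpa using hxy)]
      refine ⟨fun hh => absurd hh ?_, fun hh => absurd hxy hh.1⟩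
      rcases hdq.1 hxy with ⟨rfl, rfl⟩ | ⟨rfl, rfl⟩
      · exact hqG
      · exact fun h => hqG h.symm
    · rw [exchangeGraph_adj_of_notMem (by simpa using hxy)]
      simp [hxy]
  have hindep : ∀ x y, ¬ (x ∈ K ∧ x ∈ L) → x ≠ d → ¬ (y ∈ K ∧ y ∈ L) → y ≠ d → ¬ G.Adj x y := by
    intro x y hx hxd hy hyd hxy
    have hxyH := (heq x y hxd hyd).1 hxy
    have m1 : x ∉ K → y ∈ K := fun hh => h.mem_left hh hxy
    have m2 : x ∉ L → y ∈ L := fun hh => h.mem_right hh hxyH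
    by_cases hxK : x ∈ K
    · have hxL : x ∉ L := fun hh => hx ⟨hxK, hh⟩
      have hyL := m2 hxL
      have hyK : y ∉ K := fun hh => hy ⟨hh, hyL⟩
      rw [hKL x hxK hxL, hLK y hyL hyK] at hxy
      exact hpqG hxy
    · have hyK := m1 hxK
      have hyL : y ∉ L := fun hh => hy ⟨hyK, hh⟩
      have hxL : x ∈ L := by by_contra hh; exact hyL (m2 hh)
      rw [hLK x hxL hxK, hKL y hyK hyL] at hxy
      exact hpqG hxy.symm
  refine (isExchange_exchangeGraph (E := {s(d, q)}) ?_ ?_ ?_ ?_).fulfillsRhombus ?_ ?_ ?_ ?_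
  · intro S hS
    by_cases hmem : d ∈ S ∧ q ∈ S
    · have hpS : p ∉ S := by
        intro hpS
        rcases (keyD p q).1 (hS hpS hmem.2 hpq) with hh | hh
        · rcases hdq.1 hh with ⟨h1, -⟩ | ⟨h1, -⟩
          · exact hpd h1
          · exact hpq h1
        · exact hpqG hh
      have hd : ∀ u ∈ S, u ≠ d → H.Adj d u := by
        intro u hu hud
        rcases (keyD d u).1 (hS hmem.1 hu hud.symm) with hh | hh
        · rcases hdq.1 hh with ⟨-, rfl⟩ | ⟨h1, -⟩
          · exact hqH
          · exact absurd h1.symm hqd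
        · rcases (hGd u).1 hh with h1 | rfl
          · exact (hHd u).2 (Or.inl h1)
          · exact absurd hu hpS
      refine Or.inr fun x hx y hy hxy => ?_
      by_cases hxd : x = d
      · rw [hxd]; exact hd y hy (hxd ▸ hxy.symm)
      by_cases hyd : y = d
      · rw [hyd]; exact (hd x hx hxd).symm
      · rcases (keyD x y).1 (hS hx hy hxy) with hh | hh
        · rcases hdq.1 hh with ⟨h1, -⟩ | ⟨-, h1⟩
          · exact absurd h1 hxd
          · exact absurd h1 hyd
        · exact (heq x y hxd hyd).1 hh
    · refine Or.inl fun x hx y hy hxy => ((keyD x y).1 (hS hx hy hxy)).resolve_left fun hh => ?_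
      rcases hdq.1 hh with ⟨rfl, rfl⟩ | ⟨rfl, rfl⟩
      · exact hmem ⟨hx, hy⟩
      · exact hmem ⟨hy, hx⟩
  · exact fun S hS => Or.inl fun x hx y hy hxy => ((keyE x y).1 (hS hx hy hxy)).2
  · exact fun S hS => Or.inl fun x hx y hy hxy => (keyD x y).2 (Or.inr (hS hx hy hxy))
  · intro S hS
    by_cases hmem : d ∈ S ∧ q ∈ S
    · have hd : ∀ u ∈ S, u ≠ d → (exchangeGraph G H {s(d, q)}).Adj d u := by
        intro u hu hud
        rw [keyD]
        rcases (hHd u).1 (hS hmem.1 hu hud.symm) with h1 | rfl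
        · exact Or.inr ((hGd u).2 (Or.inl h1))
        · exact Or.inl rfl
      refine Or.inr fun x hx y hy hxy => ?_
      by_cases hxd : x = d
      · rw [hxd]; exact hd y hy (hxd ▸ hxy.symm)
      by_cases hyd : y = d
      · rw [hyd]; exact (hd x hx hxd).symm
      · exact (keyD x y).2 (Or.inr ((heq x y hxd hyd).2 (hS hx hy hxy)))
    · refine Or.inl fun x hx y hy hxy => (keyE x y).2 ⟨fun hh => ?_, hS hx hy hxy⟩
      rcases hdq.1 hh with ⟨rfl, rfl⟩ | ⟨rfl, rfl⟩
      · exact hmem ⟨hx, hy⟩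
      · exact hmem ⟨hy, hx⟩
  · refine isChordalGraph_of_split (K := {x | (x ∈ K ∧ x ∈ L) ∨ x = d}) ?_ ?_
    · rintro x y (hx | rfl) (hy | rfl) hxy
      · exact (keyD x y).2 (Or.inr (h.adj_left hx.1 hy.1 hxy))
      · exact (keyD x y).2 (Or.inr (hA x hx.1 hx.2).1.symm)
      · exact (keyD x y).2 (Or.inr (hA y hy.1 hy.2).1)
      · exact absurd rfl hxy
    · intro x y hx hxy
      by_contra hy
      have hx := not_or.1 hx
      have hy := not_or.1 hy
      rcases (keyD x y).1 hxy with hh | hh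
      · rcases hdq.1 hh with ⟨h1, -⟩ | ⟨-, h1⟩
        · exact hx.2 h1
        · exact hy.2 h1
      · exact hindep x y hx.1 hx.2 hy.1 hy.2 hh
  · refine isChordalGraph_of_split (K := {x | (x ∈ K ∧ x ∈ L) ∨ x = d}) ?_ ?_
    · have hne' : ∀ x y, (x ∈ K ∧ x ∈ L) ∨ x = d → (y ∈ K ∧ y ∈ L) ∨ y = d →
          s(x, y) ≠ s(d, q) := by
        intro x y hx hy hh
        rcases hdq.1 hh with ⟨-, rfl⟩ | ⟨rfl, -⟩
        · exact hy.elim (fun h1 => hqK h1.1) hqd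
        · exact hx.elim (fun h1 => hqK h1.1) hqd
      intro x y hx hy hxy
      refine (keyE x y).2 ⟨hne' x y hx hy, ?_⟩
      rcases hx with hx | rfl <;> rcases hy with hy | rfl
      · exact h.adj_right hx.2 hy.2 hxy
      · exact (hA x hx.1 hx.2).2.symm
      · exact (hA y hy.1 hy.2).2
      · exact absurd rfl hxy
    · intro x y hx hxy
      by_contra hy
      have hx := not_or.1 hx
      have hy := not_or.1 hy
      exact hindep x y hx.1 hx.2 hy.1 hy.2 ((heq x y hx.2 hy.2).2 ((keyE x y).1 hxy).2)
  · intro he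
    have := (keyD d q).2 (Or.inl rfl)
    rw [he] at this
    exact hqG this
  · intro he
    have := (keyD d p).2 (Or.inr hpG)
    rw [he] at this
    exact hpH this

end SingleVertex

section Main

variable {n : ℕ} {G H D : SimpleGraph (Fin n)} {K L : Set (Fin n)}

/-! ### Satellites forced by the smallest face -/

lemma IsSplitPair.isClique_neighbors (h : IsSplitPair G H K L) {d : Fin n} (hd : d ∉ K) :
    G.IsClique (insert d {u | G.Adj d u}) := by
  intro x hx y hy hxy
  rcases hx with rfl | hx
  · exact hy.resolve_left hxy.symm
  · rcases hy with rfl | hy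
    · exact hx.symm
    · exact h.adj_left (h.mem_left hd hx) (h.mem_left hd hy) hxy

/-- If a graph on the smallest face contains the clique of `H` and an edge `vy` of `G` outside `H`,
where the neighbours of `v` in `G` form a clique of `H`, then `v` is a satellite of `y`, and `y` is
in turn a satellite by an edge of `H` that is missing in the given graph, unless a vertex or a
single edge can be exchanged. -/
lemma IsOnFace.exists_isSatellite (h : IsSplitPair G H K L) (hD : IsOnFace G H D)
    (hL : ∀ x ∈ L, ∀ y ∈ L, x ≠ y → D.Adj x y) {v y : Fin n} (hvK : v ∉ K)
    (hv : NeighborsAdjIn G H v) (hy : G.Adj v y) (hyH : ¬ H.Adj v y) (hyD : D.Adj v y)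
    (hvertex : v ∉ L → ¬ NeighborsAdjIn H G v)
    (hedge : IsSatellite G H K L v y → ∃ x, H.Adj y x ∧ ¬ G.Adj v x) :
    IsSatellite G H K L v y ∧ ∃ x, IsSatellite H G L K y x ∧ ¬ D.Adj y x ∧
      NeighborsAdjIn H G y := by
  have hyK := h.mem_left hvK hy
  -- outside `L`, the vertex `v` has a neighbour in `H`, and in the given graph, outside `K`
  have hc : v ∉ L → ∃ c, c ∉ K ∧ c ∈ L ∧ D.Adj v c ∧ ¬ G.Adj v c := by
    intro hvL
    have hnot := hvertex hvL
    unfold NeighborsAdjIn at hnot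
    push Not at hnot
    obtain ⟨u, w, hu, hw, huw, hG⟩ := hnot
    have huL := h.mem_right hvL hu
    have hwL := h.mem_right hvL hw
    have hcl := hD.symm.isClique_of_adj (h.symm.isClique_neighbors hvL) (Or.inr hu) (Or.inr hw)
      (hL u huL w hwL huw) hG
    have hDv : ∀ c, H.Adj v c → D.Adj v c := fun c hc =>
      hcl (Set.mem_insert _ _) (Or.inr hc) hc.ne
    have : ∃ c, c ∉ K ∧ H.Adj v c := by
      by_cases huK : u ∈ K
      · exact ⟨w, fun hwK => hG (h.adj_left huK hwK huw), hw⟩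
      · exact ⟨u, huK, hu⟩
    obtain ⟨c, hcK, hc⟩ := this
    exact ⟨c, hcK, h.mem_right hvL hc, hDv c hc, fun hh => hcK (h.mem_left hvK hh)⟩
  have hnotL : ∀ z, G.Adj v z → ¬ H.Adj v z → D.Adj v z → z ∉ L := by
    intro z hz hzH hzD hzL
    by_cases hvL : v ∈ L
    · exact hzH (h.adj_right hvL hzL hz.ne)
    · obtain ⟨c, hcK, hcL, hcD, hcG⟩ := hc hvL
      have hzc : z ≠ c := by rintro rfl; exact hcK (h.mem_left hvK hz)
      rcases hD.not_triangle hzD hcD (hL z hzL c hcL hzc) with ⟨-, h2, -⟩ | ⟨h1, -, -⟩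
      · exact hcG h2
      · exact hzH h1
  have hyL := hnotL y hy hyH hyD
  have hsat : IsSatellite G H K L v y := by
    refine ⟨hvK, hyK, hyL, hy, hyH, fun a ha hay => ?_⟩
    have hya : H.Adj y a := hv hy ha hay.symm
    have haL := h.mem_right hyL hya
    refine ⟨haL, hya, ?_⟩
    by_contra hva
    exact hnotL a ha hva (hD.adj_of_adj_of_notMem h hvK ha hyD hy hyH) haL
  refine ⟨hsat, ?_⟩
  obtain ⟨x, hyx, hvx⟩ := hedge hsat
  have hkey : ∀ x, H.Adj y x → ¬ G.Adj v x → ¬ D.Adj y x := by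
    intro x hyx hvx hDyx
    have hxL := h.mem_right hyL hyx
    have hxv : v ≠ x := by rintro rfl; exact hyH hyx.symm
    have htri : ¬ D.Adj v x := by
      intro hh
      rcases hD.not_triangle hyD hh hDyx with ⟨-, h2, -⟩ | ⟨h1, -, -⟩
      · exact hvx h2
      · exact hyH h1
    by_cases hvL : v ∈ L
    · exact htri (hL v hvL x hxL hxv)
    · obtain ⟨c, hcK, hcL, hcD, hcG⟩ := hc hvL
      have hyc : ¬ D.Adj y c := by
        intro hh
        rcases hD.not_triangle hyD hcD hh with ⟨-, h2, -⟩ | ⟨h1, -, -⟩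
        · exact hcG h2
        · exact hyH h1
      have hxc : x ≠ c := by rintro rfl; exact hyc hDyx
      have hyc' : y ≠ c := by rintro rfl; exact hcK hyK
      rcases hD.1.four_cycle hyD hDyx (hL x hxL c hcL hxc) hcD.symm hxv hyc' with hh | hh
      · exact htri hh
      · exact hyc hh
  have hDyx := hkey x hyx hvx
  have hxL := h.mem_right hyL hyx
  have hxG : ¬ G.Adj y x := fun hh => hDyx (hD.adj_of_adj hh hyx)
  have hxK : x ∉ K := fun hh => hxG (h.adj_left hyK hh hyx.ne)
  have hnb : NeighborsAdjIn H G y := by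
    intro u w hu hw huw
    by_contra hG
    have hcl := hD.symm.isClique_of_adj (h.symm.isClique_neighbors hyL) (Or.inr hu) (Or.inr hw)
      (hL u (h.mem_right hyL hu) w (h.mem_right hyL hw) huw) hG
    exact hDyx (hcl (Set.mem_insert _ _) (Or.inr hyx) hyx.ne)
  refine ⟨x, ⟨hyL, hxL, hxK, hyx, hxG, fun a ha hax => ?_⟩, hDyx, hnb⟩
  have hxa : G.Adj x a := hnb hyx ha hax.symm
  have haK := h.mem_left hxK hxa
  exact ⟨haK, hxa, h.adj_left hyK haK ha.ne⟩

lemma IsSatellite.unique {v b b' : Fin n} (h : IsSatellite G H K L v b)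
    (h' : IsSatellite G H K L v b') : b = b' := by
  by_contra hne
  exact h'.not_adj (h.nbr h'.adj (Ne.symm hne)).2.2

/-! ### Main edges -/

/-- An edge `xy` of `G` is main if it lies in the clique `K`, or in the clique formed by a vertex
and its neighbours, provided two of these neighbours are not adjacent in `H`. On the smallest face,
the main edges of `G` outside `H` occur all together. -/
def IsMain (G H : SimpleGraph (Fin n)) (K : Set (Fin n)) (x y : Fin n) : Prop :=
  (x ∈ K ∨ ¬ NeighborsAdjIn G H x) ∧ (y ∈ K ∨ ¬ NeighborsAdjIn G H y)

lemma IsMain.symm {x y : Fin n} (h : IsMain G H K x y) : IsMain G H K y x := ⟨h.2, h.1⟩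

lemma isMain_comm {x y : Fin n} : IsMain G H K x y ↔ IsMain G H K y x := ⟨.symm, .symm⟩

/-- A graph on the smallest face that contains the clique `K` contains all main edges of `G`. -/
lemma IsOnFace.adj_of_isMain (h : IsSplitPair G H K L) (hD : IsOnFace G H D)
    (hK : ∀ x ∈ K, ∀ y ∈ K, x ≠ y → D.Adj x y) {x y : Fin n} (hxy : G.Adj x y)
    (hm : IsMain G H K x y) : D.Adj x y := by
  have key : ∀ x y, x ∉ K → G.Adj x y → ¬ NeighborsAdjIn G H x → D.Adj x y := by
    intro x y hx hxy hnot
    unfold NeighborsAdjIn at hnot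
    push Not at hnot
    obtain ⟨u, w, hu, hw, huw, hH⟩ := hnot
    have hcl := hD.isClique_of_adj (h.isClique_neighbors hx) (Or.inr hu) (Or.inr hw)
      (hK u (h.mem_left hx hu) w (h.mem_left hx hw) huw) hH
    exact hcl (Set.mem_insert _ _) (Or.inr hxy) hxy.ne
  by_cases hx : x ∈ K
  · by_cases hy : y ∈ K
    · exact hK x hx y hy hxy.ne
    · exact (key y x hy hxy.symm (hm.2.resolve_left hy)).symm
  · exact key x y hx hxy (hm.1.resolve_left hx)

/-- If one edge in `K` outside `H` is missing, so are all main edges of `G` outside `H`. -/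
lemma IsOnFace.not_adj_of_isMain (h : IsSplitPair G H K L) (hD : IsOnFace G H D) {p q : Fin n}
    (hp : p ∈ K) (hq : q ∈ K) (hpq : p ≠ q) (hpqD : ¬ D.Adj p q) {x y : Fin n}
    (hxy : G.Adj x y) (hxyH : ¬ H.Adj x y) (hm : IsMain G H K x y) : ¬ D.Adj x y := by
  have hK : ∀ u ∈ K, ∀ w ∈ K, ¬ H.Adj u w → ¬ D.Adj u w := by
    intro u hu w hw hH huw
    have hcl : G.IsClique K := fun a ha b hb hab => h.adj_left ha hb hab
    exact hpqD (hD.isClique_of_adj hcl hu hw huw hH hp hq hpq)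
  have key : ∀ x y, x ∉ K → G.Adj x y → ¬ H.Adj x y → ¬ NeighborsAdjIn G H x → ¬ D.Adj x y := by
    intro x y hx hxy hxyH hnot hxyD
    unfold NeighborsAdjIn at hnot
    push Not at hnot
    obtain ⟨u, w, hu, hw, huw, hH⟩ := hnot
    have hcl := hD.isClique_of_adj (h.isClique_neighbors hx) (Set.mem_insert _ _) (Or.inr hxy)
      hxyD hxyH
    exact hK u (h.mem_left hx hu) w (h.mem_left hx hw) hH (hcl (Or.inr hu) (Or.inr hw) huw)
  by_cases hx : x ∈ K
  · by_cases hy : y ∈ K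
    · exact hK x hx y hy hxyH
    · exact fun hh => key y x hy hxy.symm (fun h => hxyH h.symm) (hm.2.resolve_left hy) hh.symm
  · exact key x y hx hxy hxyH (hm.1.resolve_left hx)

/-! ### Joining the main parts of both graphs -/

/-- `D` is a chordal graph between `G ⊓ H` and `G ⊔ H` that contains the main edges of both graphs,
and whose cliques are cliques of `G` or of `H`. -/
structure IsMainJoin (G H : SimpleGraph (Fin n)) (K L : Set (Fin n)) (D : SimpleGraph (Fin n)) :
    Prop where
  chordal : IsChordalGraph D
  of_both : ∀ ⦃x y⦄, G.Adj x y → H.Adj x y → D.Adj x y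
  adj_or : ∀ ⦃x y⦄, D.Adj x y → G.Adj x y ∨ H.Adj x y
  isClique_or : ∀ S : Set (Fin n), D.IsClique S → G.IsClique S ∨ H.IsClique S
  main_left : ∀ ⦃x y⦄, G.Adj x y → IsMain G H K x y → D.Adj x y
  main_right : ∀ ⦃x y⦄, H.Adj x y → IsMain H G L x y → D.Adj x y

lemma IsMainJoin.symm (h : IsMainJoin G H K L D) : IsMainJoin H G L K D :=
  ⟨h.chordal, fun _ _ h1 h2 => h.of_both h2 h1, fun _ _ h1 => (h.adj_or h1).symm,
    fun S hS => (h.isClique_or S hS).symm, h.main_right, h.main_left⟩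

/-- An edge of `G` at a vertex whose neighbours form a clique of both graphs can be deleted. -/
lemma IsMainJoin.deleteEdge (hsp : IsSplitPair G H K L) (h : IsMainJoin G H K L D) {v y : Fin n}
    (hvK : v ∉ K) (hv : NeighborsAdjIn G H v) (hG : G.Adj v y) (hH : ¬ H.Adj v y)
    (hD : D.Adj v y) : IsMainJoin G H K L (D.deleteEdges {s(v, y)}) := by
  have hadj : ∀ a b, (D.deleteEdges {s(v, y)}).Adj a b ↔ D.Adj a b ∧ s(a, b) ≠ s(v, y) := by
    intro a b; simp
  have heq : ∀ {a b}, s(a, b) = s(v, y) → (a = v ∧ b = y) ∨ (a = y ∧ b = v) := by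
    intro a b hab; simpa [Sym2.eq_iff] using hab
  have hHne : ∀ {a b}, H.Adj a b → s(a, b) ≠ s(v, y) := by
    intro a b hab he
    rcases heq he with ⟨rfl, rfl⟩ | ⟨rfl, rfl⟩
    · exact hH hab
    · exact hH hab.symm
  have htri : ∀ u, D.Adj u v → D.Adj u y → G.Adj v u := by
    intro u huv huy
    have hcl : D.IsClique {v, y, u} := by
      intro a ha b hb hab
      rcases ha with rfl | rfl | rfl <;> rcases hb with rfl | rfl | rfl <;>
        first | exact absurd rfl hab | assumption | (apply SimpleGraph.Adj.symm; assumption)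
    rcases h.isClique_or _ hcl with h' | h'
    · exact h' (by simp) (by simp) huv.ne'
    · exact absurd (h' (by simp) (by simp) hD.ne) hH
  refine ⟨h.chordal.deleteEdge hD ?_, ?_, ?_, ?_, ?_, ?_⟩
  · intro u w huv huy hwv hwy huw
    have hu := htri u huv huy
    have hw := htri w hwv hwy
    exact h.of_both (hsp.adj_left (hsp.mem_left hvK hu) (hsp.mem_left hvK hw) huw) (hv hu hw huw)
  · exact fun a b h1 h2 => (hadj a b).2 ⟨h.of_both h1 h2, hHne h2⟩
  · exact fun a b h1 => h.adj_or ((hadj a b).1 h1).1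
  · exact fun S hS => h.isClique_or S fun a ha b hb hab => ((hadj a b).1 (hS ha hb hab)).1
  · intro a b h1 h2
    refine (hadj a b).2 ⟨h.main_left h1 h2, fun he => ?_⟩
    rcases heq he with ⟨rfl, rfl⟩ | ⟨rfl, rfl⟩
    · exact h2.1.elim hvK fun hh => hh hv
    · exact h2.2.elim hvK fun hh => hh hv
  · exact fun a b h1 h2 => (hadj a b).2 ⟨h.main_right h1 h2, hHne h1⟩

/-- A minimal join of the main parts has no edges of only one graph besides the main edges. -/
lemma IsMainJoin.isMain_of_minimal (hsp : IsSplitPair G H K L)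
    (h : Minimal (IsMainJoin G H K L) D) {x y : Fin n} (hD : D.Adj x y) (hG : G.Adj x y)
    (hH : ¬ H.Adj x y) : IsMain G H K x y := by
  have key : ∀ v y, D.Adj v y → G.Adj v y → ¬ H.Adj v y → v ∈ K ∨ ¬ NeighborsAdjIn G H v := by
    intro v y hD hG hH
    by_contra hcon
    push Not at hcon
    have hle := h.2 (h.1.deleteEdge hsp hcon.1 hcon.2 hG hH hD) (SimpleGraph.deleteEdges_le _)
    have := hle hD
    simp at this
  exact ⟨key x y hD hG hH, key y x hD.symm hG.symm fun h => hH h.symm⟩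

/-- The graph with the common edges of `G` and `H` and the edges of either that are not main. -/
def nonMainGraph (G H : SimpleGraph (Fin n)) (K L : Set (Fin n)) : SimpleGraph (Fin n) where
  Adj x y := (G.Adj x y ∧ H.Adj x y) ∨ (G.Adj x y ∧ ¬ H.Adj x y ∧ ¬ IsMain G H K x y) ∨
    (H.Adj x y ∧ ¬ G.Adj x y ∧ ¬ IsMain H G L x y)
  symm := ⟨fun x y h => by
    rwa [G.adj_comm, H.adj_comm, isMain_comm, isMain_comm (G := H)] at h⟩
  loopless := ⟨fun x h => by simp at h⟩

lemma nonMainGraph_adj {x y : Fin n} : (nonMainGraph G H K L).Adj x y ↔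
    (G.Adj x y ∧ H.Adj x y) ∨ (G.Adj x y ∧ ¬ H.Adj x y ∧ ¬ IsMain G H K x y) ∨
    (H.Adj x y ∧ ¬ G.Adj x y ∧ ¬ IsMain H G L x y) := Iff.rfl

lemma nonMainGraph_comm : nonMainGraph G H K L = nonMainGraph H G L K := by
  ext x y
  simp only [nonMainGraph_adj]
  tauto

lemma nonMainGraph_adj_of_mem (hsp : IsSplitPair G H K L) {x y : Fin n} (hx : x ∈ K) (hy : y ∈ K)
    (h : (nonMainGraph G H K L).Adj x y) : G.Adj x y ∧ H.Adj x y := by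
  rcases nonMainGraph_adj.1 h with h | ⟨-, -, h⟩ | ⟨-, h, -⟩
  · exact h
  · exact absurd ⟨Or.inl hx, Or.inl hy⟩ h
  · exact absurd (hsp.adj_left hx hy (nonMainGraph G H K L |>.ne_of_adj ‹_›)) h

/-- The neighbours of a vertex outside both cliques are its neighbours in one of the graphs, and
they form a clique. -/
lemma nonMainGraph_neighbors (hsp : IsSplitPair G H K L) {d : Fin n} (hdK : d ∉ K) (hdL : d ∉ L)
    (hvertex : (∃ u, ¬ (G.Adj d u ↔ H.Adj d u)) →
      ¬ (NeighborsAdjIn G H d ∧ NeighborsAdjIn H G d)) :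
    ((∀ u, (nonMainGraph G H K L).Adj d u → G.Adj d u) ∨
      (∀ u, (nonMainGraph G H K L).Adj d u → H.Adj d u)) ∧
    (∀ u w, (nonMainGraph G H K L).Adj d u → (nonMainGraph G H K L).Adj d w → u ≠ w →
      (nonMainGraph G H K L).Adj u w) := by
  have hGm : ¬ NeighborsAdjIn G H d → ∀ u, G.Adj d u → IsMain G H K d u := fun h u hu =>
    ⟨Or.inr h, Or.inl (hsp.mem_left hdK hu)⟩
  have hHm : ¬ NeighborsAdjIn H G d → ∀ u, H.Adj d u → IsMain H G L d u := fun h u hu =>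
    ⟨Or.inr h, Or.inl (hsp.mem_right hdL hu)⟩
  have hGK : ∀ u w, G.Adj d u → G.Adj d w → u ≠ w → G.Adj u w := fun u w hu hw huw =>
    hsp.adj_left (hsp.mem_left hdK hu) (hsp.mem_left hdK hw) huw
  have hHL : ∀ u w, H.Adj d u → H.Adj d w → u ≠ w → H.Adj u w := fun u w hu hw huw =>
    hsp.adj_right (hsp.mem_right hdL hu) (hsp.mem_right hdL hw) huw
  by_cases hG : NeighborsAdjIn G H d
  · have hsub : ∀ u, (nonMainGraph G H K L).Adj d u → G.Adj d u := by
      intro u hu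
      rcases nonMainGraph_adj.1 hu with h | h | ⟨h1, h2, h3⟩
      · exact h.1
      · exact h.1
      · by_cases hH : NeighborsAdjIn H G d
        · exact absurd ⟨hG, hH⟩ (hvertex ⟨u, fun hh => h2 (hh.2 h1)⟩)
        · exact absurd (hHm hH u h1) h3
    exact ⟨Or.inl hsub, fun u w hu hw huw => nonMainGraph_adj.2 (Or.inl
      ⟨hGK u w (hsub u hu) (hsub w hw) huw, hG (hsub u hu) (hsub w hw) huw⟩)⟩
  · have hsub : ∀ u, (nonMainGraph G H K L).Adj d u → H.Adj d u := by
      intro u hu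
      rcases nonMainGraph_adj.1 hu with h | ⟨h1, -, h3⟩ | h
      · exact h.2
      · exact absurd (hGm hG u h1) h3
      · exact h.1
    refine ⟨Or.inr hsub, fun u w hu hw huw => nonMainGraph_adj.2 (Or.inl ⟨?_,
      hHL u w (hsub u hu) (hsub w hw) huw⟩)⟩
    by_cases hH : NeighborsAdjIn H G d
    · exact hH (hsub u hu) (hsub w hw) huw
    · have hboth : ∀ u, (nonMainGraph G H K L).Adj d u → G.Adj d u := by
        intro u hu
        rcases nonMainGraph_adj.1 hu with h | h | ⟨h1, -, h3⟩
        · exact h.1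
        · exact h.1
        · exact absurd (hHm hH u h1) h3
      exact hGK u w (hboth u hu) (hboth w hw) huw

/-- The common edges of `G` and `H` inside the union of the two cliques form a chordal graph,
provided the two cliques are joined in a chordal graph. -/
lemma IsMainJoin.exists_simplicial_inf (hsp : IsSplitPair G H K L) (hD : IsMainJoin G H K L D)
    (T : Finset (Fin n)) (hT : T.Nonempty) (hTKL : ∀ x ∈ T, x ∈ K ∨ x ∈ L) :
    ∃ s ∈ T, IsSimplicialIn (G ⊓ H) T s := by
  by_contra hcon
  -- half of the statements below are proved twice, with the roles of the graphs exchanged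
  have half : ∀ {G H : SimpleGraph (Fin n)} {K L : Set (Fin n)}, IsSplitPair G H K L →
      IsMainJoin G H K L D → (∀ x ∈ T, x ∈ K ∨ x ∈ L) → (¬ ∃ s ∈ T, IsSimplicialIn (G ⊓ H) T s) →
      (∀ c ∈ T, c ∉ K → ∃ b ∈ T, b ∉ L ∧ G.Adj c b ∧ H.Adj c b) ∧
      (∀ c ∈ T, c ∉ K → ∀ b ∈ T, b ∉ L → G.Adj c b → H.Adj c b →
        ∃ b' ∈ T, b' ≠ b ∧ b' ∉ L ∧ G.Adj c b' ∧ H.Adj c b') := by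
    intro G H K L hsp hD hTKL hcon
    have hKD : ∀ {x y}, x ∈ K → y ∈ K → x ≠ y → D.Adj x y := fun hx hy hxy =>
      hD.main_left (hsp.adj_left hx hy hxy) ⟨Or.inl hx, Or.inl hy⟩
    have hLD : ∀ {x y}, x ∈ L → y ∈ L → x ≠ y → D.Adj x y := fun hx hy hxy =>
      hD.main_right (hsp.adj_right hx hy hxy) ⟨Or.inl hx, Or.inl hy⟩
    have hns : ∀ s ∈ T, ∃ u ∈ T, ∃ w ∈ T, (G.Adj s u ∧ H.Adj s u) ∧ (G.Adj s w ∧ H.Adj s w) ∧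
        u ≠ w ∧ ¬ (G.Adj u w ∧ H.Adj u w) := by
      intro s hs
      by_contra hh
      push Not at hh
      refine hcon ⟨s, hs, fun u hu w hw h1 h2 h3 => ?_⟩
      exact ⟨(hh u hu w hw h1 h2 h3).1, (hh u hu w hw h1 h2 h3).2⟩
    refine ⟨?_, ?_⟩
    · intro c hc hcK
      obtain ⟨u, hu, w, hw, hcu, hcw, huw, hnot⟩ := hns c hc
      have huK := hsp.mem_left hcK hcu.1
      have hwK := hsp.mem_left hcK hcw.1
      by_cases huL : u ∈ L
      · by_cases hwL : w ∈ L
        · exact absurd ⟨hsp.adj_left huK hwK huw, hsp.adj_right huL hwL huw⟩ hnot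
        · exact ⟨w, hw, hwL, hcw⟩
      · exact ⟨u, hu, huL, hcu⟩
    · intro c hc hcK b hb hbL hcbG hcbH
      by_contra huniq
      push Not at huniq
      have hcL := (hTKL c hc).resolve_left hcK
      have hbK := (hTKL b hb).resolve_right hbL
      -- the neighbours of `c` other than `b` are common to both cliques
      have hnc : ∀ u ∈ T, G.Adj c u → H.Adj c u → u ≠ b → u ∈ K ∧ u ∈ L := by
        intro u hu h1 h2 hub
        refine ⟨hsp.mem_left hcK h1, ?_⟩
        by_contra huL
        exact huniq u hu hub huL h1 h2
      obtain ⟨a, haK, haL, hca, hba⟩ : ∃ a, a ∈ K ∧ a ∈ L ∧ (G.Adj c a ∧ H.Adj c a) ∧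
          ¬ H.Adj b a := by
        obtain ⟨u, hu, w, hw, hcu, hcw, huw, hnot⟩ := hns c hc
        by_cases hub : u = b
        · subst hub
          obtain ⟨h1, h2⟩ := hnc w hw hcw.1 hcw.2 huw.symm
          exact ⟨w, h1, h2, hcw, fun hh => hnot ⟨hsp.adj_left hbK h1 huw, hh⟩⟩
        · obtain ⟨h1, h2⟩ := hnc u hu hcu.1 hcu.2 hub
          by_cases hwb : w = b
          · subst hwb
            exact ⟨u, h1, h2, hcu, fun hh => hnot ⟨hsp.adj_left h1 hbK huw, hh.symm⟩⟩
          · obtain ⟨h3, h4⟩ := hnc w hw hcw.1 hcw.2 hwb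
            exact absurd ⟨hsp.adj_left h1 h3 huw, hsp.adj_right h2 h4 huw⟩ hnot
      have hDbc : D.Adj b c := (hD.of_both hcbG hcbH).symm
      have hab : b ≠ a := by rintro rfl; exact hbL haL
      have hac : c ≠ a := by rintro rfl; exact hcK haK
      -- `b` has no further neighbour in `L` outside `K`
      have hnb : ∀ u, G.Adj b u → H.Adj b u → u ∉ K → u = c := by
        intro u h1 h2 huK
        by_contra huc
        have huL := hsp.mem_right hbL h2
        have hau : a ≠ u := by rintro rfl; exact huK haK
        have hbu : D.Adj b u := hD.of_both h1 h2
        have hcl : D.IsClique {a, b, c, u} := by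
          have e1 := hKD haK hbK hab.symm
          have e2 := hLD haL hcL hac.symm
          have e3 := hLD haL huL hau
          have e4 := hLD huL hcL huc
          intro x hx y hy hxy
          rcases hx with rfl | rfl | rfl | rfl <;> rcases hy with rfl | rfl | rfl | rfl <;>
            first | exact absurd rfl hxy | assumption | (apply SimpleGraph.Adj.symm; assumption)
        rcases hD.isClique_or _ hcl with hh | hh
        · exact huK (hsp.mem_left hcK (hh (by simp) (by simp) (Ne.symm huc)))
        · exact hba (hh (by simp) (by simp) hab)
      obtain ⟨a', ha'K, ha'L, hba', hca'⟩ : ∃ a, a ∈ K ∧ a ∈ L ∧ (G.Adj b a ∧ H.Adj b a) ∧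
          ¬ G.Adj c a := by
        have hcase : ∀ u, G.Adj b u → H.Adj b u → u ≠ c → u ∈ K ∧ u ∈ L := by
          intro u h1 h2 huc
          refine ⟨?_, hsp.mem_right hbL h2⟩
          by_contra huK
          exact huc (hnb u h1 h2 huK)
        obtain ⟨u, hu, w, hw, hbu, hbw, huw, hnot⟩ := hns b hb
        by_cases huc : u = c
        · subst huc
          obtain ⟨h1, h2⟩ := hcase w hbw.1 hbw.2 huw.symm
          exact ⟨w, h1, h2, hbw, fun hh => hnot ⟨hh, hsp.adj_right hcL h2 huw⟩⟩
        · obtain ⟨h1, h2⟩ := hcase u hbu.1 hbu.2 huc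
          by_cases hwc : w = c
          · subst hwc
            exact ⟨u, h1, h2, hbu, fun hh => hnot ⟨hh.symm, hsp.adj_right h2 hcL huw⟩⟩
          · obtain ⟨h3, h4⟩ := hcase w hbw.1 hbw.2 hwc
            exact absurd ⟨hsp.adj_left h1 h3 huw, hsp.adj_right h2 h4 huw⟩ hnot
      have haa' : a ≠ a' := by rintro rfl; exact hba hba'.2
      have hcl : D.IsClique {a, a', b, c} := by
        have e1 := hKD haK hbK hab.symm
        have e2 := hLD haL hcL hac.symm
        have e3 := hKD haK ha'K haa'
        have e4 := hKD ha'K hbK hba'.1.ne'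
        have e5 : D.Adj a' c := hLD ha'L hcL (by rintro rfl; exact hcK ha'K)
        intro x hx y hy hxy
        rcases hx with rfl | rfl | rfl | rfl <;> rcases hy with rfl | rfl | rfl | rfl <;>
          first | exact absurd rfl hxy | assumption | (apply SimpleGraph.Adj.symm; assumption)
      rcases hD.isClique_or _ hcl with hh | hh
      · exact hca' (hh (by simp) (by simp) (by rintro rfl; exact hcK ha'K))
      · exact hba (hh (by simp) (by simp) hab)
  obtain ⟨h1, h3⟩ := half hsp hD hTKL hcon
  obtain ⟨h2, h4⟩ := half hsp.symm hD.symm (fun x hx => (hTKL x hx).symm) (by rwa [inf_comm])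
  have hex : ∃ b ∈ T, b ∉ L := by
    by_contra hno
    push Not at hno
    by_cases hK : ∃ c ∈ T, c ∉ K
    · obtain ⟨c, hc, hcK⟩ := hK
      obtain ⟨b, hb, hbL, -⟩ := h1 c hc hcK
      exact hbL (hno b hb)
    · push Not at hK
      obtain ⟨s, hs⟩ := hT
      exact hcon ⟨s, hs, fun u hu w hw _ _ huw =>
        ⟨hsp.adj_left (hK u hu) (hK w hw) huw, hsp.adj_right (hno u hu) (hno w hw) huw⟩⟩
  -- an alternating path `b' c b c' b''` leads to a chordless four-cycle or to a large clique
  obtain ⟨b, hb, hbL⟩ := hex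
  obtain ⟨c, hc, hcK, hbcH, hbcG⟩ := h2 b hb hbL
  obtain ⟨c', hc', hcc', hc'K, hbc'H, hbc'G⟩ := h4 b hb hbL c hc hcK hbcH hbcG
  obtain ⟨b', hb', hb'b, hb'L, hcb'G, hcb'H⟩ := h3 c hc hcK b hb hbL hbcG.symm hbcH.symm
  obtain ⟨b'', hb'', hb''b, hb''L, hcb''G, hcb''H⟩ := h3 c' hc' hc'K b hb hbL hbc'G.symm hbc'H.symm
  have hKof : ∀ x ∈ T, x ∉ L → x ∈ K := fun x hx hxL => (hTKL x hx).resolve_right hxL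
  have hLof : ∀ x ∈ T, x ∉ K → x ∈ L := fun x hx hxK => (hTKL x hx).resolve_left hxK
  have hKD : ∀ {x y}, x ∈ K → y ∈ K → x ≠ y → D.Adj x y := fun hx hy hxy =>
    hD.main_left (hsp.adj_left hx hy hxy) ⟨Or.inl hx, Or.inl hy⟩
  have hLD : ∀ {x y}, x ∈ L → y ∈ L → x ≠ y → D.Adj x y := fun hx hy hxy =>
    hD.main_right (hsp.adj_right hx hy hxy) ⟨Or.inl hx, Or.inl hy⟩
  have hsq : ∀ x ∈ T, ∀ y ∈ T, ∀ u ∈ T, ∀ w ∈ T, x ∉ L → y ∉ L → u ∉ K → w ∉ K → x ≠ y → u ≠ w →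
      D.Adj x u → D.Adj x w → D.Adj y u → D.Adj y w → False := by
    intro x hx y hy u hu w hw hxL hyL huK hwK hxy huw h1 h2 h3 h4
    have e1 := hKD (hKof x hx hxL) (hKof y hy hyL) hxy
    have e2 := hLD (hLof u hu huK) (hLof w hw hwK) huw
    have hcl : D.IsClique {x, y, u, w} := by
      intro p hp q hq hpq
      rcases hp with rfl | rfl | rfl | rfl <;> rcases hq with rfl | rfl | rfl | rfl <;>
        first | exact absurd rfl hpq | assumption | (apply SimpleGraph.Adj.symm; assumption)
    rcases hD.isClique_or _ hcl with hh | hh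
    · exact hwK (hsp.mem_left huK (hh (by simp) (by simp) huw))
    · exact hyL (hsp.mem_right hxL (hh (by simp) (by simp) hxy))
  have d1 := hD.of_both hbcG hbcH
  have d2 := hD.of_both hbc'G hbc'H
  have d3 := hD.of_both hcb'G hcb'H
  have d4 := hD.of_both hcb''G hcb''H
  have n1 : ¬ D.Adj b'' c := fun hh =>
    hsq b hb b'' hb'' c hc c' hc' hbL hb''L hcK hc'K hb''b.symm hcc'.symm d1 d2 hh d4.symm
  have n2 : ¬ D.Adj b' c' := fun hh =>
    hsq b hb b' hb' c hc c' hc' hbL hb'L hcK hc'K hb'b.symm hcc'.symm d1 d2 d3.symm hh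
  have hbb : b' ≠ b'' := by rintro rfl; exact n1 d3.symm
  rcases hD.chordal.four_cycle d3.symm (hLD (hLof c hc hcK) (hLof c' hc' hc'K) hcc'.symm) d4
    (hKD (hKof b'' hb'' hb''L) (hKof b' hb' hb'L) hbb.symm)
    (by rintro rfl; exact hc'K (hKof _ hb' hb'L)) (by rintro rfl; exact hcK (hKof _ hb'' hb''L))
    with hh | hh
  · exact n2 hh
  · exact n1 hh.symm

end Main

section Join

variable {n : ℕ} {G H D : SimpleGraph (Fin n)} {K L : Set (Fin n)}

/-! ### Cycles of satellites -/

/-- A nonempty set of vertices each of which is a satellite of another one contains a cycle. -/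
lemma exists_isSatelliteCycle {U : Finset (Fin n)} (hU : U.Nonempty)
    (h : ∀ w ∈ U, ∃ u ∈ U, IsSatellite G H K L w u ∨ IsSatellite H G L K w u) :
    ∃ W f, W.Nonempty ∧ IsSatelliteCycle G H K L W f := by
  classical
  choose! f hfU hf using h
  obtain ⟨W, hWU, hW⟩ := exists_minimal_le_of_wellFoundedLT
    (fun W : Finset (Fin n) => W.Nonempty ∧ W ⊆ U ∧ ∀ w ∈ W, f w ∈ W) U ⟨hU, le_rfl, hfU⟩
  have himg : W.image f = W := by
    have hsub : W.image f ⊆ W := by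
      intro x hx
      obtain ⟨y, hy, rfl⟩ := Finset.mem_image.1 hx
      exact hW.1.2.2 y hy
    refine Finset.Subset.antisymm hsub (hW.2 ⟨hW.1.1.image f, hsub.trans hWU, ?_⟩ hsub)
    exact fun w hw => Finset.mem_image_of_mem f (hsub hw)
  refine ⟨W, f, hW.1.1, hW.1.2.2, ?_, fun w hw => hf w (hWU hw)⟩
  have hinj := Finset.card_image_iff.1 (congrArg Finset.card himg)
  exact fun w hw w' hw' => hinj hw hw'

/-- A vertex is a satellite of at most one vertex, so it suffices that each vertex of a finite set
has a satellite in the set. -/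
lemma exists_isSatelliteCycle_of_pred {U : Finset (Fin n)} (hU : U.Nonempty)
    (hUKL : ∀ w ∈ U, w ∈ K ∨ w ∈ L)
    (h : ∀ w ∈ U, ∃ u ∈ U, IsSatellite G H K L u w ∨ IsSatellite H G L K u w) :
    ∃ W f, W.Nonempty ∧ IsSatelliteCycle G H K L W f := by
  classical
  choose! p hpU hp using h
  have hinj : Set.InjOn p U := by
    intro w hw w' hw' he
    have h1 := hp w hw
    have h2 := hp w' hw'
    rw [← he] at h2
    rcases h1 with h1 | h1 <;> rcases h2 with h2 | h2
    · exact h1.unique h2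
    · exact ((hUKL _ (hpU w hw)).elim h1.notMem h2.notMem).elim
    · exact ((hUKL _ (hpU w hw)).elim h2.notMem h1.notMem).elim
    · exact h1.unique h2
  have hsurj := Finset.surjOn_of_injOn_of_card_le p (s := U) (t := U) (fun w hw => hpU w hw) hinj
    le_rfl
  refine exists_isSatelliteCycle hU fun w hw => ?_
  obtain ⟨w', hw', rfl⟩ := hsurj hw
  exact ⟨w', hw', hp w' hw'⟩

/-! ### Exchanging the main edges -/

lemma nonMainGraph_adj_of_mem_right (hsp : IsSplitPair G H K L) {x y : Fin n} (hx : x ∈ L)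
    (hy : y ∈ L) (h : (nonMainGraph G H K L).Adj x y) : G.Adj x y ∧ H.Adj x y := by
  rw [nonMainGraph_comm] at h
  exact (nonMainGraph_adj_of_mem hsp.symm hx hy h).symm

lemma isClique_of_nonMainGraph (hsp : IsSplitPair G H K L)
    (hvertex : ∀ d, d ∉ K → d ∉ L → (∃ u, ¬ (G.Adj d u ↔ H.Adj d u)) →
      ¬ (NeighborsAdjIn G H d ∧ NeighborsAdjIn H G d)) (S : Set (Fin n))
    (hS : (nonMainGraph G H K L).IsClique S) : G.IsClique S ∨ H.IsClique S := by
  by_cases hd : ∃ d ∈ S, d ∉ K ∧ d ∉ L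
  · obtain ⟨d, hdS, hdK, hdL⟩ := hd
    rcases (nonMainGraph_neighbors hsp hdK hdL (hvertex d hdK hdL)).1 with h | h
    · refine Or.inl ((hsp.isClique_neighbors hdK).subset fun x hx => ?_)
      by_cases hxd : x = d
      · exact Or.inl hxd
      · exact Or.inr (h x (hS hdS hx (Ne.symm hxd)))
    · refine Or.inr ((hsp.symm.isClique_neighbors hdL).subset fun x hx => ?_)
      by_cases hxd : x = d
      · exact Or.inl hxd
      · exact Or.inr (h x (hS hdS hx (Ne.symm hxd)))
  · push Not at hd
    have hL : ∀ x ∈ S, ∀ y ∈ S, x ∉ K → y ∉ K → x = y := by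
      intro x hx y hy hxK hyK
      by_contra hxy
      have := nonMainGraph_adj_of_mem_right hsp (hd x hx hxK) (hd y hy hyK) (hS hx hy hxy)
      exact hyK (hsp.mem_left hxK this.1)
    have hK : ∀ x ∈ S, ∀ y ∈ S, x ∉ L → y ∉ L → x = y := by
      intro x hx y hy hxL hyL
      by_contra hxy
      have hxK : x ∈ K := by by_contra h; exact hxL (hd x hx h)
      have hyK : y ∈ K := by by_contra h; exact hyL (hd y hy h)
      have := nonMainGraph_adj_of_mem hsp hxK hyK (hS hx hy hxy)
      exact hyL (hsp.mem_right hxL this.2)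
    by_contra hcon
    rw [not_or] at hcon
    -- an edge missing in `G` and one missing in `H` would both join the only vertex outside `K` to
    -- the only vertex outside `L`
    have key : ∀ (F : SimpleGraph (Fin n)), ¬ F.IsClique S →
        (∀ x y, (nonMainGraph G H K L).Adj x y → ¬ F.Adj x y → (G.Adj x y ∧ H.Adj x y → False)) →
        ∃ x ∈ S, ∃ y ∈ S, x ∉ K ∧ y ∉ L ∧ x ≠ y ∧ ¬ F.Adj x y := by
      intro F hF hboth
      simp only [SimpleGraph.isClique_iff, Set.Pairwise] at hF
      push Not at hF
      obtain ⟨x, hx, y, hy, hxy, hno⟩ := hF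
      have hE := hS hx hy hxy
      have h1 := hboth x y hE hno
      by_cases hxK : x ∈ K
      · by_cases hyK : y ∈ K
        · exact (h1 (nonMainGraph_adj_of_mem hsp hxK hyK hE)).elim
        · by_cases hxL : x ∈ L
          · exact (h1 (nonMainGraph_adj_of_mem_right hsp hxL (hd y hy hyK) hE)).elim
          · exact ⟨y, hy, x, hx, hyK, hxL, hxy.symm, fun h => hno h.symm⟩
      · by_cases hyL : y ∈ L
        · exact (h1 (nonMainGraph_adj_of_mem_right hsp (hd x hx hxK) hyL hE)).elim
        · exact ⟨x, hx, y, hy, hxK, hyL, hxy, hno⟩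
    obtain ⟨x, hx, y, hy, hxK, hyL, hxy, hG⟩ := key G hcon.1 fun _ _ _ h h' => h h'.1
    obtain ⟨x', hx', y', hy', hxK', hyL', -, hH⟩ := key H hcon.2 fun _ _ _ h h' => h h'.2
    obtain rfl := hL x hx x' hx' hxK hxK'
    obtain rfl := hK y hy y' hy' hyL hyL'
    rcases nonMainGraph_adj.1 (hS hx hy hxy) with h | h | h
    · exact hG h.1
    · exact hG h.1
    · exact hH h.1

lemma IsMainJoin.isClique_or_nonMainGraph (h : IsMainJoin G H K L D)
    (S : Set (Fin n)) (hS : G.IsClique S) : D.IsClique S ∨ (nonMainGraph G H K L).IsClique S := by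
  by_cases hv : ∃ v ∈ S, v ∉ K ∧ NeighborsAdjIn G H v
  · obtain ⟨v, hvS, hvK, hv⟩ := hv
    have hvu : ∀ u ∈ S, v ≠ u → (nonMainGraph G H K L).Adj v u := by
      intro u hu hvu
      have hG := hS hvS hu hvu
      by_cases hH : H.Adj v u
      · exact nonMainGraph_adj.2 (Or.inl ⟨hG, hH⟩)
      · exact nonMainGraph_adj.2 (Or.inr (Or.inl ⟨hG, hH, fun hm =>
          hm.1.elim hvK fun hh => hh hv⟩))
    refine Or.inr fun x hx y hy hxy => ?_
    by_cases hvx : v = x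
    · subst hvx; exact hvu y hy hxy
    by_cases hvy : v = y
    · subst hvy; exact (hvu x hx hvx).symm
    exact nonMainGraph_adj.2 (Or.inl ⟨hS hx hy hxy, hv (hS hvS hx hvx) (hS hvS hy hvy) hxy⟩)
  · push Not at hv
    have hm : ∀ x ∈ S, x ∈ K ∨ ¬ NeighborsAdjIn G H x := fun x hx => by
      by_cases hxK : x ∈ K
      · exact Or.inl hxK
      · exact Or.inr (hv x hx hxK)
    exact Or.inl fun x hx y hy hxy => h.main_left (hS hx hy hxy) ⟨hm x hx, hm y hy⟩

/-- A set of vertices of which none is simplicial contains a cycle of satellites, found by passing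
from the end of an edge that is not main to a neighbour which prevents it from being simplicial. -/
lemma IsMainJoin.isChordalGraph_nonMainGraph (hsp : IsSplitPair G H K L)
    (h : IsMainJoin G H K L D)
    (hvertex : ∀ d, d ∉ K → d ∉ L → (∃ u, ¬ (G.Adj d u ↔ H.Adj d u)) →
      ¬ (NeighborsAdjIn G H d ∧ NeighborsAdjIn H G d))
    (hcycle : ¬ ∃ W f, W.Nonempty ∧ IsSatelliteCycle G H K L W f) :
    IsChordalGraph (nonMainGraph G H K L) := by
  classical
  refine isChordalGraph_of_exists_simplicial fun T hT => ?_
  by_cases hd : ∃ d ∈ T, d ∉ K ∧ d ∉ L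
  · obtain ⟨d, hdT, hdK, hdL⟩ := hd
    exact ⟨d, hdT, fun u _ w _ => (nonMainGraph_neighbors hsp hdK hdL (hvertex d hdK hdL)).2 u w⟩
  have hTKL : ∀ x ∈ T, x ∈ K ∨ x ∈ L := by
    intro x hx
    by_contra hno
    rw [not_or] at hno
    exact hd ⟨x, hx, hno⟩
  by_contra hcon
  -- the ends outside `K` or `L` of the edges of one graph that are not main
  let P : SimpleGraph (Fin n) → SimpleGraph (Fin n) → Set (Fin n) → Fin n → Prop :=
    fun G H K w => w ∉ K ∧ NeighborsAdjIn G H w ∧ ∃ b ∈ T, G.Adj w b ∧ ¬ H.Adj w b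
  have hsat : ∀ {G H : SimpleGraph (Fin n)} {K L : Set (Fin n)}, IsSplitPair G H K L →
      ∀ {w b}, w ∉ K → w ∈ L → NeighborsAdjIn G H w → G.Adj w b → ¬ H.Adj w b →
      IsSatellite G H K L w b := by
    intro G H K L hsp w b hwK hwL hnb hG hH
    have hbL : b ∉ L := fun hbL => hH (hsp.adj_right hwL hbL hG.ne)
    refine ⟨hwK, hsp.mem_left hwK hG, hbL, hG, hH, fun a ha hab => ?_⟩
    have hba : H.Adj b a := hnb hG ha hab.symm
    have haL := hsp.mem_right hbL hba
    exact ⟨haL, hba, hsp.adj_right hwL haL ha.ne⟩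
  have hpred : ∀ {G H : SimpleGraph (Fin n)} {K L : Set (Fin n)}, IsSplitPair G H K L →
      (∀ x ∈ T, x ∈ K ∨ x ∈ L) → (¬ ∃ s ∈ T, IsSimplicialIn (nonMainGraph G H K L) T s) →
      ∀ w ∈ T, P G H K w → ∃ u ∈ T, P H G L u ∧ IsSatellite H G L K u w := by
    intro G H K L hsp hTKL hcon w hw ⟨hwK, hnb, _⟩
    have hwL := (hTKL w hw).resolve_left hwK
    obtain ⟨u, hu, hwu, hno⟩ : ∃ u ∈ T, (nonMainGraph G H K L).Adj w u ∧ ¬ G.Adj w u := by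
      by_contra hall
      push Not at hall
      refine hcon ⟨w, hw, fun u hu x hx hwu hwx hux => ?_⟩
      have h1 := hall u hu hwu
      have h2 := hall x hx hwx
      exact nonMainGraph_adj.2 (Or.inl
        ⟨hsp.adj_left (hsp.mem_left hwK h1) (hsp.mem_left hwK h2) hux, hnb h1 h2 hux⟩)
    rcases nonMainGraph_adj.1 hwu with hh | hh | ⟨hH, -, hm⟩
    · exact absurd hh.1 hno
    · exact absurd hh.1 hno
    have hu' : ¬ (u ∈ L ∨ ¬ NeighborsAdjIn H G u) := fun hh => hm ⟨Or.inl hwL, hh⟩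
    push Not at hu'
    have huK := (hTKL u hu).resolve_right hu'.1
    exact ⟨u, hu, ⟨hu'.1, hu'.2, w, hw, hH.symm, fun hh => hno hh.symm⟩,
      hsat hsp.symm hu'.1 huK hu'.2 hH.symm fun hh => hno hh.symm⟩
  let U : Finset (Fin n) := T.filter fun w => P G H K w ∨ P H G L w
  by_cases hU : U.Nonempty
  · refine hcycle (exists_isSatelliteCycle_of_pred hU
      (fun w hw => hTKL w (Finset.mem_filter.1 hw).1)
      fun w hw => ?_)
    obtain ⟨hwT, hw | hw⟩ := Finset.mem_filter.1 hw
    · obtain ⟨u, hu, hP, hs⟩ := hpred hsp hTKL hcon w hwT hw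
      exact ⟨u, Finset.mem_filter.2 ⟨hu, Or.inr hP⟩, Or.inr hs⟩
    · rw [nonMainGraph_comm] at hcon
      obtain ⟨u, hu, hP, hs⟩ := hpred hsp.symm (fun x hx => (hTKL x hx).symm) hcon w hwT hw
      exact ⟨u, Finset.mem_filter.2 ⟨hu, Or.inl hP⟩, Or.inl hs⟩
  · rw [Finset.not_nonempty_iff_eq_empty] at hU
    have hnP : ∀ w ∈ T, ¬ P G H K w ∧ ¬ P H G L w := by
      intro w hw
      rw [← not_or]
      intro hh
      have : w ∈ U := Finset.mem_filter.2 ⟨hw, hh⟩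
      simp [hU] at this
    have hend : ∀ {G H : SimpleGraph (Fin n)} {K : Set (Fin n)}, (∀ w ∈ T, ¬ P G H K w) →
        ∀ x ∈ T, ∀ y ∈ T, G.Adj x y → ¬ H.Adj x y → x ∈ K ∨ ¬ NeighborsAdjIn G H x := by
      intro G H K hP x hx y hy hG hH
      by_contra hh
      push Not at hh
      exact hP x hx ⟨hh.1, hh.2, y, hy, hG, hH⟩
    have hboth : ∀ x ∈ T, ∀ y ∈ T, (nonMainGraph G H K L).Adj x y → G.Adj x y ∧ H.Adj x y := by
      intro x hx y hy hxy
      rcases nonMainGraph_adj.1 hxy with hh | ⟨h1, h2, h3⟩ | ⟨h1, h2, h3⟩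
      · exact hh
      · exact absurd ⟨hend (fun w hw => (hnP w hw).1) x hx y hy h1 h2,
          hend (fun w hw => (hnP w hw).1) y hy x hx h1.symm fun hh => h2 hh.symm⟩ h3
      · exact absurd ⟨hend (fun w hw => (hnP w hw).2) x hx y hy h1 h2,
          hend (fun w hw => (hnP w hw).2) y hy x hx h1.symm fun hh => h2 hh.symm⟩ h3
    obtain ⟨s, hs, hsimp⟩ := h.exists_simplicial_inf hsp T hT hTKL
    refine hcon ⟨s, hs, fun u hu w hw h1 h2 huw => ?_⟩
    exact nonMainGraph_adj.2 (Or.inl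
      (hsimp u hu w hw (hboth s hs u hu h1) (hboth s hs w hw h2) huw))

/-- If the main parts of both graphs can be joined in a chordal graph, then the main edges can be
exchanged against the others. The assumptions on pairs `xy` exclude that this exchanges all edges or
none, and the last two assumptions make the graph of the other edges chordal. -/
theorem IsMainJoin.fulfillsRhombus (hsp : IsSplitPair G H K L) (h : IsMainJoin G H K L D)
    (hG : ∃ x y, (H.Adj x y ∧ ¬ G.Adj x y ∧ IsMain H G L x y) ∨
      (G.Adj x y ∧ ¬ H.Adj x y ∧ ¬ IsMain G H K x y))
    (hH : ∃ x y, (G.Adj x y ∧ ¬ H.Adj x y ∧ IsMain G H K x y) ∨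
      (H.Adj x y ∧ ¬ G.Adj x y ∧ ¬ IsMain H G L x y))
    (hvertex : ∀ d, d ∉ K → d ∉ L → (∃ u, ¬ (G.Adj d u ↔ H.Adj d u)) →
      ¬ (NeighborsAdjIn G H d ∧ NeighborsAdjIn H G d))
    (hcycle : ¬ ∃ W f, W.Nonempty ∧ IsSatelliteCycle G H K L W f) :
    FulfillsRhombus (chordalGraphPolytope n) (charImset G) (charImset H) := by
  obtain ⟨D, -, hmin⟩ := exists_minimal_le_of_wellFoundedLT (IsMainJoin G H K L) D h
  have hmin' : Minimal (IsMainJoin H G L K) D := ⟨hmin.1.symm, fun F hF hle => hmin.2 hF.symm hle⟩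
  have hD : ∀ x y, D.Adj x y ↔ (G.Adj x y ∧ H.Adj x y) ∨ (G.Adj x y ∧ ¬ H.Adj x y ∧
      IsMain G H K x y) ∨ (H.Adj x y ∧ ¬ G.Adj x y ∧ IsMain H G L x y) := by
    intro x y
    constructor
    · intro hxy
      by_cases h1 : G.Adj x y <;> by_cases h2 : H.Adj x y
      · exact Or.inl ⟨h1, h2⟩
      · exact Or.inr (Or.inl ⟨h1, h2, IsMainJoin.isMain_of_minimal hsp hmin hxy h1 h2⟩)
      · exact Or.inr (Or.inr ⟨h2, h1, IsMainJoin.isMain_of_minimal hsp.symm hmin' hxy h2 h1⟩)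
      · exact absurd (hmin.1.adj_or hxy) (by tauto)
    · rintro (hh | hh | hh)
      · exact hmin.1.of_both hh.1 hh.2
      · exact hmin.1.main_left hh.1 hh.2.2
      · exact hmin.1.main_right hh.1 hh.2.2
  have hex : IsExchange G H D (nonMainGraph G H K L) := by
    refine ⟨fun x y => ?_, hmin.1.isClique_or,
      isClique_of_nonMainGraph hsp hvertex, hmin.1.isClique_or_nonMainGraph, ?_⟩
    · rw [hD, nonMainGraph_adj]; tauto
    · intro S hS
      rw [nonMainGraph_comm]
      exact hmin.1.symm.isClique_or_nonMainGraph S hS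
  refine hex.fulfillsRhombus hmin.1.chordal
    (hmin.1.isChordalGraph_nonMainGraph hsp hvertex hcycle) ?_ ?_
  · rintro rfl
    obtain ⟨x, y, hxy⟩ := hG
    have := hD x y
    tauto
  · rintro rfl
    obtain ⟨x, y, hxy⟩ := hH
    have := hD x y
    tauto

end Join

section Split

variable {n : ℕ} {G H D : SimpleGraph (Fin n)} {K L : Set (Fin n)}

/-! ### The smallest face of two split graphs -/

lemma IsOnFace.isMainJoin (hsp : IsSplitPair G H K L) (hD : IsOnFace G H D) (hK : D.IsClique K)
    (hL : D.IsClique L) : IsMainJoin G H K L D where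
  chordal := hD.1
  of_both _ _ := hD.adj_of_adj
  adj_or _ _ := hD.adj_or
  isClique_or _ := hD.isClique_or
  main_left _ _ := hD.adj_of_isMain hsp (fun _ hx _ hy => hK hx hy)
  main_right _ _ := hD.symm.adj_of_isMain hsp.symm (fun _ hx _ hy => hL hx hy)

/-- A graph on the smallest face without the clique `K` lacks an edge of `G` in `K` that is not an
edge of `H`. -/
lemma IsOnFace.exists_not_adj (hsp : IsSplitPair G H K L) (hD : IsOnFace G H D)
    (hK : ¬ D.IsClique K) :
    ∃ p ∈ K, ∃ q ∈ K, p ≠ q ∧ ¬ D.Adj p q ∧ ¬ H.Adj p q ∧ G.Adj p q := by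
  simp only [SimpleGraph.isClique_iff, Set.Pairwise] at hK
  push Not at hK
  obtain ⟨p, hp, q, hq, hpq, hno⟩ := hK
  have hG := hsp.adj_left hp hq hpq
  exact ⟨p, hp, q, hq, hpq, hno, fun hH => hno (hD.adj_of_adj hG hH), hG⟩

lemma not_isMain {v y : Fin n} (hv : v ∉ K) (hn : NeighborsAdjIn G H v) : ¬ IsMain G H K v y :=
  fun hm => hm.1.elim hv fun hh => hh hn

/-- A graph on the smallest face that contains `K`, but not `L`, as a clique is equal to `G`, if
graphs on the face that contain one of the cliques have no edge of only the other graph that is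
not main. -/
lemma IsOnFace.eq_left (hsp : IsSplitPair G H K L) (hD : IsOnFace G H D) (hK : D.IsClique K)
    (hL : ¬ D.IsClique L)
    (h1 : ∀ x y, D.Adj x y → H.Adj x y → ¬ G.Adj x y → IsMain H G L x y)
    (h2 : ∀ E, IsOnFace G H E → E.IsClique L → ∀ x y, E.Adj x y → G.Adj x y → ¬ H.Adj x y →
      IsMain G H K x y) : D = G := by
  obtain ⟨a, ha, b, hb, hab, habD, habG, habH⟩ := hD.symm.exists_not_adj hsp.symm hL
  ext x y
  constructor
  · intro hxy
    by_contra hG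
    have hH := (hD.adj_or hxy).resolve_left hG
    exact hD.symm.not_adj_of_isMain hsp.symm ha hb hab habD hH hG (h1 x y hxy hH hG) hxy
  · intro hxy
    by_contra hno
    have hH : ¬ H.Adj x y := fun hH => hno (hD.adj_of_adj hxy hH)
    obtain ⟨E, hE, hExy, hEab⟩ := exists_isOnFace_adj_adj hxy hH habH habG hD hno habD
    have hEL : E.IsClique L :=
      hE.symm.isClique_of_adj (fun u hu w hw => hsp.adj_right hu hw) ha hb hEab habG
    exact hno (hD.adj_of_isMain hsp (fun _ hx _ hy => hK hx hy) hxy (h2 E hE hEL x y hExy hxy hH))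

/-- The variant of `IsOnFace.eq_left` for the case that `L` is a clique of `G` as well. -/
lemma IsOnFace.eq_left_of_isClique (hsp : IsSplitPair G H K L) (hD : IsOnFace G H D)
    (hK : D.IsClique K) (hL : G.IsClique L)
    (h1 : ∀ x y, D.Adj x y → H.Adj x y → ¬ G.Adj x y → IsMain H G L x y)
    (h2 : ∀ x y, G.Adj x y → ¬ H.Adj x y → IsMain G H K x y) : D = G := by
  ext x y
  constructor
  · intro hxy
    by_contra hG
    have hH := (hD.adj_or hxy).resolve_left hG
    have hmem : ∀ v, v ∈ L ∨ ¬ NeighborsAdjIn H G v → v ∈ L := fun v hv => by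
      by_contra hvL
      exact hv.resolve_left hvL fun u w hu hw huw =>
        hL (hsp.mem_right hvL hu) (hsp.mem_right hvL hw) huw
    have hm := h1 x y hxy hH hG
    exact hG (hL (hmem x hm.1) (hmem y hm.2) hH.ne)
  · intro hxy
    by_cases hH : H.Adj x y
    · exact hD.adj_of_adj hxy hH
    · exact hD.adj_of_isMain hsp (fun _ hx _ hy => hK hx hy) hxy (h2 x y hxy hH)

/-- The ends outside `K` of edges of `G` outside `H` that are not main and occur in a graph on the
smallest face together with the clique `L`. -/
def IsFaceSatellite (G H : SimpleGraph (Fin n)) (K L : Set (Fin n)) (v : Fin n) : Prop :=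
  v ∉ K ∧ NeighborsAdjIn G H v ∧ ∃ y, G.Adj v y ∧ ¬ H.Adj v y ∧
    ∃ D, IsOnFace G H D ∧ D.IsClique L ∧ D.Adj v y

/-- If no exchange of a vertex, of an edge or of the main edges is possible, such a vertex is a
satellite of another one, with the roles of `G` and `H` reversed. -/
lemma IsFaceSatellite.exists_isSatellite (hsp : IsSplitPair G H K L)
    (hvertex : ∀ d, d ∉ K → d ∉ L → (∃ u, ¬ (G.Adj d u ↔ H.Adj d u)) →
      ¬ (NeighborsAdjIn G H d ∧ NeighborsAdjIn H G d))
    (hedge : ∀ v b, IsSatellite G H K L v b → ∃ x, H.Adj b x ∧ ¬ G.Adj v x)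
    (hjoin : ∀ D, IsMainJoin G H K L D →
      (∃ x y, (H.Adj x y ∧ ¬ G.Adj x y ∧ IsMain H G L x y) ∨
        (G.Adj x y ∧ ¬ H.Adj x y ∧ ¬ IsMain G H K x y)) →
      ¬ ∃ x y, (G.Adj x y ∧ ¬ H.Adj x y ∧ IsMain G H K x y) ∨
        (H.Adj x y ∧ ¬ G.Adj x y ∧ ¬ IsMain H G L x y))
    {v : Fin n} (hv : IsFaceSatellite G H K L v) :
    ∃ u, IsFaceSatellite H G L K u ∧ IsSatellite G H K L v u := by
  obtain ⟨hvK, hn, y, hG, hH, D, hD, hL, hDvy⟩ := hv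
  obtain ⟨hs, x, hx, hDyx, hny⟩ := hD.exists_isSatellite hsp (fun _ hx _ hy => hL hx hy) hvK hn hG
    hH hDvy (fun hvL hn' => hvertex v hvK hvL ⟨y, fun hh => hH (hh.1 hG)⟩ ⟨hn, hn'⟩) (hedge v y)
  refine ⟨y, ⟨hx.notMem, hny, x, hx.adj, hx.not_adj, ?_⟩, hs⟩
  have hKG : G.IsClique K := fun u hu w hw => hsp.adj_left hu hw
  by_cases hK : D.IsClique K
  · have hGm : ¬ IsMain G H K v y := not_isMain hvK hn
    have hno := hjoin D (hD.isMainJoin hsp hK hL) ⟨v, y, Or.inr ⟨hG, hH, hGm⟩⟩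
    refine (hno ⟨y, x, Or.inr ⟨hx.adj, hx.not_adj, not_isMain hx.notMem hny⟩⟩).elim
  · obtain ⟨p, hp, q, hq, hpq, hpqD, hpqH, hpqG⟩ := hD.exists_not_adj hsp hK
    obtain ⟨E, hE, hEpq, hEyx⟩ :=
      exists_isOnFace_adj_adj hpqG hpqH hx.adj hx.not_adj hD hpqD hDyx
    exact ⟨E, hE.symm, hE.isClique_of_adj hKG hp hq hEpq hpqH, hEyx⟩

/-- If none of the exchanges is possible, the smallest face contains only `G` and `H`. -/
theorem IsSplitPair.fulfillsRhombus (hsp : IsSplitPair G H K L) (hne : G ≠ H) :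
    FulfillsRhombus (chordalGraphPolytope n) (charImset G) (charImset H) := by
  classical
  by_contra hcon
  have hface : ¬ ∀ D, IsOnFace G H D → D = G ∨ D = H := fun h =>
    hcon (Or.inl
      (isPolytopeEdge_of_isOnFace hne hsp.isChordalGraph_left hsp.isChordalGraph_right h))
  have hvertex : ∀ d, d ∉ K → d ∉ L → (∃ u, ¬ (G.Adj d u ↔ H.Adj d u)) →
      ¬ (NeighborsAdjIn G H d ∧ NeighborsAdjIn H G d) := by
    rintro d hdK hdL hd ⟨h1, h2⟩
    by_cases hex : ∃ x y, x ≠ d ∧ y ≠ d ∧ ¬ (G.Adj x y ↔ H.Adj x y)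
    · exact hcon (hsp.fulfillsRhombus_of_vertex hdK hdL h1 h2 hd hex)
    · push Not at hex
      exact hcon (hsp.fulfillsRhombus_of_eq_off hne hdK hdL fun x y hx hy => by
        have := hex x y hx hy; tauto)
  -- graphs that differ in one edge span an edge of the polytope
  have hother : ∀ v b, ¬ (G.Adj v b ↔ H.Adj v b) →
      ∃ x y, s(x, y) ≠ s(v, b) ∧ ¬ (G.Adj x y ↔ H.Adj x y) := by
    intro v b hvb
    by_contra hno
    push Not at hno
    have heq : ∀ x y, s(x, y) ≠ s(v, b) → (G.Adj x y ↔ H.Adj x y) := fun x y h => by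
      have := hno x y h; tauto
    refine hface fun D hD => ?_
    have hext : ∀ F : SimpleGraph (Fin n), (∀ x y, s(x, y) ≠ s(v, b) → (F.Adj x y ↔ G.Adj x y)) →
        (D.Adj v b ↔ F.Adj v b) → D = F := by
      intro F hF hvb
      ext x y
      by_cases he : s(x, y) = s(v, b)
      · rw [← SimpleGraph.mem_edgeSet, he, SimpleGraph.mem_edgeSet, hvb,
          ← SimpleGraph.mem_edgeSet, ← he, SimpleGraph.mem_edgeSet]
      · rw [hF x y he]
        refine ⟨fun hxy => ?_, fun hxy => hD.adj_of_adj hxy ((heq x y he).1 hxy)⟩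
        rcases hD.adj_or hxy with hh | hh
        · exact hh
        · exact (heq x y he).2 hh
    by_cases hDG : D.Adj v b ↔ G.Adj v b
    · exact Or.inl (hext G (fun _ _ _ => Iff.rfl) hDG)
    · exact Or.inr (hext H (fun x y he => (heq x y he).symm) (by tauto))
  have hedge : ∀ v b, IsSatellite G H K L v b → ∃ x, H.Adj b x ∧ ¬ G.Adj v x := by
    intro v b hs
    by_contra hno
    push Not at hno
    exact hcon (hs.fulfillsRhombus hsp hno (hother v b fun hh => hs.not_adj (hh.1 hs.adj)))
  have hsymm : FulfillsRhombus (chordalGraphPolytope n) (charImset H) (charImset G) →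
      FulfillsRhombus (chordalGraphPolytope n) (charImset G) (charImset H) := by
    rintro (⟨h1, h2⟩ | ⟨x, y, hx, hy, hxy⟩)
    · exact Or.inl ⟨h1.symm, by rwa [Set.pair_comm]⟩
    · rw [Set.pair_comm] at hx hy
      exact Or.inr ⟨x, y, hx, hy, by rw [add_comm, hxy]⟩
  have hedge' : ∀ v b, IsSatellite H G L K v b → ∃ x, G.Adj b x ∧ ¬ H.Adj v x := by
    intro v b hs
    by_contra hno
    push Not at hno
    obtain ⟨x, y, h1, h2⟩ := hother v b fun hh => hs.not_adj (hh.2 hs.adj)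
    exact hcon (hsymm (hs.fulfillsRhombus hsp.symm hno ⟨x, y, h1, fun hh => h2 hh.symm⟩))
  have hcycle : ¬ ∃ W f, W.Nonempty ∧ IsSatelliteCycle G H K L W f := fun ⟨W, f, hW, h⟩ =>
    hcon (h.fulfillsRhombus hsp hW)
  have hjoin : ∀ D, IsMainJoin G H K L D →
      (∃ x y, (H.Adj x y ∧ ¬ G.Adj x y ∧ IsMain H G L x y) ∨
        (G.Adj x y ∧ ¬ H.Adj x y ∧ ¬ IsMain G H K x y)) →
      ¬ ∃ x y, (G.Adj x y ∧ ¬ H.Adj x y ∧ IsMain G H K x y) ∨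
        (H.Adj x y ∧ ¬ G.Adj x y ∧ ¬ IsMain H G L x y) :=
    fun D hD h1 h2 => hcon (hD.fulfillsRhombus hsp h1 h2 hvertex hcycle)
  have hjoin' : ∀ D, IsMainJoin H G L K D →
      (∃ x y, (G.Adj x y ∧ ¬ H.Adj x y ∧ IsMain G H K x y) ∨
        (H.Adj x y ∧ ¬ G.Adj x y ∧ ¬ IsMain H G L x y)) →
      ¬ ∃ x y, (H.Adj x y ∧ ¬ G.Adj x y ∧ IsMain H G L x y) ∨
        (G.Adj x y ∧ ¬ H.Adj x y ∧ ¬ IsMain G H K x y) :=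
    fun D hD h1 h2 => hjoin D hD.symm h2 h1
  -- following satellites from a vertex as in `IsFaceSatellite` would lead to a cycle
  have hU : ∀ v, ¬ IsFaceSatellite G H K L v ∧ ¬ IsFaceSatellite H G L K v := by
    intro v
    rw [← not_or]
    intro hv
    refine hcycle (exists_isSatelliteCycle (U := Finset.univ.filter fun v =>
      IsFaceSatellite G H K L v ∨ IsFaceSatellite H G L K v) ⟨v, by simpa using hv⟩ fun w hw => ?_)
    rcases (Finset.mem_filter.1 hw).2 with hw | hw
    · obtain ⟨u, hu, hs⟩ := hw.exists_isSatellite hsp hvertex hedge hjoin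
      exact ⟨u, by simp [hu], Or.inl hs⟩
    · obtain ⟨u, hu, hs⟩ := hw.exists_isSatellite hsp.symm (fun d h1 h2 ⟨u, h3⟩ h4 =>
        hvertex d h2 h1 ⟨u, fun hh => h3 hh.symm⟩ h4.symm) hedge' hjoin'
      exact ⟨u, by simp [hu], Or.inr hs⟩
  have hmain : ∀ {G H : SimpleGraph (Fin n)} {K L : Set (Fin n)},
      (∀ v, ¬ IsFaceSatellite G H K L v) → ∀ E, IsOnFace G H E → E.IsClique L → ∀ x y, E.Adj x y →
      G.Adj x y → ¬ H.Adj x y → IsMain G H K x y := by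
    intro G H K L hU E hE hL x y hxy hG hH
    have key : ∀ x y, E.Adj x y → G.Adj x y → ¬ H.Adj x y → x ∈ K ∨ ¬ NeighborsAdjIn G H x := by
      intro x y hxy hG hH
      by_contra hno
      push Not at hno
      exact hU x ⟨hno.1, hno.2, y, hG, hH, E, hE, hL, hxy⟩
    exact ⟨key x y hxy hG hH, key y x hxy.symm hG.symm fun h => hH h.symm⟩
  have hmainG := hmain fun v => (hU v).1
  have hmainH := hmain fun v => (hU v).2
  have hboth : ∀ D, IsOnFace G H D → D.IsClique K → D.IsClique L →
      G.IsClique L ∨ H.IsClique K := by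
    intro D hD hK hL
    by_contra hno
    rw [not_or] at hno
    obtain ⟨p, hp, q, hq, hpq, -, hpqH, hpqG⟩ :=
      (isOnFace_right (G := G) hsp.isChordalGraph_right).exists_not_adj hsp hno.2
    obtain ⟨r, hr, s, hs, hrs, -, hrsG, hrsH⟩ :=
      (isOnFace_left (H := H) hsp.isChordalGraph_left).symm.exists_not_adj hsp.symm hno.1
    exact hjoin D (hD.isMainJoin hsp hK hL) ⟨r, s, Or.inl ⟨hrsH, hrsG, Or.inl hr, Or.inl hs⟩⟩
      ⟨p, q, Or.inl ⟨hpqG, hpqH, Or.inl hp, Or.inl hq⟩⟩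
  refine hface fun D hD => ?_
  by_cases hK : D.IsClique K <;> by_cases hL : D.IsClique L
  · rcases hboth D hD hK hL with hLG | hKH
    · exact Or.inl (hD.eq_left_of_isClique hsp hK hLG (hmainH D hD.symm hK)
        fun x y hG => hmainG G (isOnFace_left hsp.isChordalGraph_left) hLG x y hG hG)
    · exact Or.inr (hD.symm.eq_left_of_isClique hsp.symm hL hKH (hmainG D hD hL)
        fun x y hH => hmainH H (isOnFace_left hsp.isChordalGraph_right) hKH x y hH hH)
  · exact Or.inl (hD.eq_left hsp hK hL (hmainH D hD.symm hK) hmainG)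
  · exact Or.inr (hD.symm.eq_left hsp.symm hL hK (hmainG D hD hL) hmainH)
  · obtain ⟨p, hp, q, hq, hpq, hpqD, hpqH, hpqG⟩ := hD.exists_not_adj hsp hK
    obtain ⟨r, hr, s, hs, hrs, hrsD, hrsG, hrsH⟩ := hD.symm.exists_not_adj hsp.symm hL
    obtain ⟨E, hE, hEpq, hErs⟩ := exists_isOnFace_adj_adj hpqG hpqH hrsH hrsG hD hpqD hrsD
    have hEK : E.IsClique K :=
      hE.isClique_of_adj (fun u hu w hw => hsp.adj_left hu hw) hp hq hEpq hpqH
    have hEL : E.IsClique L :=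
      hE.symm.isClique_of_adj (fun u hu w hw => hsp.adj_right hu hw) hr hs hErs hrsG
    rcases hboth E hE hEK hEL with h | h
    · exact absurd (h hr hs hrs) hrsG
    · exact absurd (h hp hq hpq) hpqH

theorem fulfillsRhombus_of_isSplitGraph (hne : G ≠ H) (hG : IsSplitGraph G) (hH : IsSplitGraph H) :
    FulfillsRhombus (chordalGraphPolytope n) (charImset G) (charImset H) := by
  obtain ⟨K, hK, hK'⟩ := hG
  obtain ⟨L, hL, hL'⟩ := hH
  refine IsSplitPair.fulfillsRhombus (K := K) (L := L) ⟨fun x y hx hy => hK hx hy, ?_,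
    fun x y hx hy => hL hx hy, ?_⟩ hne
  · intro x y hx hxy
    by_contra hy
    exact hK' hx hy hxy.ne hxy
  · intro x y hx hxy
    by_contra hy
    exact hL' hx hy hxy.ne hxy

end Split

section Codes

variable {n : ℕ} {G : SimpleGraph (Fin n)} {K : Finset (Fin n)}

/-! ### Coding chordal graphs -/

/-- The vertices of `T` outside a clique `K` can be ordered so that the earlier neighbours of each
one form a clique; the vertices of `K` come first. -/
lemma IsChordalGraph.exists_elimination_order_on (hG : IsChordalGraph G)
    (hK : G.IsClique (K : Set (Fin n))) (T : Finset (Fin n)) (hKT : K ⊆ T) :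
    ∃ f : Fin n → ℕ, (∀ v ∈ K, f v = 0) ∧ (∀ v ∈ T, v ∉ K → 0 < f v) ∧
      (∀ v ∈ T, v ∉ K → IsSimplicialIn G {u | u ∈ T ∧ f u < f v} v) ∧
      (∀ v ∈ T, ∀ w ∈ T, v ∉ K → w ∉ K → f v = f w → v = w) := by
  induction T using Finset.strongInduction with
  | _ T ih =>
  by_cases hT : ∃ v ∈ T, v ∉ K
  · obtain ⟨s, hs, hsK, hsimp⟩ :=
      hG.exists_simplicial T K (fun u _ w _ hu hw huw => hK hu hw huw) hT
    have hKT' : K ⊆ T.erase s := fun v hv =>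
      Finset.mem_erase.2 ⟨by rintro rfl; exact hsK hv, hKT hv⟩
    obtain ⟨f, h0, hpos, hcl, hinj⟩ := ih _ (Finset.erase_ssubset hs) hKT'
    let M := T.sup f + 1
    have hM : ∀ v ∈ T, f v < M := fun v hv => Nat.lt_succ_of_le (Finset.le_sup hv)
    have hne : ∀ v, v ≠ s → Function.update f s M v = f v := fun v hv =>
      Function.update_of_ne hv _ _
    have heq : Function.update f s M s = M := Function.update_self ..
    refine ⟨Function.update f s M, fun v hv => ?_, fun v hv hvK => ?_, fun v hv hvK => ?_, ?_⟩
    · rw [hne v (by rintro rfl; exact hsK hv)]; exact h0 v hv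
    · by_cases hvs : v = s
      · rw [hvs, heq]; exact Nat.succ_pos _
      · rw [hne v hvs]; exact hpos v (Finset.mem_erase.2 ⟨hvs, hv⟩) hvK
    · by_cases hvs : v = s
      · subst hvs
        exact fun u hu w hw => hsimp u hu.1 w hw.1
      · have hlt : ∀ u ∈ T, Function.update f s M u < Function.update f s M v →
            u ∈ T.erase s ∧ f u < f v := by
          intro u hu hlt
          have hus : u ≠ s := by
            rintro rfl
            rw [heq, hne v hvs] at hlt
            exact absurd (hM v hv) (by omega)
          rw [hne u hus, hne v hvs] at hlt
          exact ⟨Finset.mem_erase.2 ⟨hus, hu⟩, hlt⟩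
        exact fun u hu w hw => hcl v (Finset.mem_erase.2 ⟨hvs, hv⟩) hvK u (hlt u hu.1 hu.2) w
          (hlt w hw.1 hw.2)
    · intro v hv w hw hvK hwK hvw
      by_cases hvs : v = s <;> by_cases hws : w = s
      · rw [hvs, hws]
      · rw [hvs, heq, hne w hws] at hvw
        exact absurd (hM w hw) (by omega)
      · rw [hws, heq, hne v hvs] at hvw
        exact absurd (hM v hv) (by omega)
      · rw [hne v hvs, hne w hws] at hvw
        exact hinj v (Finset.mem_erase.2 ⟨hvs, hv⟩) w (Finset.mem_erase.2 ⟨hws, hw⟩) hvK hwK hvw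
  · push Not at hT
    exact ⟨fun _ => 0, fun _ _ => rfl, fun v hv hvK => absurd (hT v hv) hvK,
      fun v hv hvK => absurd (hT v hv) hvK, fun v hv _ _ hvK => absurd (hT v hv) hvK⟩

/-- A construction of a graph from a clique `K`, by adding one vertex after the other. The vertex
`v` outside `K` is added at time `f v`, when its neighbourhood is the clique `C v`, and `p v` is the
vertex of `C v` outside `K` that was added last, or `none` if `C v` is contained in `K`. -/
structure IsConstruction (G : SimpleGraph (Fin n)) (K : Finset (Fin n)) (f : Fin n → ℕ)
    (C : Fin n → Finset (Fin n)) (p : Fin n → Option (Fin n)) : Prop where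
  adj_iff : ∀ u v, G.Adj u v ↔ (u ∈ K ∧ v ∈ K ∧ u ≠ v) ∨ u ∈ C v ∨ v ∈ C u
  base : ∀ v ∈ K, C v = ∅ ∧ p v = none
  clique : ∀ v ∉ K, v ∉ C v ∧ G.IsClique (insert v (C v) : Set (Fin n))
  subset_of_none : ∀ v, p v = none → C v ⊆ K
  of_some : ∀ v w, p v = some w → f w < f v ∧ w ∉ K ∧ w ∈ C v ∧ (C v).erase w ⊆ C w

lemma IsChordalGraph.exists_isConstruction (hG : IsChordalGraph G)
    (hK : G.IsClique (K : Set (Fin n))) : ∃ f C p, IsConstruction G K f C p := by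
  classical
  obtain ⟨f, h0, hpos, hcl, hinj⟩ := hG.exists_elimination_order_on hK Finset.univ (by simp)
  let C : Fin n → Finset (Fin n) := fun v => Finset.univ.filter fun u => G.Adj u v ∧ f u < f v
  have hC : ∀ u v, u ∈ C v ↔ G.Adj u v ∧ f u < f v := fun u v => by simp [C]
  have hcl' : ∀ v ∉ K, ∀ u ∈ C v, ∀ w ∈ C v, u ≠ w → G.Adj u w := by
    intro v hv u hu w hw huw
    rw [hC] at hu hw
    exact hcl v (by simp) hv u ⟨by simp, hu.2⟩ w ⟨by simp, hw.2⟩ hu.1.symm hw.1.symm huw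
  have hp : ∀ v, ∃ o : Option (Fin n), (o = none → C v ⊆ K) ∧
      (∀ w, o = some w → w ∉ K ∧ w ∈ C v ∧ ∀ u ∈ C v, f u ≤ f w) := by
    intro v
    by_cases h : C v ⊆ K
    · exact ⟨none, fun _ => h, fun w hw => by simp at hw⟩
    · obtain ⟨w₀, hw₀, hw₀K⟩ := Finset.not_subset.1 h
      obtain ⟨w, hw, hmax⟩ := Finset.exists_max_image (C v) f ⟨w₀, hw₀⟩
      refine ⟨some w, fun h => by simp at h, fun w' hw' => ?_⟩
      obtain rfl : w = w' := by simpa using hw'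
      refine ⟨fun hwK => ?_, hw, hmax⟩
      have h1 := hmax w₀ hw₀
      have h2 := hpos w₀ (by simp) hw₀K
      rw [h0 w hwK] at h1
      omega
  choose p hp0 hp1 using hp
  have hCK : ∀ v ∈ K, C v = ∅ := by
    intro v hv
    ext u
    simp [hC, h0 v hv]
  refine ⟨f, C, p, fun u v => ?_, fun v hv => ⟨hCK v hv, ?_⟩, fun v hv => ⟨by simp [hC], ?_⟩, hp0,
    fun v w hvw => ?_⟩
  · constructor
    · intro huv
      by_cases hlt : f u < f v
      · exact Or.inr (Or.inl ((hC u v).2 ⟨huv, hlt⟩))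
      by_cases hgt : f v < f u
      · exact Or.inr (Or.inr ((hC v u).2 ⟨huv.symm, hgt⟩))
      have heq : f u = f v := by omega
      by_cases hu : u ∈ K
      · refine Or.inl ⟨hu, ?_, huv.ne⟩
        by_contra hv
        have := hpos v (by simp) hv
        rw [h0 u hu] at heq
        omega
      · by_cases hv : v ∈ K
        · have := hpos u (by simp) hu
          rw [h0 v hv] at heq
          omega
        · exact absurd (hinj u (by simp) v (by simp) hu hv heq) huv.ne
    · rintro (⟨hu, hv, huv⟩ | h | h)
      · exact hK hu hv huv
      · exact ((hC u v).1 h).1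
      · exact ((hC v u).1 h).1.symm
  · by_contra hne
    obtain ⟨w, hw⟩ := Option.ne_none_iff_exists'.1 hne
    have := (hp1 v w hw).2.1
    rw [hCK v hv] at this
    simp at this
  · intro x hx y hy hxy
    rcases hx with rfl | hx
    · exact ((hC _ _).1 (hy.resolve_left hxy.symm)).1.symm
    · rcases hy with rfl | hy
      · exact ((hC _ _).1 hx).1
      · exact hcl' v hv x hx y hy hxy
  · obtain ⟨hwK, hw, hmax⟩ := hp1 v w hvw
    have hvK : v ∉ K := fun hvK => by simp [hCK v hvK] at hw
    refine ⟨((hC w v).1 hw).2, hwK, hw, fun u hu => ?_⟩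
    obtain ⟨huw, hu⟩ := Finset.mem_erase.1 hu
    refine (hC u w).2 ⟨hcl' v hvK u hu w hw huw, lt_of_le_of_ne (hmax u hu) fun heq => huw ?_⟩
    by_cases huK : u ∈ K
    · have := hpos w (by simp) hwK
      rw [h0 u huK] at heq
      omega
    · exact hinj u (by simp) w (by simp) huK hwK heq

/-- The position of `u` among the elements of `B`. -/
def relIndex (B : Finset (Fin n)) (u : Fin n) : ℕ := (B.filter (· < u)).card

lemma relIndex_lt {B : Finset (Fin n)} {u : Fin n} (hu : u ∈ B) : relIndex B u < B.card :=
  Finset.card_lt_card (Finset.filter_ssubset.2 ⟨u, hu, lt_irrefl u⟩)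

lemma relIndex_injOn (B : Finset (Fin n)) : Set.InjOn (relIndex B) B := by
  have key : ∀ u ∈ B, ∀ w ∈ B, u < w → relIndex B u < relIndex B w := by
    intro u hu w hw huw
    apply Finset.card_lt_card
    refine Finset.ssubset_iff_of_subset (fun x hx => ?_) |>.2 ⟨u, by simp [hu, huw], by simp⟩
    rw [Finset.mem_filter] at hx ⊢
    exact ⟨hx.1, hx.2.trans huw⟩
  intro u hu w hw h
  rcases lt_trichotomy u w with hlt | heq | hlt
  · exact absurd h (key u hu w hw hlt).ne
  · exact heq
  · exact absurd h (key w hw u hu hlt).ne'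

/-- The set from which the neighbourhood of a vertex with last neighbour `o` is chosen, apart from
this last neighbour. -/
def codeBase (K : Finset (Fin n)) (C : Fin n → Finset (Fin n)) : Option (Fin n) → Finset (Fin n)
  | none => K
  | some w => C w

/-- The neighbourhood `C` without the last neighbour `o`. -/
def eraseOption (C : Finset (Fin n)) : Option (Fin n) → Finset (Fin n)
  | none => C
  | some w => C.erase w

/-- The code of a construction tells for each vertex the last neighbour outside `K`, and the
positions of the other neighbours in the clique from which they are chosen. -/
def constructionCode (K : Finset (Fin n)) (C : Fin n → Finset (Fin n))
    (p : Fin n → Option (Fin n)) (v : Fin n) : Option (Fin n) × Finset ℕ :=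
  (p v, (eraseOption (C v) (p v)).image (relIndex (codeBase K C (p v))))

namespace IsConstruction

variable {f : Fin n → ℕ} {C : Fin n → Finset (Fin n)} {p : Fin n → Option (Fin n)}

lemma eraseOption_subset (h : IsConstruction G K f C p) (v : Fin n) :
    eraseOption (C v) (p v) ⊆ codeBase K C (p v) := by
  cases hp : p v with
  | none => exact h.subset_of_none v hp
  | some w => exact (h.of_some v w hp).2.2.2

/-- A graph can be recovered from the code of any of its constructions, although the code does not
contain the order of the construction. -/
lemma eq_of_constructionCode_eq {G' : SimpleGraph (Fin n)} {f' : Fin n → ℕ}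
    {C' : Fin n → Finset (Fin n)} {p' : Fin n → Option (Fin n)} (h : IsConstruction G K f C p)
    (h' : IsConstruction G' K f' C' p') (hc : constructionCode K C p = constructionCode K C' p') :
    G = G' := by
  have hp : p = p' := funext fun v => congrArg Prod.fst (congrFun hc v)
  subst hp
  have hC : ∀ m v, f v < m → C v = C' v := by
    intro m
    induction m with
    | zero => intro v hv; omega
    | succ m ih =>
      intro v hv
      have hbase : codeBase K C (p v) = codeBase K C' (p v) := by
        cases hp : p v with
        | none => rfl
        | some w => exact ih w (by have := (h.of_some v w hp).1; omega)
      have himg := congrArg Prod.snd (congrFun hc v)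
      have hsub' := h'.eraseOption_subset v
      simp only [constructionCode] at himg
      rw [← hbase] at himg hsub'
      have herase : eraseOption (C v) (p v) = eraseOption (C' v) (p v) := by
        have := Finset.coe_inj.2 himg
        rw [Finset.coe_image, Finset.coe_image] at this
        exact Finset.coe_injective (((relIndex_injOn _).image_eq_image_iff
          (Finset.coe_subset.2 (h.eraseOption_subset v)) (Finset.coe_subset.2 hsub')).1 this)
      cases hp : p v with
      | none => rwa [hp] at herase
      | some w =>
        rw [hp] at herase
        rw [← Finset.insert_erase (h.of_some v w hp).2.2.1,
          ← Finset.insert_erase (h'.of_some v w hp).2.2.1]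
        exact congrArg (insert w) herase
  have hC' : C = C' := funext fun v => hC _ v (Nat.lt_succ_self _)
  subst hC'
  ext u v
  rw [h.adj_iff, h'.adj_iff]

lemma isSplitGraph (h : IsConstruction G K f C p) (hp : ∀ v, p v = none) : IsSplitGraph G := by
  refine ⟨K, fun x hx y hy hxy => (h.adj_iff x y).2 (Or.inl ⟨hx, hy, hxy⟩), ?_⟩
  intro x hx y hy _ hxy
  rcases (h.adj_iff x y).1 hxy with hh | hh | hh
  · exact hx hh.1
  · exact hx (h.subset_of_none y (hp y) hh)
  · exact hy (h.subset_of_none x (hp x) hh)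

end IsConstruction

end Codes

section Counting

variable {n : ℕ} {G : SimpleGraph (Fin n)} {K : Finset (Fin n)}

/-! ### Counting codes -/

lemma ncard_le_card_of_constructionCode_mem (𝒢 : Set (SimpleGraph (Fin n)))
    (S : Finset (Fin n → Option (Fin n) × Finset ℕ))
    (h : ∀ G ∈ 𝒢, ∃ f C p, IsConstruction G K f C p ∧ constructionCode K C p ∈ S) :
    𝒢.ncard ≤ S.card := by
  choose! f C p hcon hmem using h
  rw [← Set.ncard_coe_finset S]
  exact Set.ncard_le_ncard_of_injOn (fun G => constructionCode K (C G) (p G))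
    (fun G hG => hmem G hG)
    (fun G hG G' hG' he => (hcon G hG).eq_of_constructionCode_eq (hcon G' hG') he)

lemma card_filter_sub_le_card_powerset_le (k L : ℕ) :
    ((Finset.range k).powerset.filter fun D => k - L ≤ D.card).card ≤ (k + 1) ^ L := by
  have hsub : ((Finset.range k).powerset.filter fun D => k - L ≤ D.card) ⊆
      (Finset.range (L + 1)).biUnion fun j =>
        (Finset.powersetCard j (Finset.range k)).image (Finset.range k \ ·) := by
    intro D hD
    rw [Finset.mem_filter, Finset.mem_powerset] at hD
    have hc := Finset.card_sdiff_of_subset hD.1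
    rw [Finset.card_range] at hc
    refine Finset.mem_biUnion.2 ⟨(Finset.range k \ D).card, Finset.mem_range.2 (by omega),
      Finset.mem_image.2 ⟨Finset.range k \ D, ?_, Finset.sdiff_sdiff_eq_self hD.1⟩⟩
    exact Finset.mem_powersetCard.2 ⟨Finset.sdiff_subset, rfl⟩
  calc _ ≤ _ := Finset.card_le_card hsub
    _ ≤ ∑ j ∈ Finset.range (L + 1), k.choose j := by
      refine Finset.card_biUnion_le.trans (Finset.sum_le_sum fun j _ => ?_)
      refine Finset.card_image_le.trans ?_
      simp
    _ ≤ ∑ j ∈ Finset.range (L + 1), k ^ j * 1 ^ (L - j) * L.choose j := by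
      refine Finset.sum_le_sum fun j hj => ?_
      have h1 : 1 ≤ L.choose j := Nat.choose_pos (by have := Finset.mem_range.1 hj; omega)
      have h2 := Nat.choose_le_pow k j
      simp only [one_pow, mul_one]
      exact h2.trans (Nat.le_mul_of_pos_right _ h1)
    _ = (k + 1) ^ L := by
      rw [add_pow]
      simp

/-- The possible codes at `v` of constructions in which `B` is the set of vertices added with more
than `|K| - L` neighbours: such a vertex has few choices for its own neighbourhood, and any other
vertex leaves few choices for the neighbourhoods of which it is the last element. -/
def allowedCode (K : Finset (Fin n)) (L : ℕ) (B : Finset (Fin n)) (v : Fin n) :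
    Finset (Option (Fin n) × Finset ℕ) :=
  if v ∈ K then {(none, ∅)} else
  if v ∈ B then Finset.univ ×ˢ (Finset.range K.card).powerset.filter fun D => K.card - L ≤ D.card
  else {none} ×ˢ (Finset.range K.card).powerset ∪
    (B.image some ×ˢ (Finset.range (K.card - 1)).powerset ∪
      Finset.univ ×ˢ (Finset.range (K.card - L)).powerset)

/-- The codes of the split graphs with clique `K` and independent set `Kᶜ`. -/
def splitCode (K : Finset (Fin n)) (v : Fin n) : Finset (Option (Fin n) × Finset ℕ) :=
  if v ∈ K then {(none, ∅)} else {none} ×ˢ (Finset.range K.card).powerset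

lemma prod_ite_mem_one {M : Type*} [CommMonoid M] (K : Finset (Fin n)) (g : Fin n → M) :
    (∏ v, if v ∈ K then 1 else g v) = ∏ v ∈ Kᶜ, g v := by
  rw [← Finset.prod_mul_prod_compl K, Finset.prod_congr rfl (fun v hv => if_pos hv),
    Finset.prod_const_one, one_mul]
  exact Finset.prod_congr rfl fun v hv => if_neg (Finset.mem_compl.1 hv)

lemma card_piFinset_splitCode (K : Finset (Fin n)) :
    (Fintype.piFinset (splitCode K)).card = 2 ^ (K.card * Kᶜ.card) := by
  have : ∀ v, (splitCode K v).card = if v ∈ K then 1 else 2 ^ K.card := by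
    intro v
    by_cases hv : v ∈ K <;> simp [splitCode, hv]
  rw [Fintype.card_piFinset]
  simp_rw [this]
  rw [prod_ite_mem_one, Finset.prod_const, ← pow_mul]

section Construction

variable {f : Fin n → ℕ} {C : Fin n → Finset (Fin n)} {p : Fin n → Option (Fin n)}

lemma IsConstruction.card_lt (h : IsConstruction G K f C p)
    (hmax : ∀ S : Finset (Fin n), G.IsClique (S : Set (Fin n)) → S.card ≤ K.card) {v : Fin n}
    (hv : v ∉ K) : (C v).card < K.card := by
  have := hmax (insert v (C v)) (by simpa using (h.clique v hv).2)
  rw [Finset.card_insert_of_notMem (h.clique v hv).1] at this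
  omega

lemma IsConstruction.card_code (h : IsConstruction G K f C p) (v : Fin n) :
    (constructionCode K C p v).2.card = (eraseOption (C v) (p v)).card :=
  Finset.card_image_of_injOn
    ((relIndex_injOn _).mono (Finset.coe_subset.2 (h.eraseOption_subset v)))

lemma IsConstruction.code_subset (h : IsConstruction G K f C p) (v : Fin n) :
    (constructionCode K C p v).2 ⊆ Finset.range (codeBase K C (p v)).card := by
  intro i hi
  obtain ⟨u, hu, rfl⟩ := Finset.mem_image.1 hi
  exact Finset.mem_range.2 (relIndex_lt (h.eraseOption_subset v hu))

lemma IsConstruction.code_eq_of_mem (h : IsConstruction G K f C p) {v : Fin n} (hv : v ∈ K) :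
    constructionCode K C p v = (none, ∅) := by
  simp [constructionCode, (h.base v hv).1, (h.base v hv).2, eraseOption]

lemma IsConstruction.card_codeBase_le (h : IsConstruction G K f C p)
    (hmax : ∀ S : Finset (Fin n), G.IsClique (S : Set (Fin n)) → S.card ≤ K.card) (v : Fin n) :
    (codeBase K C (p v)).card ≤ K.card := by
  cases hp : p v with
  | none => exact le_rfl
  | some w => exact (h.card_lt hmax (h.of_some v w hp).2.1).le

lemma IsConstruction.code_mem_allowedCode (h : IsConstruction G K f C p)
    (hmax : ∀ S : Finset (Fin n), G.IsClique (S : Set (Fin n)) → S.card ≤ K.card) (L : ℕ)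
    (v : Fin n) : constructionCode K C p v ∈
      allowedCode K L (Finset.univ.filter fun v => K.card - L < (C v).card) v := by
  unfold allowedCode
  split_ifs with hvK hvB
  · rw [h.code_eq_of_mem hvK]; simp
  · have hc : (C v).card ≤ (eraseOption (C v) (p v)).card + 1 := by
      cases p v with
      | none => exact Nat.le_succ _
      | some w =>
        have := Finset.pred_card_le_card_erase (s := C v) (a := w)
        simp only [eraseOption]
        omega
    have hv : K.card - L < (C v).card := by simpa using hvB
    refine Finset.mem_product.2 ⟨Finset.mem_univ _, Finset.mem_filter.2 ⟨Finset.mem_powerset.2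
      ((h.code_subset v).trans (Finset.range_mono (h.card_codeBase_le hmax v))), ?_⟩⟩
    rw [h.card_code]
    omega
  · have hsub := h.code_subset v
    cases hp : p v with
    | none =>
      rw [hp] at hsub
      refine Finset.mem_union_left _ (Finset.mem_product.2 ⟨?_, Finset.mem_powerset.2 hsub⟩)
      simp [constructionCode, hp]
    | some w =>
      rw [hp] at hsub
      refine Finset.mem_union_right _ ?_
      by_cases hw : K.card - L < (C w).card
      · refine Finset.mem_union_left _ (Finset.mem_product.2 ⟨?_, Finset.mem_powerset.2
          (hsub.trans (Finset.range_mono ?_))⟩)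
        · simp [constructionCode, hp, hw]
        · exact Nat.le_sub_one_of_lt (h.card_lt hmax (h.of_some v w hp).2.1)
      · exact Finset.mem_union_right _ (Finset.mem_product.2 ⟨Finset.mem_univ _,
          Finset.mem_powerset.2 (hsub.trans (Finset.range_mono (not_lt.1 hw)))⟩)

end Construction

/-- The chordal graphs that are not split and have `K` as a clique of maximal size. -/
def nonsplitChordal (K : Finset (Fin n)) : Set (SimpleGraph (Fin n)) :=
  {G | IsChordalGraph G ∧ ¬ IsSplitGraph G ∧ G.IsClique (K : Set (Fin n)) ∧
    ∀ S : Finset (Fin n), G.IsClique (S : Set (Fin n)) → S.card ≤ K.card}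

lemma ncard_nonsplitChordal_le (K : Finset (Fin n)) :
    (nonsplitChordal K).ncard ≤ (n + 1) ^ n * 2 ^ (K.card * Kᶜ.card) := by
  classical
  let S : Fin n → Finset (Option (Fin n) × Finset ℕ) := fun v =>
    if v ∈ K then {(none, ∅)} else Finset.univ ×ˢ (Finset.range K.card).powerset
  have hcard : ∀ v, (S v).card = if v ∈ K then 1 else (n + 1) * 2 ^ K.card := by
    intro v
    by_cases hv : v ∈ K <;> simp [S, hv]
  calc (nonsplitChordal K).ncard ≤ (Fintype.piFinset S).card := by
        refine ncard_le_card_of_constructionCode_mem (K := K) _ _ ?_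
        rintro G ⟨hG, -, hK, hmax⟩
        obtain ⟨f, C, p, h⟩ := hG.exists_isConstruction hK
        refine ⟨f, C, p, h, Fintype.mem_piFinset.2 fun v => ?_⟩
        by_cases hv : v ∈ K
        · simp [S, hv, h.code_eq_of_mem hv]
        · simp only [S, hv, if_false, Finset.mem_product, Finset.mem_univ, true_and,
            Finset.mem_powerset]
          exact (h.code_subset v).trans (Finset.range_mono (h.card_codeBase_le hmax v))
    _ = (n + 1) ^ Kᶜ.card * 2 ^ (K.card * Kᶜ.card) := by
        rw [Fintype.card_piFinset]
        simp_rw [hcard]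
        rw [prod_ite_mem_one, Finset.prod_const, mul_pow, ← pow_mul]
    _ ≤ _ := by
        gcongr
        · omega
        · simpa using Finset.card_le_univ Kᶜ

lemma ncard_nonsplitChordal_add_le (K : Finset (Fin n)) (L : ℕ) :
    (nonsplitChordal K).ncard + 2 ^ (K.card * Kᶜ.card) ≤
      ∑ B ∈ Kᶜ.powerset, ∏ v, (allowedCode K L B v).card := by
  classical
  let S := Kᶜ.powerset.biUnion fun B => Fintype.piFinset (allowedCode K L B)
  have hS : Fintype.piFinset (splitCode K) ⊆ S := by
    refine fun c hc => Finset.mem_biUnion.2 ⟨∅, by simp, Fintype.mem_piFinset.2 fun v => ?_⟩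
    have := Fintype.mem_piFinset.1 hc v
    by_cases hv : v ∈ K
    · simpa [allowedCode, splitCode, hv] using this
    · simp only [splitCode, hv, if_false] at this
      simp only [allowedCode, hv, if_false, Finset.notMem_empty]
      exact Finset.mem_union_left _ this
  have hle : (nonsplitChordal K).ncard ≤ (S \ Fintype.piFinset (splitCode K)).card := by
    refine ncard_le_card_of_constructionCode_mem (K := K) _ _ ?_
    rintro G ⟨hG, hns, hK, hmax⟩
    obtain ⟨f, C, p, h⟩ := hG.exists_isConstruction hK
    refine ⟨f, C, p, h, Finset.mem_sdiff.2 ⟨Finset.mem_biUnion.2 ⟨_, Finset.mem_powerset.2 ?_,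
      Fintype.mem_piFinset.2 fun v => h.code_mem_allowedCode hmax L v⟩, fun hc => ?_⟩⟩
    · intro v hv
      rw [Finset.mem_compl]
      intro hvK
      simp [(h.base v hvK).1] at hv
    · refine hns (h.isSplitGraph fun v => ?_)
      by_cases hv : v ∈ K
      · exact (h.base v hv).2
      · have := Fintype.mem_piFinset.1 hc v
        simp only [splitCode, hv, if_false] at this
        simpa [constructionCode] using (Finset.mem_product.1 this).1
  have hsum : S.card ≤ ∑ B ∈ Kᶜ.powerset, ∏ v, (allowedCode K L B v).card :=
    Finset.card_biUnion_le.trans_eq (Finset.sum_congr rfl fun B _ => Fintype.card_piFinset _)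
  rw [Finset.card_sdiff_of_subset hS] at hle
  have := Finset.card_le_card hS
  rw [card_piFinset_splitCode] at hle this
  omega

lemma prod_card_allowedCode_le {L : ℕ} (hL : L ≤ K.card) (hK : 1 ≤ K.card) {B : Finset (Fin n)}
    (hB : B ⊆ Kᶜ) : ((∏ v, (allowedCode K L B v).card : ℕ) : ℝ) ≤
      2 ^ (K.card * Kᶜ.card) * (1 + (n + 1) / 2 ^ L) ^ Kᶜ.card *
        ((n + 1) * (K.card + 1) ^ L * (3 / 2) ^ Kᶜ.card / 2 ^ K.card) ^ B.card := by
  set k := K.card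
  set r := Kᶜ.card
  set m := B.card
  set δ : ℝ := (n + 1) / 2 ^ L with hδ
  have hδ0 : 0 ≤ δ := by positivity
  set M : ℝ := (n + 1) * (k + 1) ^ L with hM
  have hmr : m ≤ r := Finset.card_le_card hB
  have hbig : ∀ v ∈ B, ((allowedCode K L B v).card : ℝ) ≤ M := by
    intro v hv
    have hvK : v ∉ K := Finset.mem_compl.1 (hB hv)
    simp only [allowedCode, hvK, hv, if_false, if_true, Finset.card_product]
    have := card_filter_sub_le_card_powerset_le k L
    rw [hM]
    push_cast
    apply mul_le_mul
    · simp
    · exact_mod_cast this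
    · positivity
    · positivity
  have hsmall : ∀ v ∈ Kᶜ \ B, ((allowedCode K L B v).card : ℝ) ≤ 2 ^ k * (1 + δ) * (3 / 2) ^ m := by
    intro v hv
    rw [Finset.mem_sdiff, Finset.mem_compl] at hv
    simp only [allowedCode, hv.1, hv.2, if_false]
    have h1 : (({none} ×ˢ (Finset.range k).powerset ∪
        (B.image some ×ˢ (Finset.range (k - 1)).powerset ∪
        Finset.univ ×ˢ (Finset.range (k - L)).powerset) :
        Finset (Option (Fin n) × Finset ℕ))).card ≤
        2 ^ k + (m * 2 ^ (k - 1) + (n + 1) * 2 ^ (k - L)) := by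
      refine (Finset.card_union_le _ _).trans (Nat.add_le_add ?_
        ((Finset.card_union_le _ _).trans (Nat.add_le_add ?_ ?_)))
      · simp
      · rw [Finset.card_product, Finset.card_powerset, Finset.card_range]
        exact Nat.mul_le_mul_right _ Finset.card_image_le
      · simp
    have h2 : (2 : ℝ) ^ (k - 1) = 2 ^ k / 2 := by
      rw [eq_div_iff two_ne_zero, ← pow_succ]; congr 1; omega
    have h3 : (2 : ℝ) ^ (k - L) = 2 ^ k / 2 ^ L := by
      rw [eq_div_iff (by positivity), ← pow_add]; congr 1; omega
    have h4 : 1 + (m : ℝ) * (1 / 2) ≤ (1 + 1 / 2) ^ m :=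
      one_add_mul_le_pow (by norm_num) m
    calc _ ≤ ((2 ^ k + (m * 2 ^ (k - 1) + (n + 1) * 2 ^ (k - L)) : ℕ) : ℝ) := by exact_mod_cast h1
      _ = 2 ^ k * (1 + m * (1 / 2) + δ) := by
        push_cast
        rw [h2, h3, hδ]
        ring
      _ ≤ 2 ^ k * ((1 + δ) * (1 + m * (1 / 2))) := by
        gcongr
        have : 0 ≤ δ * (m * (1 / 2)) := by positivity
        linarith
      _ ≤ 2 ^ k * ((1 + δ) * (1 + 1 / 2) ^ m) := by gcongr
      _ = _ := by norm_num; ring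
  have hsplit : (∏ v, (allowedCode K L B v).card) = (∏ v ∈ Kᶜ \ B, (allowedCode K L B v).card) *
      ∏ v ∈ B, (allowedCode K L B v).card := by
    rw [Finset.prod_sdiff hB, ← Finset.prod_mul_prod_compl K]
    rw [Finset.prod_eq_one (s := K), one_mul]
    intro v hv
    simp [allowedCode, hv]
  have e1 : (2 : ℝ) ^ (k * r) = (2 ^ k) ^ (r - m) * (2 ^ k) ^ m := by
    rw [pow_mul, ← pow_add]; congr 1; omega
  rw [hsplit]
  push_cast
  calc _ ≤ (∏ v ∈ Kᶜ \ B, (2 ^ k * (1 + δ) * (3 / 2 : ℝ) ^ m)) * ∏ v ∈ B, M := by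
        apply mul_le_mul
        · exact Finset.prod_le_prod (fun _ _ => Nat.cast_nonneg _) hsmall
        · exact Finset.prod_le_prod (fun _ _ => Nat.cast_nonneg _) hbig
        · exact Finset.prod_nonneg fun _ _ => Nat.cast_nonneg _
        · exact Finset.prod_nonneg fun _ _ => by positivity
    _ = (2 ^ k) ^ (r - m) * (1 + δ) ^ (r - m) * ((3 / 2 : ℝ) ^ m) ^ (r - m) * M ^ m := by
        rw [Finset.prod_const, Finset.prod_const, Finset.card_sdiff_of_subset hB, mul_pow, mul_pow]
    _ ≤ (2 ^ k) ^ (r - m) * (1 + δ) ^ r * ((3 / 2 : ℝ) ^ m) ^ r * M ^ m := by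
        gcongr
        · linarith
        · omega
        · exact one_le_pow₀ (by norm_num)
        · omega
    _ = _ := by
        rw [e1, div_pow (M * _), mul_pow M, pow_right_comm (3 / 2 : ℝ) r m]
        have hne : ((2 : ℝ) ^ k) ^ m ≠ 0 := by positivity
        generalize ((2 : ℝ) ^ k) ^ m = a at hne
        generalize ((2 : ℝ) ^ k) ^ (r - m) = b
        generalize ((3 / 2 : ℝ) ^ m) ^ r = c
        generalize (1 + δ) ^ r = d
        generalize M ^ m = e
        field_simp

/-- There are `2 ^ (|K| * |Kᶜ|)` split graphs with the clique `K` and the independent set `Kᶜ`.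
Unless `K` is small, the other chordal graphs with the largest clique `K` are few in comparison. -/
lemma ncard_nonsplitChordal_le_of_le {L : ℕ} (hL : L ≤ K.card) (hK : 1 ≤ K.card) :
    ((nonsplitChordal K).ncard : ℝ) ≤ 2 ^ (K.card * Kᶜ.card) *
      ((1 + (n + 1) / 2 ^ L) ^ Kᶜ.card *
        (1 + (n + 1) * (K.card + 1) ^ L * (3 / 2) ^ Kᶜ.card / 2 ^ K.card) ^ Kᶜ.card - 1) := by
  have h := ncard_nonsplitChordal_add_le K L
  have h' : ((nonsplitChordal K).ncard : ℝ) + 2 ^ (K.card * Kᶜ.card) ≤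
      ∑ B ∈ Kᶜ.powerset, ((∏ v, (allowedCode K L B v).card : ℕ) : ℝ) := by exact_mod_cast h
  have h2 := Finset.sum_le_sum fun B (hB : B ∈ Kᶜ.powerset) =>
    prod_card_allowedCode_le hL hK (Finset.mem_powerset.1 hB)
  rw [← Finset.mul_sum] at h2
  have h3 := Finset.sum_pow_mul_eq_add_pow
    ((n + 1) * (K.card + 1) ^ L * (3 / 2) ^ Kᶜ.card / 2 ^ K.card : ℝ) 1 Kᶜ
  simp only [one_pow, mul_one] at h3
  rw [h3, add_comm (_ / _ : ℝ) 1] at h2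
  linarith

end Counting

section SplitCount

variable {n : ℕ}

/-! ### Counting split graphs -/

/-- The split graphs with clique `K` and independent set `Kᶜ`. -/
def splitGraphs (K : Finset (Fin n)) : Set (SimpleGraph (Fin n)) :=
  {G | G.IsClique (K : Set (Fin n)) ∧ G.IsIndepSet (K : Set (Fin n))ᶜ}

/-- The split graph with clique `K` in which `N v` is the neighbourhood of a vertex `v` outside
`K`. -/
def splitGraphOf (K : Finset (Fin n)) (N : Fin n → Finset (Fin n)) : SimpleGraph (Fin n) where
  Adj u v := u ≠ v ∧ ((u ∈ K ∧ v ∈ K) ∨ u ∈ N v ∨ v ∈ N u)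
  symm := ⟨fun u v h => ⟨h.1.symm, by tauto⟩⟩
  loopless := ⟨fun u h => h.1 rfl⟩

lemma two_pow_le_ncard_splitGraphs (K : Finset (Fin n)) :
    2 ^ (K.card * Kᶜ.card) ≤ (splitGraphs K).ncard := by
  classical
  let S := Fintype.piFinset fun v => if v ∈ K then {∅} else K.powerset
  have hcard : S.card = 2 ^ (K.card * Kᶜ.card) := by
    have : ∀ v, (if v ∈ K then {∅} else K.powerset).card = if v ∈ K then 1 else 2 ^ K.card := by
      intro v
      split_ifs <;> simp
    rw [Fintype.card_piFinset]
    simp_rw [this]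
    rw [prod_ite_mem_one, Finset.prod_const, ← pow_mul]
  have hmem : ∀ N ∈ S, ∀ v, N v ⊆ K ∧ (v ∈ K → N v = ∅) := by
    intro N hN v
    have := Fintype.mem_piFinset.1 hN v
    by_cases hv : v ∈ K
    · simp only [hv, if_true, Finset.mem_singleton] at this
      simp [this]
    · simp only [hv, if_false, Finset.mem_powerset] at this
      exact ⟨this, fun h => absurd h hv⟩
  rw [← hcard, ← Set.ncard_coe_finset]
  refine Set.ncard_le_ncard_of_injOn (splitGraphOf K) (fun N hN => ⟨?_, ?_⟩) ?_
  · exact fun u hu v hv huv => ⟨huv, Or.inl ⟨hu, hv⟩⟩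
  · rintro u hu v hv - ⟨-, h | h | h⟩
    · exact hu h.1
    · exact hu ((hmem N hN v).1 h)
    · exact hv ((hmem N hN u).1 h)
  · intro N hN N' hN' he
    have key : ∀ N ∈ S, ∀ v ∉ K, ∀ u, u ∈ N v ↔ u ∈ K ∧ (splitGraphOf K N).Adj u v := by
      intro N hN v hv u
      constructor
      · intro hu
        have huK := (hmem N hN v).1 hu
        exact ⟨huK, by rintro rfl; exact hv huK, Or.inr (Or.inl hu)⟩
      · rintro ⟨huK, -, h | h | h⟩
        · exact absurd h.2 hv
        · exact h
        · exact absurd ((hmem N hN u).1 h) hv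
    funext v
    by_cases hv : v ∈ K
    · rw [(hmem N hN v).2 hv, (hmem N' hN' v).2 hv]
    · ext u
      rw [key N hN v hv, key N' hN' v hv, he]

lemma isSplitGraph_of_mem_splitGraphs {K : Finset (Fin n)} {G : SimpleGraph (Fin n)}
    (h : G ∈ splitGraphs K) : IsSplitGraph G := ⟨K, h.1, h.2⟩

lemma two_pow_le_ncard_isSplitGraph (k : ℕ) (hk : k ≤ n) :
    2 ^ (k * (n - k)) ≤ {G : SimpleGraph (Fin n) | IsSplitGraph G}.ncard := by
  obtain ⟨K, -, hK⟩ := Finset.exists_subset_card_eq (s := (Finset.univ : Finset (Fin n))) (n := k)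
    (by simpa using hk)
  have h := two_pow_le_ncard_splitGraphs K
  rw [Finset.card_compl, hK, Fintype.card_fin] at h
  exact h.trans (Set.ncard_le_ncard fun G hG => isSplitGraph_of_mem_splitGraphs hG)

/-- Two partitions of a graph into a clique and an independent set differ in at most two vertices:
one that leaves the clique and one that enters it. -/
lemma card_filter_mem_splitGraphs_le (G : SimpleGraph (Fin n))
    [DecidablePred fun K : Finset (Fin n) => G ∈ splitGraphs K] :
    (Finset.univ.filter fun K : Finset (Fin n) => G ∈ splitGraphs K).card ≤ (n + 1) ^ 2 := by
  classical
  by_cases hex : ∃ K₀ : Finset (Fin n), G ∈ splitGraphs K₀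
  swap
  · push Not at hex
    simp [hex]
  obtain ⟨K₀, hK₀⟩ := hex
  let A : Finset (Finset (Fin n)) := Finset.univ.image Option.toFinset
  have hA : A.card ≤ n + 1 := Finset.card_image_le.trans (by simp)
  have hdiff : ∀ K K', G ∈ splitGraphs K → G ∈ splitGraphs K' → K \ K' ∈ A := by
    intro K K' hK hK'
    have hle : (K \ K').card ≤ 1 := by
      refine Finset.card_le_one.2 fun u hu w hw => ?_
      rw [Finset.mem_sdiff] at hu hw
      by_contra huw
      exact hK'.2 hu.2 hw.2 huw (hK.1 hu.1 hw.1 huw)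
    rcases Nat.le_one_iff_eq_zero_or_eq_one.1 hle with h | h
    · rw [Finset.card_eq_zero.1 h]
      exact Finset.mem_image.2 ⟨none, by simp, rfl⟩
    · obtain ⟨a, ha⟩ := Finset.card_eq_one.1 h
      rw [ha]
      exact Finset.mem_image.2 ⟨some a, by simp, rfl⟩
  calc _ ≤ (A ×ˢ A).card := by
        refine Finset.card_le_card_of_injOn (fun K => (K \ K₀, K₀ \ K)) (fun K hK => ?_) ?_
        · have hK : G ∈ splitGraphs K := by simpa using hK
          exact Finset.mem_product.2 ⟨hdiff K K₀ hK hK₀, hdiff K₀ K hK₀ hK⟩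
        · intro K _ K' _ he
          simp only [Prod.mk.injEq, Finset.ext_iff, Finset.mem_sdiff] at he
          ext u
          have h1 := he.1 u
          have h2 := he.2 u
          tauto
    _ ≤ (n + 1) ^ 2 := by
        rw [Finset.card_product, sq]
        exact Nat.mul_le_mul hA hA

lemma sum_two_pow_le (n : ℕ) : ∑ K : Finset (Fin n), 2 ^ (K.card * Kᶜ.card) ≤
    (n + 1) ^ 2 * {G : SimpleGraph (Fin n) | IsSplitGraph G}.ncard := by
  classical
  have := Fintype.ofFinite (SimpleGraph (Fin n))
  let S : Finset (SimpleGraph (Fin n)) := Finset.univ.filter IsSplitGraph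
  have hS : {G : SimpleGraph (Fin n) | IsSplitGraph G}.ncard = S.card := by
    rw [← Set.ncard_coe_finset]
    congr 1
    ext G
    simp [S]
  calc _ ≤ ∑ K : Finset (Fin n), (S.filter fun G => G ∈ splitGraphs K).card := by
        refine Finset.sum_le_sum fun K _ => (two_pow_le_ncard_splitGraphs K).trans_eq ?_
        rw [← Set.ncard_coe_finset]
        congr 1
        ext G
        simpa [S] using isSplitGraph_of_mem_splitGraphs
    _ = ∑ G ∈ S, (Finset.univ.filter fun K : Finset (Fin n) => G ∈ splitGraphs K).card :=
        Finset.sum_card_bipartiteAbove_eq_sum_card_bipartiteBelow fun K G => G ∈ splitGraphs K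
    _ ≤ ∑ _G ∈ S, (n + 1) ^ 2 := Finset.sum_le_sum fun G _ => card_filter_mem_splitGraphs_le G
    _ = _ := by rw [Finset.sum_const, smul_eq_mul, hS, mul_comm]

lemma ncard_nonsplit_le_sum (n : ℕ) :
    {G : SimpleGraph (Fin n) | IsChordalGraph G ∧ ¬ IsSplitGraph G}.ncard ≤
      ∑ K : Finset (Fin n), (nonsplitChordal K).ncard := by
  classical
  have hsub : {G : SimpleGraph (Fin n) | IsChordalGraph G ∧ ¬ IsSplitGraph G} ⊆
      ⋃ K : Finset (Fin n), nonsplitChordal K := by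
    rintro G ⟨hG, hns⟩
    obtain ⟨K, hK, hmax⟩ := Finset.exists_max_image
      (Finset.univ.filter fun K : Finset (Fin n) => G.IsClique (K : Set (Fin n))) Finset.card
      ⟨∅, by simp⟩
    exact Set.mem_iUnion.2 ⟨K, hG, hns, by simpa using hK, fun S hS => hmax S (by simpa using hS)⟩
  exact (Set.ncard_le_ncard hsub).trans (Set.ncard_iUnion_le_of_fintype _)

/-! ### Almost all chordal graphs are split -/

/-- For a clique `K` with at least `2 * n / 5` vertices, twice this number bounds the chordal graphs
that are not split and have the largest clique `K`, relative to `2 ^ (|K| * |Kᶜ|)`. It results from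
the threshold `L = √n` for the size of neighbourhoods. -/
noncomputable def largeCliqueError (n : ℕ) : ℝ :=
  (n + 1) ^ 2 / 2 ^ Nat.sqrt n + (n + 1) ^ (Nat.sqrt n + 2) * 0.97 ^ n

lemma largeCliqueError_nonneg (n : ℕ) : 0 ≤ largeCliqueError n := by
  unfold largeCliqueError; positivity

lemma three_halves_pow_div_le {k r : ℕ} (h : 2 * (k + r) ≤ 5 * k) :
    (3 / 2 : ℝ) ^ r / 2 ^ k ≤ 0.97 ^ (k + r) := by
  -- both sides are compared with a power of `0.92`, by squares and by fifth powers
  have h1 : (3 / 2 : ℝ) ^ r / 2 ^ k ≤ 0.92 ^ k := by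
    rw [div_le_iff₀ (by positivity), ← mul_pow]
    refine le_of_pow_le_pow_left₀ (n := 2) (by norm_num) (by positivity) ?_
    calc ((3 / 2 : ℝ) ^ r) ^ 2 = (3 / 2) ^ (r * 2) := by rw [pow_mul]
      _ ≤ (3 / 2) ^ (3 * k) := pow_le_pow_right₀ (by norm_num) (by omega)
      _ = ((3 / 2) ^ 3) ^ k := by rw [pow_mul]
      _ ≤ ((0.92 * 2) ^ 2) ^ k := by gcongr; norm_num
      _ = _ := by rw [← pow_mul, ← pow_mul, mul_comm 2 k]
  refine h1.trans ?_
  refine le_of_pow_le_pow_left₀ (n := 5) (by norm_num) (by positivity) ?_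
  calc ((0.92 : ℝ) ^ k) ^ 5 = 0.92 ^ (5 * k) := by rw [← pow_mul, mul_comm]
    _ ≤ 0.92 ^ (2 * (k + r)) := pow_le_pow_of_le_one (by norm_num) (by norm_num) h
    _ = (0.92 ^ 2) ^ (k + r) := by rw [pow_mul]
    _ ≤ (0.97 ^ 5) ^ (k + r) := by gcongr; norm_num
    _ = _ := by rw [← pow_mul, ← pow_mul, mul_comm]

lemma ncard_nonsplitChordal_le_of_large {K : Finset (Fin n)} (hK : 2 * n ≤ 5 * K.card)
    (hn : 7 ≤ n) (hx : largeCliqueError n ≤ 1) :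
    ((nonsplitChordal K).ncard : ℝ) ≤ 2 ^ (K.card * Kᶜ.card) * (2 * largeCliqueError n) := by
  have hkr : K.card + Kᶜ.card = n := by simp
  have hL : Nat.sqrt n ≤ K.card := by
    have h1 := Nat.sqrt_le' n
    by_contra hlt
    have h2 : K.card + 1 ≤ Nat.sqrt n := by omega
    have h3 : 3 ≤ K.card := by omega
    nlinarith
  refine (ncard_nonsplitChordal_le_of_le hL (by omega)).trans ?_
  gcongr
  set k := K.card
  set r := Kᶜ.card
  set L := Nat.sqrt n
  have hpow : ∀ x : ℝ, 0 ≤ x → (1 + x) ^ r ≤ Real.exp (n * x) := by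
    intro x hx
    calc (1 + x) ^ r ≤ Real.exp x ^ r := by
          gcongr
          rw [add_comm]
          exact Real.add_one_le_exp x
      _ = Real.exp (r * x) := by rw [← Real.exp_nat_mul]
      _ ≤ _ := by
          gcongr
          omega
  have hy : ((n : ℝ) + 1) * (k + 1) ^ L * (3 / 2) ^ r / 2 ^ k ≤ (n + 1) ^ (L + 1) * 0.97 ^ n := by
    have h1 := three_halves_pow_div_le (k := k) (r := r) (by omega)
    rw [hkr] at h1
    have h2 : (k : ℝ) ≤ n := by exact_mod_cast (by omega : k ≤ n)
    calc _ = ((n : ℝ) + 1) * (k + 1) ^ L * ((3 / 2) ^ r / 2 ^ k) := by rw [mul_div_assoc]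
      _ ≤ ((n : ℝ) + 1) * (n + 1) ^ L * 0.97 ^ n := by gcongr
      _ = _ := by rw [pow_succ' _ L]
  have hsum : n * (((n : ℝ) + 1) / 2 ^ L) +
      n * (((n : ℝ) + 1) * (k + 1) ^ L * (3 / 2) ^ r / 2 ^ k) ≤ largeCliqueError n := by
    unfold largeCliqueError
    apply add_le_add
    · rw [← mul_div_assoc]
      gcongr
      nlinarith
    · calc _ ≤ ((n : ℝ) + 1) * ((n + 1) ^ (L + 1) * 0.97 ^ n) := by
            gcongr
            linarith
        _ = _ := by rw [← mul_assoc, ← pow_succ']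
  calc _ ≤ Real.exp (n * (((n : ℝ) + 1) / 2 ^ L)) *
        Real.exp (n * (((n : ℝ) + 1) * (k + 1) ^ L * (3 / 2) ^ r / 2 ^ k)) - 1 := by
        gcongr
        · exact hpow _ (by positivity)
        · exact hpow _ (by positivity)
    _ ≤ Real.exp (largeCliqueError n) - 1 := by
        rw [← Real.exp_add]
        gcongr
    _ ≤ 2 * largeCliqueError n := by
        have h0 := largeCliqueError_nonneg n
        have := Real.abs_exp_sub_one_le (x := largeCliqueError n) (by rwa [abs_of_nonneg h0])
        rw [abs_of_nonneg h0] at this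
        exact (le_abs_self _).trans this

lemma ncard_nonsplitChordal_le_of_small {K : Finset (Fin n)} (hK : 5 * K.card < 2 * n) :
    ((nonsplitChordal K).ncard : ℝ) ≤ 2 * (n + 1) ^ n * 0.995 ^ (n * n) *
      ({G : SimpleGraph (Fin n) | IsSplitGraph G}.ncard : ℝ) := by
  have hkr : K.card + Kᶜ.card = n := by simp
  have h1 : ((nonsplitChordal K).ncard : ℝ) ≤ (n + 1) ^ n * 2 ^ (K.card * Kᶜ.card) := by
    exact_mod_cast ncard_nonsplitChordal_le K
  have h2 : (2 : ℝ) ^ (n / 2 * (n - n / 2)) ≤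
      ({G : SimpleGraph (Fin n) | IsSplitGraph G}.ncard : ℝ) := by
    exact_mod_cast two_pow_le_ncard_isSplitGraph (n / 2) (Nat.div_le_self n 2)
  have h3 : (2 : ℝ) ^ (K.card * Kᶜ.card) ≤ 2 * 0.995 ^ (n * n) * 2 ^ (n / 2 * (n - n / 2)) := by
    set k := K.card
    set r := Kᶜ.card
    have e1 : 25 * (k * r) ≤ 6 * (n * n) := by nlinarith
    have e2 : n * n ≤ 4 * (n / 2 * (n - n / 2)) + 1 := by
      obtain ⟨m, hm | hm⟩ : ∃ m, n = 2 * m ∨ n = 2 * m + 1 := ⟨n / 2, by omega⟩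
      · have h1 : n / 2 = m := by omega
        have h2 : n - m = m := by omega
        rw [h1, h2, hm]; nlinarith
      · have h1 : n / 2 = m := by omega
        have h2 : n - m = m + 1 := by omega
        rw [h1, h2, hm]; nlinarith
    refine le_of_pow_le_pow_left₀ (n := 100) (by norm_num) (by positivity) ?_
    calc ((2 : ℝ) ^ (k * r)) ^ 100 = 2 ^ (100 * (k * r)) := by rw [← pow_mul, mul_comm]
      _ ≤ 2 ^ (24 * (n * n)) := pow_le_pow_right₀ (by norm_num) (by omega)
      _ = (1 / 2) ^ (n * n) * 2 ^ (25 * (n * n)) := by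
          rw [show 25 * (n * n) = n * n + 24 * (n * n) by ring, pow_add,
            ← mul_assoc ((1 / 2 : ℝ) ^ _), ← mul_pow]
          norm_num
      _ ≤ (0.995 ^ 100) ^ (n * n) * 2 ^ (100 * (n / 2 * (n - n / 2)) + 100) := by
          gcongr
          · norm_num
          · norm_num
          · omega
      _ = _ := by
          rw [mul_pow, mul_pow, ← pow_mul, ← pow_mul, ← pow_mul, pow_add,
            mul_comm (n * n) 100, mul_comm (n / 2 * (n - n / 2)) 100]
          ring
  calc _ ≤ ((n : ℝ) + 1) ^ n * 2 ^ (K.card * Kᶜ.card) := h1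
    _ ≤ ((n : ℝ) + 1) ^ n * (2 * 0.995 ^ (n * n) *
        ({G : SimpleGraph (Fin n) | IsSplitGraph G}.ncard : ℝ)) := by
        gcongr
        exact h3.trans (by gcongr)
    _ = _ := by ring

lemma ncard_nonsplit_le (hn : 7 ≤ n) (hx : largeCliqueError n ≤ 1) :
    ({G : SimpleGraph (Fin n) | IsChordalGraph G ∧ ¬ IsSplitGraph G}.ncard : ℝ) ≤
      (2 * ((n + 1) ^ 2 * largeCliqueError n) + 2 * (2 * (n + 1) * 0.995 ^ n) ^ n) *
        ({G : SimpleGraph (Fin n) | IsSplitGraph G}.ncard : ℝ) := by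
  have hsum : ∑ K : Finset (Fin n), (2 : ℝ) ^ (K.card * Kᶜ.card) ≤
      (n + 1) ^ 2 * ({G : SimpleGraph (Fin n) | IsSplitGraph G}.ncard : ℝ) := by
    exact_mod_cast sum_two_pow_le n
  set s := ({G : SimpleGraph (Fin n) | IsSplitGraph G}.ncard : ℝ)
  have h0 := largeCliqueError_nonneg n
  have hK : ∀ K : Finset (Fin n), ((nonsplitChordal K).ncard : ℝ) ≤
      2 ^ (K.card * Kᶜ.card) * (2 * largeCliqueError n) +
        2 * (n + 1) ^ n * 0.995 ^ (n * n) * s := by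
    intro K
    by_cases h : 2 * n ≤ 5 * K.card
    · exact (ncard_nonsplitChordal_le_of_large h hn hx).trans
        (le_add_of_nonneg_right (by positivity))
    · exact (ncard_nonsplitChordal_le_of_small (not_le.1 h)).trans
        (le_add_of_nonneg_left (by positivity))
  calc _ ≤ ∑ K : Finset (Fin n), ((nonsplitChordal K).ncard : ℝ) := by
        exact_mod_cast ncard_nonsplit_le_sum n
    _ ≤ _ := Finset.sum_le_sum fun K _ => hK K
    _ = (∑ K : Finset (Fin n), (2 : ℝ) ^ (K.card * Kᶜ.card)) * (2 * largeCliqueError n) +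
        2 ^ n * (2 * (n + 1) ^ n * 0.995 ^ (n * n) * s) := by
        rw [Finset.sum_add_distrib, Finset.sum_mul]
        simp
    _ ≤ (n + 1) ^ 2 * s * (2 * largeCliqueError n) +
        2 ^ n * (2 * (n + 1) ^ n * 0.995 ^ (n * n) * s) := by gcongr
    _ = _ := by
        rw [mul_pow, mul_pow, ← pow_mul]
        ring

end SplitCount

section Limits

lemma tendsto_pow_of_tendsto_zero {a : ℕ → ℝ} {N : ℕ → ℕ} (ha0 : ∀ n, 0 ≤ a n)
    (ha : Tendsto a atTop (𝓝 0)) (hN : Tendsto N atTop atTop) :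
    Tendsto (fun n => a n ^ N n) atTop (𝓝 0) := by
  have h1 : Tendsto (fun n => (1 / 2 : ℝ) ^ N n) atTop (𝓝 0) :=
    (tendsto_pow_atTop_nhds_zero_of_lt_one (by norm_num) (by norm_num)).comp hN
  refine tendsto_of_tendsto_of_tendsto_of_le_of_le' tendsto_const_nhds h1
    (Eventually.of_forall fun n => pow_nonneg (ha0 n) _) ?_
  filter_upwards [ha.eventually (ge_mem_nhds (by norm_num : (0 : ℝ) < 1 / 2))] with n hn
  exact pow_le_pow_left₀ (ha0 n) hn _

lemma tendsto_add_one_pow_mul_pow (a : ℕ) {r : ℝ} (h0 : 0 < r) (h1 : r < 1) :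
    Tendsto (fun n : ℕ => ((n : ℝ) + 1) ^ a * r ^ n) atTop (𝓝 0) := by
  have h := ((tendsto_pow_const_mul_const_pow_of_abs_lt_one a (by rwa [abs_of_pos h0])).comp
    (tendsto_add_atTop_nat 1)).const_mul r⁻¹
  rw [mul_zero] at h
  refine h.congr fun n => ?_
  simp only [Function.comp_apply]
  push_cast
  rw [pow_succ]
  field_simp

lemma tendsto_sqrt_atTop : Tendsto Nat.sqrt atTop atTop :=
  tendsto_atTop_atTop.2 fun b => ⟨b * b, fun _ h => Nat.le_sqrt.2 h⟩

lemma add_one_le_sqrt_add_one_sq (n : ℕ) : (n : ℝ) + 1 ≤ ((Nat.sqrt n : ℝ) + 1) ^ 2 := by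
  have := Nat.succ_le_succ_sqrt' n
  exact_mod_cast this

lemma tendsto_sq_mul_largeCliqueError :
    Tendsto (fun n : ℕ => ((n : ℝ) + 1) ^ 2 * largeCliqueError n) atTop (𝓝 0) := by
  have h1 : Tendsto (fun n : ℕ => ((Nat.sqrt n : ℝ) + 1) ^ 8 * (1 / 2) ^ Nat.sqrt n) atTop (𝓝 0) :=
    (tendsto_add_one_pow_mul_pow 8 (by norm_num) (by norm_num)).comp tendsto_sqrt_atTop
  have h2 : Tendsto (fun n : ℕ => ((0.97 : ℝ) ^ 4)⁻¹ * (((Nat.sqrt n : ℝ) + 1) ^ 2 *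
      0.97 ^ Nat.sqrt n)) atTop (𝓝 0) := by
    have := ((tendsto_add_one_pow_mul_pow 2 (r := 0.97) (by norm_num) (by norm_num)).comp
      tendsto_sqrt_atTop).const_mul ((0.97 : ℝ) ^ 4)⁻¹
    rwa [mul_zero] at this
  have h3 := tendsto_pow_of_tendsto_zero (fun n => by positivity) h2
    ((tendsto_add_atTop_nat 4).comp tendsto_sqrt_atTop)
  have h4 := h1.add h3
  rw [add_zero] at h4
  refine tendsto_of_tendsto_of_tendsto_of_le_of_le tendsto_const_nhds h4
    (fun n => mul_nonneg (by positivity) (largeCliqueError_nonneg n)) fun n => ?_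
  simp only [largeCliqueError, mul_add, Function.comp_apply]
  set L := Nat.sqrt n with hL
  have hle := add_one_le_sqrt_add_one_sq n
  rw [← hL] at hle
  apply add_le_add
  · calc ((n : ℝ) + 1) ^ 2 * ((n + 1) ^ 2 / 2 ^ L) = (n + 1) ^ 4 * (1 / 2) ^ L := by
          rw [one_div, inv_pow]; ring
      _ ≤ (((L : ℝ) + 1) ^ 2) ^ 4 * (1 / 2) ^ L := by gcongr
      _ = _ := by rw [← pow_mul]
  · -- the exponent `n` is at least `L ^ 2`, that is `(L + 4) * (L - 4)` up to a constant
    have hn : L * (L + 4) ≤ n + 4 * (L + 4) := by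
      have := Nat.sqrt_le' n
      rw [← hL] at this
      nlinarith
    calc ((n : ℝ) + 1) ^ 2 * ((n + 1) ^ (L + 2) * 0.97 ^ n) = (n + 1) ^ (L + 4) * 0.97 ^ n := by
          ring
      _ = (n + 1) ^ (L + 4) * ((((0.97 : ℝ) ^ 4)⁻¹) ^ (L + 4) * 0.97 ^ (n + 4 * (L + 4))) := by
          rw [pow_add 0.97 n, pow_mul 0.97 4, mul_comm (0.97 ^ n), ← mul_assoc (_⁻¹ ^ _), ← mul_pow,
            inv_mul_cancel₀ (by positivity), one_pow, one_mul]
      _ ≤ (((L : ℝ) + 1) ^ 2) ^ (L + 4) * ((((0.97 : ℝ) ^ 4)⁻¹) ^ (L + 4) *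
          0.97 ^ (L * (L + 4))) := by
          have := pow_le_pow_of_le_one (by norm_num : (0 : ℝ) ≤ 0.97) (by norm_num) hn
          gcongr
      _ = _ := by
          rw [pow_mul 0.97 L, mul_pow, mul_pow]
          ring

lemma tendsto_largeCliqueError : Tendsto largeCliqueError atTop (𝓝 0) := by
  refine tendsto_of_tendsto_of_tendsto_of_le_of_le tendsto_const_nhds
    tendsto_sq_mul_largeCliqueError largeCliqueError_nonneg fun n => ?_
  have h1 : (1 : ℝ) ≤ ((n : ℝ) + 1) ^ 2 := one_le_pow₀ (by simp)
  exact le_mul_of_one_le_left (largeCliqueError_nonneg n) h1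

/-- The number of chordal graphs that are not split is of smaller order than the number of split
graphs. -/
theorem tendsto_ncard_nonsplit_div : Tendsto (fun n : ℕ =>
    ({G : SimpleGraph (Fin n) | IsChordalGraph G ∧ ¬ IsSplitGraph G}.ncard : ℝ) /
      ({G : SimpleGraph (Fin n) | IsSplitGraph G}.ncard : ℝ)) atTop (𝓝 0) := by
  have h1 : Tendsto (fun n : ℕ => (2 * ((n : ℝ) + 1) * 0.995 ^ n) ^ n) atTop (𝓝 0) := by
    refine tendsto_pow_of_tendsto_zero (fun n => by positivity) ?_ tendsto_id
    have := (tendsto_add_one_pow_mul_pow 1 (r := 0.995) (by norm_num) (by norm_num)).const_mul 2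
    simpa [mul_assoc] using this
  have h2 := (tendsto_sq_mul_largeCliqueError.const_mul 2).add (h1.const_mul 2)
  simp only [mul_zero, add_zero] at h2
  refine tendsto_of_tendsto_of_tendsto_of_le_of_le' tendsto_const_nhds h2
    (Eventually.of_forall fun n => by positivity) ?_
  filter_upwards [eventually_ge_atTop 7,
    tendsto_largeCliqueError.eventually (ge_mem_nhds (by norm_num : (0 : ℝ) < 1))] with n hn hx
  refine div_le_of_le_mul₀ (by positivity) ?_ (ncard_nonsplit_le hn hx)
  have := largeCliqueError_nonneg n
  positivity

/-! ### The proportion of pairs -/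

lemma ncard_offDiag {α : Type*} {s : Set α} (hs : s.Finite) :
    s.offDiag.ncard = s.ncard * s.ncard - s.ncard := by
  classical
  obtain ⟨t, rfl⟩ := hs.exists_finset_coe
  rw [← Finset.coe_offDiag, Set.ncard_coe_finset, Set.ncard_coe_finset, Finset.offDiag_card]

lemma rhombusProportion_chordalGraphPolytope_ge (n : ℕ) (hn : 2 ≤ n) :
    1 - 4 * (({G : SimpleGraph (Fin n) | IsChordalGraph G ∧ ¬ IsSplitGraph G}.ncard : ℝ) /
      ({G : SimpleGraph (Fin n) | IsSplitGraph G}.ncard : ℝ)) ≤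
      rhombusProportion (chordalGraphPolytope n) := by
  set S := {G : SimpleGraph (Fin n) | IsSplitGraph G}
  set C := {G : SimpleGraph (Fin n) | IsChordalGraph G}
  set X := {G : SimpleGraph (Fin n) | IsChordalGraph G ∧ ¬ IsSplitGraph G}
  have hSC : S ⊆ C := fun G hG => IsSplitGraph.isChordalGraph hG
  have hC : C.ncard = S.ncard + X.ncard := by
    rw [← Set.ncard_union_eq (Set.disjoint_left.2 fun G hG hX => hX.2 hG)]
    congr 1
    ext G
    by_cases h : IsSplitGraph G
    · simp [C, S, X, h, h.isChordalGraph]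
    · simp [C, S, X, h]
  have hS2 : 2 ≤ S.ncard := by
    have : _ ≤ S.ncard := two_pow_le_ncard_isSplitGraph (n := n) 1 (by omega)
    have h2 : 2 ^ 1 ≤ 2 ^ (1 * (n - 1)) := Nat.pow_le_pow_right (by norm_num) (by omega)
    omega
  have hden : (((chordalGraphPolytope n).extremePoints ℝ).offDiag.ncard : ℝ) =
      C.ncard * C.ncard - C.ncard := by
    rw [extremePoints_chordalGraphPolytope, ncard_offDiag (Set.toFinite _),
      Set.ncard_image_of_injective _ charImset_injective, Nat.cast_sub (Nat.le_mul_self _)]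
    push_cast
    rfl
  have hnum : (S.ncard * S.ncard - S.ncard : ℝ) ≤
      ({p ∈ ((chordalGraphPolytope n).extremePoints ℝ).offDiag |
        FulfillsRhombus (chordalGraphPolytope n) p.1 p.2}.ncard : ℝ) := by
    have h1 : ((charImset '' S).offDiag.ncard : ℝ) = S.ncard * S.ncard - S.ncard := by
      rw [ncard_offDiag (Set.toFinite _), Set.ncard_image_of_injective _ charImset_injective,
        Nat.cast_sub (Nat.le_mul_self _)]
      push_cast
      rfl
    rw [← h1, extremePoints_chordalGraphPolytope]
    have hfin : (charImset '' C).offDiag.Finite := (Set.toFinite (charImset '' C)).offDiag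
    refine Nat.cast_le.2 (Set.ncard_le_ncard ?_ (hfin.subset (Set.sep_subset _ _)))
    rintro ⟨x, y⟩ ⟨⟨G, hG, rfl⟩, ⟨H, hH, rfl⟩, hne⟩
    exact ⟨⟨⟨G, hSC hG, rfl⟩, ⟨H, hSC hH, rfl⟩, hne⟩,
      fulfillsRhombus_of_isSplitGraph (fun h => hne (congrArg charImset h)) hG hH⟩
  have hs : (2 : ℝ) ≤ S.ncard := by exact_mod_cast hS2
  have hx : (0 : ℝ) ≤ X.ncard := Nat.cast_nonneg _
  have hc : (C.ncard : ℝ) = S.ncard + X.ncard := by exact_mod_cast hC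
  unfold rhombusProportion
  rw [hden, hc]
  generalize (S.ncard : ℝ) = s at *
  generalize (X.ncard : ℝ) = x at *
  refine le_trans ?_ (div_le_div_of_nonneg_right hnum (by nlinarith))
  rw [le_div_iff₀ (by nlinarith), ← mul_div_assoc, sub_mul, div_mul_eq_mul_div, sub_le_iff_le_add,
    ← sub_le_iff_le_add', le_div_iff₀ (by linarith)]
  nlinarith [mul_nonneg hx hx, mul_nonneg hx (sub_nonneg.2 hs), mul_nonneg (mul_nonneg hx hx) hx,
    mul_nonneg (mul_nonneg hx (sub_nonneg.2 hs)) (sub_nonneg.2 hs),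
    mul_nonneg (mul_nonneg hx hx) (sub_nonneg.2 hs)]

lemma rhombusProportion_le_one {E : Type*} [AddCommGroup E] [Module ℝ E] [TopologicalSpace E]
    {P : Set E} (hP : (P.extremePoints ℝ).Finite) : rhombusProportion P ≤ 1 :=
  div_le_one_of_le₀ (Nat.cast_le.2 (Set.ncard_le_ncard (Set.sep_subset _ _) hP.offDiag))
    (Nat.cast_nonneg _)

theorem tendsto_rhombusProportion_chordalGraphPolytope :
    Tendsto (fun n : ℕ => rhombusProportion (chordalGraphPolytope n)) atTop (𝓝 1) := by
  have h := (tendsto_ncard_nonsplit_div.const_mul 4).const_sub 1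
  rw [mul_zero, sub_zero] at h
  refine tendsto_of_tendsto_of_tendsto_of_le_of_le' h tendsto_const_nhds ?_
    (Eventually.of_forall fun n => rhombusProportion_le_one ?_)
  · filter_upwards [eventually_ge_atTop 2] with n hn
    exact rhombusProportion_chordalGraphPolytope_ge n hn
  · rw [extremePoints_chordalGraphPolytope]
    exact Set.toFinite _

end Limits

theorem mainTheorem1 :
    (∀ (n : ℕ) (G H : SimpleGraph (Fin n)), G ≠ H → IsSplitGraph G → IsSplitGraph H →
      charImset G ∈ (chordalGraphPolytope n).extremePoints ℝ ∧
      charImset H ∈ (chordalGraphPolytope n).extremePoints ℝ ∧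
      FulfillsRhombus (chordalGraphPolytope n) (charImset G) (charImset H)) ∧
    Tendsto (fun n : ℕ => rhombusProportion (chordalGraphPolytope n)) atTop (𝓝 1) := by
  refine ⟨fun n G H hne hG hH => ⟨?_, ?_, fulfillsRhombus_of_isSplitGraph hne hG hH⟩,
    tendsto_rhombusProportion_chordalGraphPolytope⟩
  · rw [extremePoints_chordalGraphPolytope]; exact ⟨G, hG.isChordalGraph, rfl⟩
  · rw [extremePoints_chordalGraphPolytope]; exact ⟨H, hH.isChordalGraph, rfl⟩
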